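/- Let $K$ be an infinite field, let $A=\bigoplus_{i\ge 0}A_i$ be a standard graded $K$-algebra ($A_0=K$, and $A$ is generated over $K$ by the finite-dimensional space $A_1$), and let $I\subseteq A$ be a homogeneous ideal. Let $\mathcal R(I)=A[It]=\bigoplus_{j\ge 0}I^jt^j$ be the Rees algebra, bigraded by $\mathcal R(I)_{(i,j)}=(I^j)_it^j$. Let $x_1,\dots,x_n$ span $A_1$ over $K$, let $f_1,\dots,f_m$ be homogeneous generators of $I$, and regard $\mathcal R(I)$ as a bigraded module over $S=K[x_1,\dots,x_n,y_1,\dots,y_m]$ via $x_i\mapsto x_i$, $y_j\mapsto f_jt$ (so each $x_i$ has $y$-degree $0$ and each $y_j$ has $y$-degree $1$). Put $t_{i}=\sup\{j:\operatorname{Tor}_i^S(\mathcal R(I),K)_{(*,j)}\ne 0\}$ (with $t_i=-\infty$ if there is no such $j$) and $\operatorname{reg}_y(\mathcal R(I))=\sup\{t_i-i: i\ge 0\}$. Then the following are equivalent: (a) $\operatorname{reg}_y(\mathcal R(I))=0$. (b) $I$ is generated by a $d$-sequence. (c) $I$ is generated by a strong $s$-sequence, and $I$ is of linear type. (d) $I$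 is generated by a $c$-sequence. (e) $I$ is generated by a proper sequence, and $I$ is of linear type. (f) $I$ is generated by a weak relative regular sequence, and $I$ is of linear type. Here $I$ is of linear type if the canonical surjection $\operatorname{Sym}(I)\to\mathcal R(I)$ is an isomorphism. Sequences are finite sequences $a_1,\dots,a_r$ of arbitrary (not necessarily homogeneous) elements of $A$, and "$I$ is generated by a sequence with property $P$" means that some sequence with property $P$ satisfies $(a_1,\dots,a_r)=I$. Writing $I=(a_1,\dots,a_r)$ and $I_i=(a_1,\dots,a_i)$, with $I_0=0$, the sequence is - a $d$-sequence if $(I_{i-1}:a_i)\cap I=I_{i-1}$ for all $i=1,\dots,r$; - a weak relative regular sequence if $(I_{i-1}I:a_i)\cap I=I_{i-1}$ for all $i$; - a $c$-sequence if $(I_{i-1}I^k:a_i)\cap I^k=I_{i-1}I^{k-1}$ for all $i$ and all $k\ge 1$; - a proper sequence if $a_iH_j(a_1,\dots,a_{i-1})=0$ for all $i$ and all $j\ge 1$, where $H_j(a_1,\dots,a_{i-1})$ is the homology of the Koszul complex of $a_1,\dots,a_{i-1}$ over $A$; - a strong $s$-sequence if, with $L_i=(I_{i-1}:a_i)$ and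 $J$ the kernel of $A[y_1,\dots,y_r]\to\operatorname{Sym}(I)$, $y_i\mapsto a_i$, one has $L_1\subseteq L_2\subseteq\dots\subseteq L_r$ and $\operatorname{in}(J)=(L_1y_1,\dots,L_ry_r)$, where $\operatorname{in}(J)$ is the ideal generated by the leading terms (with their coefficients in $A$) of the elements of $J$ for the degree reverse lexicographic order with $y_1<y_2<\dots<y_r$. -/

import Mathlib

open Finset

/-! ### Standard graded algebras -/

/-- A grading `𝒜` of a `K`-algebra `A` is *standard* if `A₀ = K`, the vector space `A₁` is
finite-dimensional, and `A` is generated by `A₁` as a `K`-algebra.  (For a nonzero ring `A` the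
condition `A₀ = K · 1` says that `A₀` is a copy of `K`.) -/
structure IsStandardGraded {K A : Type*} [Field K] [CommRing A] [Algebra K A]
    (𝒜 : ℕ → Submodule K A) : Prop where
  degree_zero : 𝒜 0 = 1
  finite_degree_one : Module.Finite K (𝒜 1)
  adjoin_degree_one : Algebra.adjoin K (𝒜 1 : Set A) = ⊤

/-! ### The Koszul complex -/

section Koszul

variable {R : Type*} [CommRing R] {n : ℕ}

/-- The differential of the Koszul complex `K(a₁, …, aₙ; R)`.  An element of the exterior algebra
`⋀ Rⁿ` is written as the family of its coefficients `ω T` at the basis elements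
`e_T = e_{t₀} ∧ ⋯ ∧ e_{tₚ}`, for `T = {t₀ < ⋯ < tₚ}`, and the differential is
`e_T ↦ ∑ₛ (-1)ˢ a_{tₛ} e_{T \ {tₛ}}`. -/
def koszulD (a : Fin n → R) : (Finset (Fin n) → R) →ₗ[R] (Finset (Fin n) → R) where
  toFun ω T := ∑ k ∈ Tᶜ, (-1) ^ #{t ∈ T | t < k} * a k * ω (insert k T)
  map_add' ω η := by
    funext T
    simp [mul_add, Finset.sum_add_distrib]
  map_smul' c ω := by
    funext T
    simp [Finset.mul_sum, mul_left_comm]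

/-- The Koszul differential squares to zero, so boundaries are cycles. -/
theorem koszulD_koszulD {R : Type*} [CommRing R] {n : ℕ} (a : Fin n → R)
    (ω : Finset (Fin n) → R) : koszulD a (koszulD a ω) = 0 := by
  funext T
  simp only [koszulD, LinearMap.coe_mk, AddHom.coe_mk, Pi.zero_apply, Finset.mul_sum]
  rw [Finset.sum_sigma']
  refine Finset.sum_involution (fun p _ => ⟨p.2, p.1⟩) ?_ ?_ ?_ ?_
  · rintro ⟨k, l⟩ h
    simp only [mem_sigma, mem_compl, mem_insert, not_or] at h
    obtain ⟨hk, hlk, hl⟩ := h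
    have e : ∀ u v : Fin n, u ∉ T → v ∉ T → u ≠ v → #{t ∈ insert u T | t < v} =
        #{t ∈ T | t < v} + if u < v then 1 else 0 := by
      intro u v hu hv huv
      rw [Finset.filter_insert]
      split_ifs
      · rw [Finset.card_insert_of_notMem (by simp [hu])]
      · simp
    simp only
    rw [e k l hk hl (Ne.symm hlk), e l k hl hk hlk, Finset.insert_comm k l]
    rcases lt_or_gt_of_ne hlk with h | h
    · rw [if_pos h, if_neg (not_lt.2 h.le)]; ring
    · rw [if_pos h, if_neg (not_lt.2 h.le)]; ring
  · rintro ⟨k, l⟩ h hne heq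
    simp only [mem_sigma, mem_compl, mem_insert, not_or] at h
    simp at heq
    exact h.2.1 heq.1
  · rintro ⟨k, l⟩ h
    simp only [mem_sigma, mem_compl, mem_insert, not_or] at h ⊢
    exact ⟨h.2.2, fun e => h.2.1 e.symm, h.1⟩
  · rintro ⟨k, l⟩ h; rfl

variable (R n) in
/-- The elements of homological degree `j`: those supported on the `e_T` with `#T = j`. -/
def koszulChains (j : ℕ) : Submodule R (Finset (Fin n) → R) where
  carrier := {ω | ∀ T, #T ≠ j → ω T = 0}
  add_mem' hω hη T hT := by simp [hω T hT, hη T hT]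
  zero_mem' _ _ := rfl
  smul_mem' c ω hω T hT := by simp [hω T hT]

/-- Cycles of degree `j` in the Koszul complex. -/
def koszulCycles (a : Fin n → R) (j : ℕ) : Submodule R (Finset (Fin n) → R) :=
  koszulChains R n j ⊓ LinearMap.ker (koszulD a)

/-- Boundaries of degree `j` in the Koszul complex. -/
def koszulBoundaries (a : Fin n → R) (j : ℕ) : Submodule R (Finset (Fin n) → R) :=
  (koszulChains R n (j + 1)).map (koszulD a)

/-- The Koszul homology module `H_j(a₁, …, aₙ)` over `R`. -/
abbrev KoszulHomology (a : Fin n → R) (j : ℕ) : Type _ :=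
  koszulCycles a j ⧸ (koszulBoundaries a j).submoduleOf (koszulCycles a j)

end Koszul

/-! ### Symmetric algebra, Rees algebra, linear type -/

section Rees

variable {A : Type*} [CommRing A]

/-- The inclusion of `I` in the Rees algebra `A[It]` as its part of degree one: `u ↦ u t`. -/
noncomputable def reesι (I : Ideal A) : I →ₗ[A] reesAlgebra I where
  toFun u := ⟨Polynomial.monomial 1 (u : A), reesAlgebra.monomial_mem.2 (by simp)⟩
  map_add' u v := by ext1; simp
  map_smul' c u := by ext1; simp [Polynomial.smul_monomial]

/-- `I` is of linear type: the canonical surjection `Sym(I) → A[It]`, `u ↦ u t`, is an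
isomorphism. -/
def IsLinearType (I : Ideal A) : Prop :=
  Function.Bijective (SymmetricAlgebra.lift (reesι I))

end Rees

/-! ### The `y`-regularity of the Rees algebra -/

section Regularity

variable {A : Type*} [CommRing A] {n m : ℕ} {I : Ideal A}

/-- The images in the Rees algebra of the variables `x₁, …, xₙ, y₁, …, yₘ` of the bigraded
polynomial ring `S = K[x₁, …, xₙ, y₁, …, yₘ]` presenting it: the variable `xᵢ` goes to `x i ∈ A`
and the variable `yⱼ` goes to `f j · t`. -/
noncomputable def reesVariables (x : Fin n → A) (f : Fin m → I) :
    Fin (n + m) → reesAlgebra I :=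
  Fin.append (fun i => algebraMap A (reesAlgebra I) (x i)) (fun j => reesι I (f j))

variable (n m I) in
/-- The part of `y`-degree `j` of the Koszul complex on `x₁, …, xₙ, y₁, …, yₘ` with coefficients
in the Rees algebra.  An element of `Iᵏ tᵏ` has `y`-degree `k`, and each basis vector belonging to
one of the `y`-variables has `y`-degree `1`, each one belonging to an `x`-variable has
`y`-degree `0`. -/
def yDegreeChains (j : ℕ) : AddSubgroup (Finset (Fin (n + m)) → reesAlgebra I) where
  carrier := {ω | ∀ (T : Finset (Fin (n + m))) (k : ℕ),
    k + #{t ∈ T | n ≤ Fin.val t} ≠ j → (ω T : Polynomial A).coeff k = 0}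
  add_mem' hω hη T k hk := by simp [hω T k hk, hη T k hk]
  zero_mem' T k _ := by simp
  neg_mem' hω T k hk := by simp [hω T k hk]

/-- `Tor_i^S(R(I), K)` for `S = K[x₁, …, xₙ, y₁, …, yₘ]`.  The Koszul complex on the variables is
the minimal bigraded free resolution of `K = S / (x, y)` over `S`, so this `Tor` is the homology of
its tensor product with `R(I)`, which is the Koszul complex over `R(I)` on the images of
the variables. -/
abbrev ReesTor (x : Fin n → A) (f : Fin m → I) (i : ℕ) : Type _ :=
  KoszulHomology (reesVariables x f) i

/-- The graded part `Tor_i^S(R(I), K)_{(*, j)}` of `y`-degree `j`. -/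
noncomputable def yReesTor (x : Fin n → A) (f : Fin m → I) (i j : ℕ) : AddSubgroup (ReesTor x f i) :=
  ((yDegreeChains n m I j).comap (koszulCycles (reesVariables x f) i).subtype.toAddMonoidHom).map
    (Submodule.mkQ _).toAddMonoidHom

/-- `t_{i,y}(R(I)) = sup {j | Tor_i^S(R(I), K)_{(*, j)} ≠ 0}`, which is `-∞` if there is no
such `j`. -/
noncomputable def yTop (x : Fin n → A) (f : Fin m → I) (i : ℕ) : EReal :=
  ⨆ (j : ℕ) (_ : yReesTor x f i j ≠ ⊥), (j : EReal)

/-- The `y`-regularity `reg_y(R(I)) = sup {t_{i,y}(R(I)) - i | i ≥ 0}`, with respect to the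
presentation of `R(I)` by the variables `xᵢ ↦ x i` and `yⱼ ↦ f j · t`. -/
noncomputable def yRegularity (x : Fin n → A) (f : Fin m → I) : EReal :=
  ⨆ i : ℕ, yTop x f i - (i : EReal)

end Regularity

/-! ### Sequences -/

section Sequences

variable {A : Type*} [CommRing A] {n : ℕ}

/-- The ideal `(a₁, …, a_{i-1})`. -/
def initSpan (a : Fin n → A) (i : Fin n) : Ideal A :=
  Ideal.span (a '' Set.Iio i)

/-- `d`-sequences: `((a₁, …, a_{i-1}) : aᵢ) ∩ I = (a₁, …, a_{i-1})` for all `i`. -/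
def IsDSequence (a : Fin n → A) : Prop :=
  ∀ i, (initSpan a i).colon {a i} ⊓ Ideal.span (Set.range a) = initSpan a i

/-- Weak relative regular sequences: `((a₁, …, a_{i-1}) I : aᵢ) ∩ I = (a₁, …, a_{i-1})` for all
`i`. -/
def IsWeakRelativeRegularSequence (a : Fin n → A) : Prop :=
  ∀ i, (initSpan a i * Ideal.span (Set.range a)).colon {a i} ⊓ Ideal.span (Set.range a) =
    initSpan a i

/-- `c`-sequences: `((a₁, …, a_{i-1}) Iᵏ : aᵢ) ∩ Iᵏ = (a₁, …, a_{i-1}) Iᵏ⁻¹` for all `i` and all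
`k ≥ 1`. -/
def IsCSequence (a : Fin n → A) : Prop :=
  ∀ i, ∀ k : ℕ, 1 ≤ k →
    (initSpan a i * Ideal.span (Set.range a) ^ k).colon {a i} ⊓ Ideal.span (Set.range a) ^ k =
      initSpan a i * Ideal.span (Set.range a) ^ (k - 1)

/-- Proper sequences: `aᵢ H_j(a₁, …, a_{i-1}) = 0` for all `i` and all `j ≥ 1`. -/
def IsProperSequence (a : Fin n → A) : Prop :=
  ∀ i : Fin n, ∀ j : ℕ, 1 ≤ j →
    ∀ h : KoszulHomology (fun l : Fin i => a (Fin.castLE i.isLt.le l)) j, a i • h = 0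

/-- The (degree) reverse lexicographic order on the monomials in `y₁ < y₂ < ⋯ < yₙ`: `y^α < y^β`
if `y^α` has smaller degree, or if both have the same degree and, for the smallest variable whose
exponents in the two monomials differ, the exponent in `y^α` is the larger one. -/
def RevLexLT (α β : Fin n →₀ ℕ) : Prop :=
  α.degree < β.degree ∨
    (α.degree = β.degree ∧ ∃ i, (∀ l < i, α l = β l) ∧ β i < α i)

/-- The initial ideal of an ideal `J` of `A[y₁, …, yₙ]` for the reverse lexicographic order: it is
generated by the leading terms (leading monomial times its coefficient in `A`) of the elements of
`J`. -/
noncomputable def initialIdeal (J : Ideal (MvPolynomial (Fin n) A)) : Ideal (MvPolynomial (Fin n) A) :=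
  Ideal.span {g | ∃ p ∈ J, ∃ α ∈ p.support,
    (∀ β ∈ p.support, β ≠ α → RevLexLT β α) ∧ g = MvPolynomial.monomial α (p.coeff α)}

/-- The defining ideal `J` of the symmetric algebra of `I = (a₁, …, aₙ)`, i.e. the kernel of the
surjection `A[y₁, …, yₙ] → Sym(I)`, `yᵢ ↦ aᵢ`. -/
noncomputable def symRelations (a : Fin n → A) : Ideal (MvPolynomial (Fin n) A) :=
  RingHom.ker (MvPolynomial.aeval (R := A) fun i =>
    SymmetricAlgebra.ι A (Ideal.span (Set.range a)) ⟨a i, Ideal.subset_span ⟨i, rfl⟩⟩)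

/-- Strong `s`-sequences (for the reverse lexicographic order): with
`Lᵢ = ((a₁, …, a_{i-1}) : aᵢ)`, one has `in(J) = (L₁ y₁, …, Lₙ yₙ)` and `L₁ ⊆ L₂ ⊆ ⋯ ⊆ Lₙ`. -/
def IsStrongSSequence (a : Fin n → A) : Prop :=
  initialIdeal (symRelations a) =
      ⨆ i, ((initSpan a i).colon {a i}).map MvPolynomial.C * Ideal.span {MvPolynomial.X i} ∧
    Monotone fun i => (initSpan a i).colon {a i}

/-- `I` is generated by a finite sequence with the property `P`. -/
def IsGeneratedBy (P : ∀ {n : ℕ}, (Fin n → A) → Prop) (I : Ideal A) : Prop :=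
  ∃ (n : ℕ) (a : Fin n → A), Ideal.span (Set.range a) = I ∧ P a

end Sequences

/-! ### Wedge products and contractions on the Koszul complex -/

section KoszulCore

variable {A : Type*} [CommRing A] {N : ℕ}

/-! The common measure of all six conditions is the Koszul homology over the Rees algebra, split by
`y`-degree and written with coefficients in powers of `I`. Adjoining one variable `p` of `y`-degree
`d` to a set `S` gives the exact sequence H_{i+1}(S)_j → H_{i+1}(S ∪ p)_j → H_i(S)_{j-d} → H_i(S)_j
whose last map is multiplication by `a p`; it is used throughout in the form of
`KoszulExact.insert_succ` and `KoszulExact.inj_of_insert`.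

Regularity zero means that H_i of all the variables vanishes in `y`-degrees above `i`. Graded
Nakayama removes the `x`-variables, and redundant generators can be added or deleted, so this is a
property `KoszulLinear` of `I` that may be tested on any generators, homogeneous or not.

A `c`-sequence says exactly that each `a_p t` acts injectively in positive degrees modulo its
predecessors (`RelInjective`), and the exact sequence then makes the homology linear: (d) ⇒ (a).
Conversely, over an infinite field generic combinations of generators are filter-regular, hence
injective in large degrees; linearity carries injectivity down to all positive degrees, and
Artin–Rees together with filter-regularity on the associated graded ring turns this into the
`d`-sequence condition: (a) ⇒ (b).

On the side of the symmetric algebra, a `d`-sequence is a `c`-sequence, and the `c`-condition allows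
a form vanishing at `a` to be rewritten by smaller variables. This gives linear type and identifies
the leading coefficients: (b) ⇒ (c). For (c) ⇒ (d), leading terms are cancelled against linear
relations until only monomials in earlier variables remain.

Finally, multiplying a Koszul cycle by an element of `I` moves it to a `y`-degree above its
homological degree, where homology vanishes; hence (d) ⇒ (e) and (d) ⇒ (f). Proper and weak relative
regular sequences both satisfy `KillsKoszulOne`, under which a Buchberger-type rewriting of linear
syzygies computes the initial ideal, so both lead back to (c). -/

theorem koszulD_apply (a : Fin N → A) (ω : Finset (Fin N) → A) (T : Finset (Fin N)) :
    koszulD a ω T = ∑ k ∈ Tᶜ, (-1) ^ #{t ∈ T | t < k} * a k * ω (insert k T) := rfl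

/-- The wedge product `ω ↦ e_p ∧ ω` on the exterior algebra. -/
def koszulWedge (p : Fin N) : (Finset (Fin N) → A) →ₗ[A] (Finset (Fin N) → A) where
  toFun ω T := if p ∈ T then (-1) ^ #{t ∈ T | t < p} * ω (T.erase p) else 0
  map_add' ω η := by
    funext T
    by_cases h : p ∈ T <;> simp [h, mul_add]
  map_smul' c ω := by
    funext T
    by_cases h : p ∈ T <;> simp [h, mul_left_comm]

theorem koszulWedge_apply (p : Fin N) (ω : Finset (Fin N) → A) (T : Finset (Fin N)) :
    koszulWedge p ω T = if p ∈ T then (-1) ^ #{t ∈ T | t < p} * ω (T.erase p) else 0 := rfl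

theorem card_filter_lt_insert {T : Finset (Fin N)} {u : Fin N} (hu : u ∉ T) (v : Fin N) :
    #{t ∈ insert u T | t < v} = #{t ∈ T | t < v} + if u < v then 1 else 0 := by
  rw [Finset.filter_insert]
  split_ifs
  · rw [Finset.card_insert_of_notMem (by simp [hu])]
  · simp

/-- The homotopy formula `∂(e_p ∧ ω) + e_p ∧ ∂ω = a_p ω`. -/
theorem koszulD_wedge (a : Fin N → A) (p : Fin N) (ω : Finset (Fin N) → A) :
    koszulD a (koszulWedge p ω) = a p • ω - koszulWedge p (koszulD a ω) := by
  funext T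
  rw [Pi.sub_apply, Pi.smul_apply, koszulD_apply, koszulWedge_apply, smul_eq_mul]
  by_cases hp : p ∈ T
  · obtain ⟨S, hS, rfl⟩ : ∃ S, p ∉ S ∧ insert p S = T := ⟨T.erase p, by simp, by simp [hp]⟩
    rw [if_pos hp, Finset.erase_insert hS, koszulD_apply,
      show Sᶜ = insert p (insert p S)ᶜ by ext t; by_cases h : t = p <;> simp [h, hS],
      Finset.sum_insert (by simp), mul_add, ← sub_sub]
    have h1 : (-1 : A) ^ #{t ∈ insert p S | t < p} *
        ((-1) ^ #{t ∈ S | t < p} * a p * ω (insert p S)) = a p * ω (insert p S) := by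
      rw [card_filter_lt_insert hS, if_neg (lt_irrefl _), add_zero, mul_assoc, ← mul_assoc,
        ← pow_add, ← two_mul, pow_mul]
      simp
    rw [h1, sub_self, zero_sub, Finset.mul_sum, ← Finset.sum_neg_distrib]
    refine Finset.sum_congr rfl fun k hk => ?_
    simp only [mem_compl, mem_insert, not_or] at hk
    have hS' : p ∉ insert k S := by simp [hS, Ne.symm hk.1]
    rw [koszulWedge_apply, if_pos (by simp), Finset.insert_comm,
      Finset.erase_insert hS', card_filter_lt_insert hS k, card_filter_lt_insert hS' p,
      card_filter_lt_insert hk.2 p, card_filter_lt_insert hS p]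
    rcases lt_or_gt_of_ne hk.1 with h | h
    · rw [if_pos h, if_neg (not_lt.2 h.le)]; simp; ring
    · rw [if_pos h, if_neg (not_lt.2 h.le)]; simp; ring
  · rw [if_neg hp, sub_zero, Finset.sum_eq_single p]
    · rw [koszulWedge_apply, if_pos (by simp), Finset.erase_insert hp,
        card_filter_lt_insert hp, if_neg (lt_irrefl _), add_zero, mul_comm _ (a p), mul_assoc,
        ← mul_assoc _ _ (ω T), ← pow_add, ← two_mul, pow_mul]
      simp
    · intro k _ hk
      rw [koszulWedge_apply, if_neg (by simp [hp, Ne.symm hk]), mul_zero]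
    · simp [hp]

/-- The `y`-degree of the `p`-th variable: `1` if it belongs to `Y` and `0` otherwise. -/
def varDegree (Y : Finset (Fin N)) (p : Fin N) : ℕ := if p ∈ Y then 1 else 0

/-- The Koszul chains of homological degree `i` that involve only the variables in `S` and that
have `y`-degree `j` in the Koszul complex over the Rees algebra of `I`: the coefficient at `e_T`
lies in `I ^ (j - #(T ∩ Y))`. -/
def reesChains (I : Ideal A) (Y S : Finset (Fin N)) (i j : ℕ) :
    Submodule A (Finset (Fin N) → A) where
  carrier := {ω | ∀ T, (ω T ≠ 0 → T ⊆ S ∧ #T = i) ∧ ω T ∈ I ^ (j - #(T ∩ Y))}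
  add_mem' {ω η} hω hη T := by
    refine ⟨fun h => ?_, add_mem (hω T).2 (hη T).2⟩
    by_cases h0 : ω T = 0
    · exact (hη T).1 fun h' => h (by simp [h0, h'])
    · exact (hω T).1 h0
  zero_mem' T := by simp
  smul_mem' c ω hω T :=
    ⟨fun h => (hω T).1 fun h' => h (by simp [h']), Ideal.mul_mem_left _ _ (hω T).2⟩

theorem mem_reesChains {I : Ideal A} {Y S : Finset (Fin N)} {i j : ℕ}
    {ω : Finset (Fin N) → A} : ω ∈ reesChains I Y S i j ↔
      ∀ T, (ω T ≠ 0 → T ⊆ S ∧ #T = i) ∧ ω T ∈ I ^ (j - #(T ∩ Y)) := Iff.rfl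

theorem reesChains_mono (I : Ideal A) (Y : Finset (Fin N)) {S S' : Finset (Fin N)} (h : S ⊆ S')
    (i : ℕ) {j j' : ℕ} (hj : j ≤ j') : reesChains I Y S i j' ≤ reesChains I Y S' i j :=
  fun _ hω T => ⟨fun h0 => ⟨((hω T).1 h0).1.trans h, ((hω T).1 h0).2⟩,
    Ideal.pow_le_pow_right (by omega) (hω T).2⟩

theorem card_insert_inter {Y T : Finset (Fin N)} {p : Fin N} (hp : p ∉ T) :
    #(insert p T ∩ Y) = #(T ∩ Y) + varDegree Y p := by
  unfold varDegree
  split_ifs with h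
  · rw [Finset.insert_inter_of_mem h, Finset.card_insert_of_notMem (by simp [hp])]
  · rw [Finset.insert_inter_of_notMem h, add_zero]

theorem mul_mem_pow_of_varDegree {I : Ideal A} {Y : Finset (Fin N)} {a : Fin N → A}
    (ha : ∀ k ∈ Y, a k ∈ I) (p : Fin N) {e e' : ℕ} (he : e' ≤ e + varDegree Y p) {w : A}
    (hw : w ∈ I ^ e) : a p * w ∈ I ^ e' := by
  refine Ideal.pow_le_pow_right he ?_
  unfold varDegree
  split_ifs with h
  · rw [pow_succ']; exact Ideal.mul_mem_mul (ha p h) hw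
  · exact Ideal.mul_mem_left _ _ hw

theorem neg_one_pow_mul_mem {J : Ideal A} (e : ℕ) {w : A} (hw : w ∈ J) : (-1) ^ e * w ∈ J :=
  Ideal.mul_mem_left _ _ hw

/-- Removing a basis vector of `y`-degree one is paid for by a factor in `I`. The subtraction in the
exponent is truncated; the inclusion survives truncation, but the chains have the intended meaning
only when the homological degree is at most `j`. -/
theorem koszulD_mem_reesChains {I : Ideal A} {Y S : Finset (Fin N)} {a : Fin N → A}
    (ha : ∀ k ∈ Y, a k ∈ I) {i j : ℕ} {ω : Finset (Fin N) → A}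
    (hω : ω ∈ reesChains I Y S (i + 1) j) : koszulD a ω ∈ reesChains I Y S i j := by
  intro T
  refine ⟨fun h => ?_, ?_⟩
  · obtain ⟨k, hk, h⟩ := Finset.exists_ne_zero_of_sum_ne_zero h
    obtain ⟨h1, h2⟩ := (hω (insert k T)).1 (right_ne_zero_of_mul h)
    rw [Finset.card_insert_of_notMem (by simpa using hk)] at h2
    exact ⟨(Finset.subset_insert _ _).trans h1, by omega⟩
  · refine sum_mem fun k hk => ?_
    rw [mul_assoc]
    refine neg_one_pow_mul_mem _ (mul_mem_pow_of_varDegree ha k ?_ (hω _).2)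
    rw [card_insert_inter (by simpa using hk)]
    omega

theorem smul_mem_reesChains {I : Ideal A} {Y S : Finset (Fin N)} {a : Fin N → A}
    (ha : ∀ k ∈ Y, a k ∈ I) (p : Fin N) {i j : ℕ} {ω : Finset (Fin N) → A}
    (hω : ω ∈ reesChains I Y S i j) : a p • ω ∈ reesChains I Y S i (j + varDegree Y p) :=
  fun T => ⟨fun h => (hω T).1 (right_ne_zero_of_mul h),
    mul_mem_pow_of_varDegree ha p (by omega) (hω T).2⟩

theorem koszulWedge_mem_reesChains {I : Ideal A} {Y S : Finset (Fin N)} (p : Fin N)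
    {i j : ℕ} {ω : Finset (Fin N) → A} (hω : ω ∈ reesChains I Y S i j) :
    koszulWedge p ω ∈ reesChains I Y (insert p S) (i + 1) (j + varDegree Y p) := by
  intro T
  rw [koszulWedge_apply]
  by_cases hT : p ∈ T
  · obtain ⟨T, hT', rfl⟩ : ∃ S, p ∉ S ∧ insert p S = T := ⟨T.erase p, by simp, by simp [hT]⟩
    replace hT := hT'
    rw [if_pos (by simp), Finset.erase_insert hT]
    refine ⟨fun h => ?_, neg_one_pow_mul_mem _ (Ideal.pow_le_pow_right ?_ (hω T).2)⟩
    · obtain ⟨h1, h2⟩ := (hω T).1 (right_ne_zero_of_mul h)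
      exact ⟨Finset.insert_subset_insert _ h1, by rw [Finset.card_insert_of_notMem hT, h2]⟩
    · rw [card_insert_inter hT]; omega
  · simp [hT]

theorem reesChains_apply_eq_zero {I : Ideal A} {Y S : Finset (Fin N)} {i j : ℕ}
    {ω : Finset (Fin N) → A} (hω : ω ∈ reesChains I Y S i j) {T : Finset (Fin N)}
    (hT : ¬ (T ⊆ S ∧ #T = i)) : ω T = 0 :=
  not_not.1 fun h => hT ((hω T).1 h)

/-- Every chain involving the variables in `S ∪ {p}` is `ω₀ + e_p ∧ ω₁` with chains `ω₀`, `ω₁`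
involving only the variables in `S`. -/
theorem exists_reesChains_decomposition {I : Ideal A} {Y S : Finset (Fin N)} {p : Fin N}
    (hp : p ∉ S) {i j : ℕ} {ω : Finset (Fin N) → A}
    (hω : ω ∈ reesChains I Y (insert p S) (i + 1) j) :
    ∃ ω₀ ∈ reesChains I Y S (i + 1) j, ∃ ω₁ ∈ reesChains I Y S i (j - varDegree Y p),
      ω = ω₀ + koszulWedge p ω₁ := by
  refine ⟨fun T => if p ∈ T then 0 else ω T, fun T => ?_,
    fun T => if p ∈ T then 0 else (-1) ^ #{t ∈ T | t < p} * ω (insert p T), fun T => ?_, ?_⟩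
  · by_cases hT : p ∈ T
    · simp [hT]
    · simp only [hT, if_false]
      refine ⟨fun h => ?_, (hω T).2⟩
      obtain ⟨h1, h2⟩ := (hω T).1 h
      exact ⟨(Finset.subset_insert_iff_of_notMem hT).1 h1, h2⟩
  · by_cases hT : p ∈ T
    · simp [hT]
    · simp only [hT, if_false]
      refine ⟨fun h => ?_, neg_one_pow_mul_mem _ (Ideal.pow_le_pow_right ?_ (hω (insert p T)).2)⟩
      · obtain ⟨h1, h2⟩ := (hω _).1 (right_ne_zero_of_mul h)
        rw [Finset.card_insert_of_notMem hT] at h2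
        refine ⟨fun t ht => ?_, by omega⟩
        rcases Finset.mem_insert.1 (h1 (Finset.mem_insert_of_mem ht)) with rfl | h
        · exact absurd ht hT
        · exact h
      · rw [card_insert_inter hT]; omega
  · funext T
    rw [Pi.add_apply, koszulWedge_apply]
    by_cases hT : p ∈ T
    · obtain ⟨T, hT', rfl⟩ : ∃ S, p ∉ S ∧ insert p S = T := ⟨T.erase p, by simp, by simp [hT]⟩
      rw [if_pos hT, if_pos hT, Finset.erase_insert hT', if_neg hT', zero_add,
        card_filter_lt_insert hT', if_neg (lt_irrefl _), add_zero, ← mul_assoc, ← pow_add,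
        ← two_mul, pow_mul]
      simp
    · simp [hT]

theorem reesChains_decomposition_unique {I : Ideal A} {Y S : Finset (Fin N)} {p : Fin N}
    (hp : p ∉ S) {i i' j j' : ℕ} {ω₀ ω₁ η₀ η₁ : Finset (Fin N) → A}
    (h0 : ω₀ ∈ reesChains I Y S i j) (h1 : ω₁ ∈ reesChains I Y S i' j')
    (e0 : η₀ ∈ reesChains I Y S i j) (e1 : η₁ ∈ reesChains I Y S i' j')
    (h : ω₀ + koszulWedge p ω₁ = η₀ + koszulWedge p η₁) : ω₀ = η₀ ∧ ω₁ = η₁ := by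
  constructor
  · funext T
    by_cases hT : p ∈ T
    · rw [reesChains_apply_eq_zero h0 fun h => hp (h.1 hT),
        reesChains_apply_eq_zero e0 fun h => hp (h.1 hT)]
    · simpa [koszulWedge_apply, hT] using congrFun h T
  · funext T
    by_cases hT : p ∈ T
    · rw [reesChains_apply_eq_zero h1 fun h => hp (h.1 hT),
        reesChains_apply_eq_zero e1 fun h => hp (h.1 hT)]
    · have := congrFun h (insert p T)
      rw [Pi.add_apply, Pi.add_apply, koszulWedge_apply, koszulWedge_apply, if_pos (by simp),
        if_pos (by simp), Finset.erase_insert hT,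
        reesChains_apply_eq_zero h0 fun h => hp (h.1 (by simp)),
        reesChains_apply_eq_zero e0 fun h => hp (h.1 (by simp)), zero_add, zero_add] at this
      have h2 : (-1 : A) ^ #{t ∈ insert p T | t < p} * (-1) ^ #{t ∈ insert p T | t < p} = 1 := by
        rw [← pow_add, ← two_mul, pow_mul]; simp
      calc ω₁ T = ((-1 : A) ^ #{t ∈ insert p T | t < p} * (-1) ^ #{t ∈ insert p T | t < p}) *
            ω₁ T := by rw [h2, one_mul]
        _ = η₁ T := by rw [mul_assoc, this, ← mul_assoc, h2, one_mul]

/-- The vanishing of the part of `y`-degree `j` of the `i`-th Koszul homology over the Rees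
algebra, for the variables in `S`. -/
def KoszulExact (a : Fin N → A) (I : Ideal A) (Y S : Finset (Fin N)) (i j : ℕ) : Prop :=
  ∀ ω ∈ reesChains I Y S i j, koszulD a ω = 0 →
    ∃ η ∈ reesChains I Y S (i + 1) j, koszulD a η = ω

/-- The injectivity of the multiplication with the `p`-th variable on the part of `y`-degree `j` of
the `i`-th Koszul homology over the Rees algebra, for the variables in `S`. -/
def KoszulInj (a : Fin N → A) (I : Ideal A) (Y S : Finset (Fin N)) (p : Fin N) (i j : ℕ) : Prop :=
  ∀ ω ∈ reesChains I Y S i j, koszulD a ω = 0 →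
    (∃ η ∈ reesChains I Y S (i + 1) (j + varDegree Y p), koszulD a η = a p • ω) →
      ∃ η ∈ reesChains I Y S (i + 1) j, koszulD a η = ω

theorem KoszulExact.inj {a : Fin N → A} {I : Ideal A} {Y S : Finset (Fin N)} {i j : ℕ}
    (h : KoszulExact a I Y S i j) (p : Fin N) : KoszulInj a I Y S p i j :=
  fun ω hω h0 _ => h ω hω h0

/-- The components of the boundary of `ω₀ + e_p ∧ ω₁`. -/
theorem koszulD_add_wedge (a : Fin N → A) (p : Fin N) (ω₀ ω₁ : Finset (Fin N) → A) :
    koszulD a (ω₀ + koszulWedge p ω₁) =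
      (koszulD a ω₀ + a p • ω₁) + koszulWedge p (-koszulD a ω₁) := by
  rw [map_add, koszulD_wedge, map_neg]; abel

theorem koszulD_eq_zero_of_degree_zero {I : Ideal A} {Y S : Finset (Fin N)} {a : Fin N → A}
    {j : ℕ} {ω : Finset (Fin N) → A} (hω : ω ∈ reesChains I Y S 0 j) : koszulD a ω = 0 := by
  funext T
  refine Finset.sum_eq_zero fun k hk => ?_
  rw [reesChains_apply_eq_zero hω, mul_zero]
  simp

/-- The two components of an equation `∂(η₀ + e_p ∧ η₁) = ω₀ + e_p ∧ ω₁`. -/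
theorem koszulD_components {I : Ideal A} {Y S : Finset (Fin N)} {a : Fin N → A}
    (ha : ∀ k ∈ Y, a k ∈ I) {p : Fin N} (hp : p ∉ S) {i j : ℕ}
    {η₀ η₁ ω₀ ω₁ : Finset (Fin N) → A}
    (h0 : η₀ ∈ reesChains I Y S (i + 1) j) (h1 : η₁ ∈ reesChains I Y S i (j - varDegree Y p))
    (w0 : ω₀ ∈ reesChains I Y S i j) {i' : ℕ} (hi : i = i' + 1 ∨ ω₁ = 0)
    (w1 : ω₁ ∈ reesChains I Y S i' (j - varDegree Y p))
    (h : koszulD a (η₀ + koszulWedge p η₁) = ω₀ + koszulWedge p ω₁) :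
    koszulD a η₀ + a p • η₁ = ω₀ ∧ koszulD a η₁ = -ω₁ := by
  rw [koszulD_add_wedge] at h
  have m0 : koszulD a η₀ + a p • η₁ ∈ reesChains I Y S i j :=
    add_mem (koszulD_mem_reesChains ha h0)
      (reesChains_mono I Y subset_rfl i (by omega) (smul_mem_reesChains ha p h1))
  rcases i with _ | i
  · rcases hi with hi | rfl
    · omega
    · rw [koszulD_eq_zero_of_degree_zero h1] at h ⊢
      simpa using h
  · have m1 : -koszulD a η₁ ∈ reesChains I Y S i (j - varDegree Y p) :=
      neg_mem (koszulD_mem_reesChains ha h1)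
    have w1' : ω₁ ∈ reesChains I Y S i (j - varDegree Y p) := by
      rcases hi with hi | rfl
      · obtain rfl : i = i' := by omega
        exact w1
      · exact zero_mem _
    obtain ⟨e0, e1⟩ := reesChains_decomposition_unique hp m0 m1 w0 w1' h
    exact ⟨e0, by rw [← e1, neg_neg]⟩

theorem mem_reesChains_zero_insert {I : Ideal A} {Y S : Finset (Fin N)} {p : Fin N} {j : ℕ}
    {ω : Finset (Fin N) → A} (hω : ω ∈ reesChains I Y (insert p S) 0 j) :
    ω ∈ reesChains I Y S 0 j := fun T => ⟨fun h => by
      have := ((hω T).1 h).2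
      exact ⟨by simp [Finset.card_eq_zero.1 this], this⟩, (hω T).2⟩

theorem KoszulExact.insert_zero {a : Fin N → A} {I : Ideal A} {Y S : Finset (Fin N)} {j : ℕ}
    (h : KoszulExact a I Y S 0 j) (p : Fin N) : KoszulExact a I Y (insert p S) 0 j := by
  intro ω hω h0
  obtain ⟨η, hη, e⟩ := h ω (mem_reesChains_zero_insert hω) h0
  exact ⟨η, reesChains_mono I Y (Finset.subset_insert _ _) _ le_rfl hη, e⟩

/-- The middle of the exact sequence: for a cycle `ω₀ + e_p ∧ ω₁`, the class of `ω₁` is killed by `a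
p`, hence zero; subtracting a boundary leaves a cycle not involving `p`. -/
theorem KoszulExact.insert_succ {a : Fin N → A} {I : Ideal A} {Y S : Finset (Fin N)}
    (ha : ∀ k ∈ Y, a k ∈ I) {p : Fin N} (hp : p ∉ S) {i j : ℕ} (hj : varDegree Y p ≤ j)
    (h : KoszulExact a I Y S (i + 1) j) (h' : KoszulInj a I Y S p i (j - varDegree Y p)) :
    KoszulExact a I Y (insert p S) (i + 1) j := by
  intro ω hω hD
  obtain ⟨ω₀, h0, ω₁, h1, rfl⟩ := exists_reesChains_decomposition hp hω
  obtain ⟨e0, e1⟩ := koszulD_components ha hp h0 h1 (zero_mem _) (Or.inr rfl)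
    (zero_mem (reesChains I Y S 0 (j - varDegree Y p))) (by simpa using hD)
  obtain ⟨η₁, hη₁, e2⟩ := h' ω₁ h1 (by simpa using e1) ⟨-ω₀, neg_mem (by
    rwa [Nat.sub_add_cancel hj]), by rw [map_neg]; exact neg_eq_of_add_eq_zero_right e0⟩
  obtain ⟨η₀, hη₀, e3⟩ := h (ω₀ + a p • η₁) (add_mem h0
    (by simpa [Nat.sub_add_cancel hj] using smul_mem_reesChains ha p hη₁))
    (by rw [map_add, map_smul, e2, e0])
  refine ⟨η₀ - koszulWedge p η₁,
    sub_mem (reesChains_mono I Y (Finset.subset_insert _ _) _ le_rfl hη₀)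
    (by simpa [Nat.sub_add_cancel hj] using koszulWedge_mem_reesChains p hη₁), ?_⟩
  rw [map_sub, koszulD_wedge, e3, e2]
  abel

/-- The next place in the exact sequence: if `a p • ω = ∂η`, then `e_p ∧ ω - η` is a cycle, and the
`p`-component of a chain bounding it bounds `ω` up to sign. -/
theorem KoszulExact.inj_of_insert {a : Fin N → A} {I : Ideal A} {Y S : Finset (Fin N)}
    (ha : ∀ k ∈ Y, a k ∈ I) {p : Fin N} (hp : p ∉ S) {i j : ℕ}
    (h : KoszulExact a I Y (insert p S) (i + 1) (j + varDegree Y p)) :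
    KoszulInj a I Y S p i j := by
  intro ω hω hD ⟨η, hη, e⟩
  obtain ⟨ζ, hζ, e'⟩ := h (koszulWedge p ω - η) (sub_mem (koszulWedge_mem_reesChains p hω)
    (reesChains_mono I Y (Finset.subset_insert _ _) _ le_rfl hη))
    (by rw [map_sub, koszulD_wedge, hD, e]; simp)
  obtain ⟨ζ₀, h0, ζ₁, h1, rfl⟩ := exists_reesChains_decomposition hp hζ
  obtain ⟨-, e2⟩ := koszulD_components ha hp h0 h1 (neg_mem hη) (Or.inl rfl)
    (by simpa using hω) (by rw [e']; abel)
  exact ⟨-ζ₁, neg_mem (by simpa using h1), by rw [map_neg, e2, neg_neg]⟩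

/-- Removing a variable whose value is a linear combination of the values of the others. -/
theorem KoszulExact.of_insert {a : Fin N → A} {I : Ideal A} {Y S : Finset (Fin N)}
    (ha : ∀ k ∈ Y, a k ∈ I) (hS : S ⊆ Y) {p : Fin N} (hpY : p ∈ Y) (hp : p ∉ S)
    (hspan : a p ∈ Ideal.span (a '' S)) {i j : ℕ} (hj : 1 ≤ j)
    (h : KoszulExact a I Y (insert p S) i j) : KoszulExact a I Y S i j := by
  intro ω hω hD
  obtain ⟨η, hη, e⟩ := h ω (reesChains_mono I Y (Finset.subset_insert _ _) _ le_rfl hω) hD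
  obtain ⟨η₀, h0, η₁, h1, rfl⟩ := exists_reesChains_decomposition hp hη
  obtain ⟨e0, e1⟩ := koszulD_components ha hp h0 h1 hω (Or.inr rfl)
    (zero_mem (reesChains I Y S 0 (j - varDegree Y p))) (by simpa using e)
  rw [neg_zero] at e1
  -- The obstruction is `a p • η₁` with `η₁` a cycle. Each `a s`, `s ∈ S`, annihilates homology
  -- through `e_s ∧ η₁`, hence so does their combination `a p`. Since both `p` and `s` lie in `Y`,
  -- the degree drops to `j - 1` and returns to `j`.
  suffices H : ∀ c ∈ Ideal.span (a '' S), ∃ ζ ∈ reesChains I Y S (i + 1) j,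
      koszulD a ζ = c • η₁ by
    obtain ⟨ζ, hζ, e2⟩ := H _ hspan
    exact ⟨η₀ + ζ, add_mem h0 hζ, by rw [map_add, e2, e0]⟩
  intro c hc
  induction hc using Submodule.span_induction with
  | mem c hc =>
    obtain ⟨s, hs, rfl⟩ := hc
    refine ⟨koszulWedge s η₁, ?_, by rw [koszulD_wedge, e1]; simp⟩
    have := koszulWedge_mem_reesChains (Y := Y) s h1
    rw [Finset.insert_eq_of_mem (by simpa using hs)] at this
    simpa [varDegree, hpY, hS hs, Nat.sub_add_cancel hj] using this
  | zero => exact ⟨0, zero_mem _, by simp⟩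
  | add x y _ _ hx hy =>
    obtain ⟨ζ, hζ, e2⟩ := hx
    obtain ⟨ζ', hζ', e3⟩ := hy
    exact ⟨ζ + ζ', add_mem hζ hζ', by rw [map_add, e2, e3, add_smul]⟩
  | smul c x _ hx =>
    obtain ⟨ζ, hζ, e2⟩ := hx
    exact ⟨c • ζ, Submodule.smul_mem _ _ hζ, by rw [map_smul, e2, smul_assoc]⟩

end KoszulCore

/-! ### Relabelling the variables of a Koszul complex -/

section KoszulTransport

variable {A : Type*} [CommRing A] {n N : ℕ}

theorem koszulD_comp_map (φ : Fin n ↪o Fin N) (a : Fin N → A) {ω : Finset (Fin N) → A}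
    (hω : ∀ T, ω T ≠ 0 → T ⊆ univ.map φ.toEmbedding) :
    koszulD (a ∘ φ) (fun T => ω (T.map φ.toEmbedding)) =
      fun T => koszulD a ω (T.map φ.toEmbedding) := by
  funext T
  rw [koszulD_apply, koszulD_apply, ← Finset.sum_subset (s₁ := Tᶜ.map φ.toEmbedding)]
  · rw [Finset.sum_map]
    refine Finset.sum_congr rfl fun k _ => ?_
    rw [Finset.map_insert, Finset.filter_map, Finset.card_map]
    simp
  · intro k hk
    simp only [mem_map, mem_compl] at hk ⊢
    obtain ⟨l, hl, rfl⟩ := hk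
    rintro ⟨l', hl', h⟩
    exact hl (by rwa [← φ.toEmbedding.injective h])
  · intro k hk hk'
    refine mul_eq_zero_of_right _ (not_not.1 fun h => ?_)
    obtain ⟨l, -, rfl⟩ := Finset.mem_map.1 (hω _ h (Finset.mem_insert_self _ _))
    refine hk' (Finset.mem_map_of_mem _ (Finset.mem_compl.2 fun hl => ?_))
    exact Finset.mem_compl.1 hk (Finset.mem_map_of_mem _ hl)

theorem eq_of_comp_map_eq (φ : Fin n ↪o Fin N) {ω η : Finset (Fin N) → A}
    (hω : ∀ T, ω T ≠ 0 → T ⊆ univ.map φ.toEmbedding)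
    (hη : ∀ T, η T ≠ 0 → T ⊆ univ.map φ.toEmbedding)
    (h : ∀ T : Finset (Fin n), ω (T.map φ.toEmbedding) = η (T.map φ.toEmbedding)) : ω = η := by
  funext T
  by_cases hT : T ⊆ univ.map φ.toEmbedding
  · obtain ⟨T', -, rfl⟩ := Finset.subset_map_iff.1 hT
    exact h T'
  · rw [not_not.1 fun h => hT (hω T h), not_not.1 fun h => hT (hη T h)]

variable {I : Ideal A} {Y : Finset (Fin N)} {Y' : Finset (Fin n)} (φ : Fin n ↪o Fin N)

theorem card_map_inter (hY : ∀ k, k ∈ Y' ↔ φ k ∈ Y) (T : Finset (Fin n)) :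
    #(T.map φ.toEmbedding ∩ Y) = #(T ∩ Y') := by
  rw [← Finset.card_map φ.toEmbedding (s := T ∩ Y')]
  congr 1
  ext k
  simp only [mem_inter, mem_map]
  constructor
  · rintro ⟨⟨l, hl, rfl⟩, h⟩
    exact ⟨l, ⟨hl, (hY l).2 h⟩, rfl⟩
  · rintro ⟨l, ⟨hl, hl'⟩, rfl⟩
    exact ⟨⟨l, hl, rfl⟩, (hY l).1 hl'⟩

theorem reesChains_comp_map (hY : ∀ k, k ∈ Y' ↔ φ k ∈ Y) {i j : ℕ} {ω : Finset (Fin N) → A}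
    (hω : ω ∈ reesChains I Y (univ.map φ.toEmbedding) i j) :
    (fun T => ω (T.map φ.toEmbedding)) ∈ reesChains I Y' univ i j := fun T =>
  ⟨fun h => ⟨subset_univ _, by simpa using ((hω _).1 h).2⟩, by
    simpa [card_map_inter φ hY] using (hω (T.map φ.toEmbedding)).2⟩

theorem exists_reesChains_comp_map (hY : ∀ k, k ∈ Y' ↔ φ k ∈ Y) {i j : ℕ}
    {ω : Finset (Fin n) → A} (hω : ω ∈ reesChains I Y' univ i j) :
    ∃ η ∈ reesChains I Y (univ.map φ.toEmbedding) i j,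
      (fun T => η (T.map φ.toEmbedding)) = ω := by
  have hinj := Finset.map_injective φ.toEmbedding
  refine ⟨Function.extend (Finset.map φ.toEmbedding) ω 0, fun T => ?_,
    funext fun T => hinj.extend_apply _ _ _⟩
  by_cases hT : ∃ T' : Finset (Fin n), T'.map φ.toEmbedding = T
  · obtain ⟨T, rfl⟩ := hT
    rw [hinj.extend_apply, card_map_inter φ hY]
    exact ⟨fun h => ⟨Finset.map_subset_map.2 (subset_univ _), by simpa using ((hω T).1 h).2⟩,
      (hω T).2⟩
  · rw [Function.extend_apply' _ _ _ hT]
    simp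

theorem koszulExact_comp_iff {a : Fin N → A} (ha : ∀ k ∈ Y, a k ∈ I)
    (hY : ∀ k, k ∈ Y' ↔ φ k ∈ Y) {i j : ℕ} :
    KoszulExact (a ∘ φ) I Y' univ i j ↔ KoszulExact a I Y (univ.map φ.toEmbedding) i j := by
  constructor
  · intro h ω hω hD
    obtain ⟨η, hη, e⟩ := h _ (reesChains_comp_map φ hY hω) (by
      rw [koszulD_comp_map φ a fun T h => ((hω T).1 h).1, hD]; rfl)
    obtain ⟨ζ, hζ, rfl⟩ := exists_reesChains_comp_map φ hY hη
    refine ⟨ζ, hζ, eq_of_comp_map_eq φ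
      (fun T h => ((koszulD_mem_reesChains ha hζ T).1 h).1) (fun T h => ((hω T).1 h).1) ?_⟩
    rw [koszulD_comp_map φ a fun T h => ((hζ T).1 h).1] at e
    exact congrFun e
  · intro h ω hω hD
    obtain ⟨ζ, hζ, rfl⟩ := exists_reesChains_comp_map φ hY hω
    obtain ⟨η, hη, e⟩ := h ζ hζ (by
      rcases i with _ | i
      · exact koszulD_eq_zero_of_degree_zero hζ
      · rw [koszulD_comp_map φ a fun T h => ((hζ T).1 h).1] at hD
        exact eq_of_comp_map_eq φ
          (fun T h => ((koszulD_mem_reesChains ha hζ T).1 h).1) (by simp) (congrFun hD))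
    exact ⟨_, reesChains_comp_map φ hY hη, by
      rw [koszulD_comp_map φ a fun T h => ((hη T).1 h).1, e]⟩

end KoszulTransport

/-! ### Linear Koszul homology and change of generators -/

section KoszulRegularity

variable {A : Type*} [CommRing A] {N : ℕ} {a : Fin N → A} {I : Ideal A}

/-- The `i`-th Koszul homology over the Rees algebra for the variables in `S` vanishes in all
`y`-degrees greater than `i`. -/
def KoszulLinear (a : Fin N → A) (I : Ideal A) (Y S : Finset (Fin N)) : Prop :=
  ∀ i j, i < j → KoszulExact a I Y S i j

theorem varDegree_le_one (Y : Finset (Fin N)) (p : Fin N) : varDegree Y p ≤ 1 := by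
  unfold varDegree; split_ifs <;> simp

/-- Adjoining a variable to `S` preserves vanishing in small homological degrees. -/
theorem koszulExact_insert {Y S : Finset (Fin N)} (ha : ∀ k ∈ Y, a k ∈ I) (p : Fin N) {i j : ℕ}
    (hj : 1 ≤ j) (h : KoszulExact a I Y S i j)
    (h' : ∀ i', i' + 1 = i → KoszulExact a I Y S i' (j - varDegree Y p)) :
    KoszulExact a I Y (insert p S) i j := by
  by_cases hp : p ∈ S
  · rwa [Finset.insert_eq_of_mem hp]
  · rcases i with _ | i
    · exact h.insert_zero p
    · exact h.insert_succ ha hp ((varDegree_le_one Y p).trans hj) ((h' i rfl).inj p)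

/-- The neighbouring term in the exact sequence is H_{i-1} in degree `j` or `j - 1`, and a variable
has `y`-degree at most one, so the region above the diagonal is never left. -/
theorem KoszulLinear.mono {Y S S' : Finset (Fin N)} (ha : ∀ k ∈ Y, a k ∈ I) (hS : S ⊆ S')
    (h : KoszulLinear a I Y S) : KoszulLinear a I Y S' := by
  rw [← Finset.union_eq_right.2 hS, Finset.union_comm]
  clear hS
  induction S' using Finset.induction_on with
  | empty => simpa using h
  | insert p T _ ih =>
    rw [Finset.insert_union]
    intro i j hij
    refine koszulExact_insert ha p (by omega) (ih i j hij) fun i' hi' => ih _ _ ?_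
    have := varDegree_le_one Y p
    omega

theorem KoszulLinear.of_superset {Y S S' : Finset (Fin N)} (ha : ∀ k ∈ Y, a k ∈ I) (hS : S ⊆ S')
    (hS' : S' ⊆ Y) (hspan : ∀ p ∈ S', a p ∈ Ideal.span (a '' S)) (h : KoszulLinear a I Y S') :
    KoszulLinear a I Y S := by
  have hSY := hS.trans hS'
  rw [← Finset.union_eq_right.2 hS, Finset.union_comm] at h
  clear hS
  induction S' using Finset.induction_on with
  | empty => simpa using h
  | insert p T hp ih =>
    refine ih ((Finset.subset_insert _ _).trans hS')
      (fun q hq => hspan q (Finset.mem_insert_of_mem hq)) ?_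
    rw [Finset.insert_union] at h
    by_cases hp' : p ∈ T ∪ S
    · rwa [Finset.insert_eq_of_mem hp'] at h
    · intro i j hij
      exact (h i j hij).of_insert ha
        (Finset.union_subset ((Finset.subset_insert _ _).trans hS') hSY)
        (hS' (Finset.mem_insert_self _ _)) hp'
        (Ideal.span_mono (Set.image_mono (by simp)) (hspan p (Finset.mem_insert_self _ _)))
        (by omega)

/-- Linearity of the Koszul homology over the Rees algebra does not depend on the choice of the
generators of the ideal. -/
theorem KoszulLinear.of_span_eq {m r : ℕ} {f : Fin m → A} {z : Fin r → A}
    (hf : Ideal.span (Set.range f) = I) (hz : Ideal.span (Set.range z) = I)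
    (h : KoszulLinear f I univ univ) : KoszulLinear z I univ univ := by
  have ha : ∀ k ∈ (univ : Finset (Fin (m + r))), Fin.append f z k ∈ I := by
    intro k _
    refine Fin.addCases (fun l => ?_) (fun l => ?_) k
    · rw [Fin.append_left, ← hf]; exact Ideal.subset_span ⟨l, rfl⟩
    · rw [Fin.append_right, ← hz]; exact Ideal.subset_span ⟨l, rfl⟩
  -- Two generating systems are compared through their concatenation: the `z`'s are adjoined to the
  -- `f`'s, and then the `f`'s, which are combinations of the `z`'s, are deleted.
  have h1 : KoszulLinear (Fin.append f z) I univ univ := by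
    refine KoszulLinear.mono (S := univ.map (Fin.castAddOrderEmb r).toEmbedding) ha
      (subset_univ _) fun i j hij => ?_
    rw [← koszulExact_comp_iff (Y' := univ) (Fin.castAddOrderEmb r) ha (by simp)]
    convert h i j hij
    funext l
    exact Fin.append_left f z l
  have h2 : KoszulLinear (Fin.append f z) I univ (univ.map (Fin.natAddOrderEmb m).toEmbedding) := by
    refine h1.of_superset ha (subset_univ _) subset_rfl fun p hp => ?_
    refine (hz.symm ▸ ha p hp : _ ∈ Ideal.span (Set.range z)) |> fun h => ?_
    convert h
    ext w
    simp only [coe_map, coe_univ, Set.image_univ, Set.mem_image, Set.mem_range,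
      exists_exists_eq_and]
    exact exists_congr fun l => by rw [← Fin.append_right f z l]; rfl
  intro i j hij
  have := h2 i j hij
  rw [← koszulExact_comp_iff (Y' := univ) (Fin.natAddOrderEmb m) ha (by simp)] at this
  convert this
  funext l
  exact (Fin.append_right f z l).symm

end KoszulRegularity

/-! ### Linear homology versus injectivity on H_0 -/

section RelativeInjectivity

variable {A : Type*} [CommRing A] {N : ℕ} {a : Fin N → A} {I : Ideal A}

theorem single_mem_reesChains {S : Finset (Fin N)} {j : ℕ} {w : A} (hw : w ∈ I ^ j) :
    (Pi.single ∅ w : Finset (Fin N) → A) ∈ reesChains I univ S 0 j := by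
  intro T
  by_cases hT : T = ∅
  · subst hT; simpa using hw
  · simp [hT]

theorem eq_single_of_mem_reesChains {Y S : Finset (Fin N)} {j : ℕ} {ω : Finset (Fin N) → A}
    (hω : ω ∈ reesChains I Y S 0 j) : ω = Pi.single ∅ (ω ∅) := by
  funext T
  by_cases hT : T = ∅
  · subst hT; simp
  · simp only [Pi.single_apply, hT, if_false]
    exact reesChains_apply_eq_zero hω fun h => hT (Finset.card_eq_zero.1 h.2)

theorem exists_koszulD_eq_single_iff {S : Finset (Fin N)} {e : ℕ} {w : A} :
    (∃ η ∈ reesChains I univ S 1 (e + 1), koszulD a η = Pi.single ∅ w) ↔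
      w ∈ Ideal.span (a '' S) * I ^ e := by
  constructor
  · rintro ⟨η, hη, h⟩
    have h0 := congrFun h ∅
    rw [Pi.single_eq_same] at h0
    rw [← h0, koszulD_apply]
    refine sum_mem fun k _ => ?_
    by_cases hk : k ∈ S
    · rw [mul_assoc]
      refine neg_one_pow_mul_mem _ (Ideal.mul_mem_mul (Ideal.subset_span ⟨k, hk, rfl⟩) ?_)
      simpa using (hη {k}).2
    · rw [reesChains_apply_eq_zero hη (by simp [hk]), mul_zero]
      exact zero_mem _
  · intro hw
    induction hw using Submodule.mul_induction_on' with
    | mem_mul_mem u hu v hv =>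
      induction hu using Submodule.span_induction with
      | mem u hu =>
        obtain ⟨s, hs, rfl⟩ := hu
        have h1 : (Pi.single ∅ v : Finset (Fin N) → A) ∈ reesChains I univ S 0 e :=
          single_mem_reesChains hv
        refine ⟨koszulWedge s (Pi.single ∅ v), ?_, ?_⟩
        · have := koszulWedge_mem_reesChains s h1
          rw [Finset.insert_eq_of_mem (by simpa using hs)] at this
          simpa [varDegree] using this
        · rw [koszulD_wedge, koszulD_eq_zero_of_degree_zero h1, map_zero, sub_zero,
            ← Pi.single_smul, smul_eq_mul]
      | zero => exact ⟨0, zero_mem _, by simp⟩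
      | add x y _ _ hx hy =>
        obtain ⟨ζ, hζ, e2⟩ := hx
        obtain ⟨ζ', hζ', e3⟩ := hy
        exact ⟨ζ + ζ', add_mem hζ hζ', by rw [map_add, e2, e3, add_mul, Pi.single_add]⟩
      | smul c x _ hx =>
        obtain ⟨ζ, hζ, e2⟩ := hx
        exact ⟨c • ζ, Submodule.smul_mem _ _ hζ, by
          rw [map_smul, e2, ← Pi.single_smul, smul_mul_assoc]⟩
    | add x _ y _ hx hy =>
      obtain ⟨ζ, hζ, e2⟩ := hx
      obtain ⟨ζ', hζ', e3⟩ := hy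
      exact ⟨ζ + ζ', add_mem hζ hζ', by rw [map_add, e2, e3, Pi.single_add]⟩

/-- Multiplication with `a_p t` is injective in degree `k` on `R(I)` modulo the `a_s t`, `s < p`. -/
def RelInjective (a : Fin N → A) (I : Ideal A) (p : Fin N) (k : ℕ) : Prop :=
  ∀ w ∈ I ^ k, a p * w ∈ initSpan a p * I ^ k → w ∈ initSpan a p * I ^ (k - 1)

theorem initSpan_eq (a : Fin N → A) (p : Fin N) :
    initSpan a p = Ideal.span (a '' (Finset.Iio p : Finset (Fin N))) := by
  rw [Finset.coe_Iio]; rfl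

/-- In degree `k ≥ 1`, H_0 of the variables before `p` is `I ^ k` modulo `initSpan a p * I ^ (k -
1)`. -/
theorem koszulInj_zero_iff (p : Fin N) {k : ℕ} (hk : 1 ≤ k) :
    KoszulInj a I univ (Finset.Iio p) p 0 k ↔ RelInjective a I p k := by
  obtain ⟨k, rfl⟩ := Nat.exists_eq_add_of_le' hk
  have hp : varDegree univ p = 1 := by simp [varDegree]
  rw [RelInjective, initSpan_eq, Nat.add_sub_cancel]
  constructor
  · intro h w hw h'
    rw [← exists_koszulD_eq_single_iff] at h' ⊢
    refine h _ (single_mem_reesChains hw)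
      (koszulD_eq_zero_of_degree_zero (single_mem_reesChains (S := ∅) hw)) ?_
    rwa [hp, ← Pi.single_smul, smul_eq_mul]
  · intro h ω hω _ h'
    rw [hp, eq_single_of_mem_reesChains hω, ← Pi.single_smul, smul_eq_mul,
      exists_koszulD_eq_single_iff] at h'
    rw [eq_single_of_mem_reesChains hω, exists_koszulD_eq_single_iff]
    exact h _ (by simpa using (hω ∅).2) h'

/-- The first `q` variables. -/
def firstVars (N q : ℕ) : Finset (Fin N) := {t | t.val < q}

theorem firstVars_val (p : Fin N) : firstVars N p.val = Finset.Iio p := by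
  ext t; simp [firstVars]

theorem firstVars_succ (p : Fin N) : firstVars N (p.val + 1) = insert p (Finset.Iio p) := by
  ext t
  simp only [firstVars, mem_filter, mem_univ, true_and, mem_insert, mem_Iio, Fin.lt_def, Fin.ext_iff]
  omega

theorem firstVars_self : firstVars N N = univ := by
  ext t; simp [firstVars]

theorem koszulExact_empty (Y : Finset (Fin N)) {i : ℕ} (hi : 1 ≤ i) (j : ℕ) :
    KoszulExact a I Y ∅ i j := by
  intro ω hω _
  refine ⟨0, zero_mem _, ?_⟩
  rw [map_zero]
  funext T
  refine (reesChains_apply_eq_zero hω fun h => ?_).symm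
  obtain rfl := Finset.subset_empty.1 h.1
  simp at h
  omega

theorem firstVars_induction {P : ℕ → Prop} (h0 : P 0) (h : ∀ p : Fin N, P p.val → P (p.val + 1))
    {q : ℕ} (hq : q ≤ N) : P q := by
  induction q with
  | zero => exact h0
  | succ q ih => exact h ⟨q, hq⟩ (ih (by omega))

theorem firstVars_zero : firstVars N 0 = ∅ := by
  ext t; simp [firstVars]

/-- H_1 in degree `k + 1` only sees H_0 in degree `k`, so injectivity in the single degree `k`
suffices. The case `k = 1` is all that a weak relative regular sequence provides. -/
theorem koszulExact_one_of_relInjective (ha : ∀ k, a k ∈ I) {k : ℕ} (hk : 1 ≤ k)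
    (h : ∀ p, RelInjective a I p k) {q : ℕ} (hq : q ≤ N) :
    KoszulExact a I univ (firstVars N q) 1 (k + 1) := by
  refine firstVars_induction (P := fun q => KoszulExact a I univ (firstVars N q) 1 (k + 1))
    ?_ (fun p ih => ?_) hq
  · rw [firstVars_zero]; exact koszulExact_empty _ le_rfl _
  · rw [firstVars_succ]
    rw [firstVars_val] at ih
    refine KoszulExact.insert_succ (fun k _ => ha k) (by simp) (by simp [varDegree]) ih ?_
    rw [show k + 1 - varDegree univ p = k by simp [varDegree]]
    exact (koszulInj_zero_iff p hk).2 (h p)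

/-- Injectivity is needed only to start, for H_1. Beyond that, H_{i+2} of `p + 1` variables in
degree `j` lies between H_{i+2} of `p` variables in degree `j` and H_{i+1} in degree `j - 1`, both
zero by induction. -/
theorem koszulExact_of_relInjective (ha : ∀ k, a k ∈ I) {k₀ : ℕ} (hk₀ : 1 ≤ k₀)
    (h : ∀ p, ∀ k ≥ k₀, RelInjective a I p k) (i : ℕ) :
    ∀ j ≥ i + 1 + k₀, ∀ q ≤ N, KoszulExact a I univ (firstVars N q) (i + 1) j := by
  induction i with
  | zero =>
    intro j hj q hq
    obtain ⟨k, rfl⟩ : ∃ k, j = k + 1 := ⟨j - 1, by omega⟩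
    exact koszulExact_one_of_relInjective ha (by omega) (fun p => h p k (by omega)) hq
  | succ i ih =>
    intro j hj q hq
    refine firstVars_induction (P := fun q => KoszulExact a I univ (firstVars N q) (i + 1 + 1) j)
      ?_ (fun p ih' => ?_) hq
    · rw [firstVars_zero]; exact koszulExact_empty _ (by omega) _
    · rw [firstVars_succ]
      rw [firstVars_val] at ih'
      refine KoszulExact.insert_succ (fun k _ => ha k) (by simp) (by simp [varDegree]; omega) ih' ?_
      refine KoszulExact.inj ?_ p
      rw [← firstVars_val]
      exact ih _ (by simp [varDegree]; omega) _ p.isLt.le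

/-- If all the multiplications with the `a_p t` are injective in positive degrees, then the Koszul
homology is linear. -/
theorem koszulLinear_of_relInjective (hI : Ideal.span (Set.range a) = I)
    (h : ∀ p, ∀ k ≥ 1, RelInjective a I p k) : KoszulLinear a I univ univ := by
  have ha : ∀ k, a k ∈ I := fun k => hI ▸ Ideal.subset_span ⟨k, rfl⟩
  intro i j hij
  rcases i with _ | i
  · obtain ⟨j, rfl⟩ : ∃ k, j = k + 1 := ⟨j - 1, by omega⟩
    -- H_0 of all the generators is zero in positive degrees because `I * I ^ j = I ^ (j + 1)`.
    intro ω hω _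
    rw [eq_single_of_mem_reesChains hω, exists_koszulD_eq_single_iff]
    simp only [coe_univ, Set.image_univ, hI, ← pow_succ']
    simpa using (hω ∅).2
  · have := koszulExact_of_relInjective ha le_rfl h i j (by omega) N le_rfl
    rwa [firstVars_self] at this

/-- If the Koszul homology is linear and the multiplications with the `a_p t` are injective in
large degrees, then they are injective in all positive degrees. -/
theorem relInjective_of_koszulLinear (ha : ∀ k, a k ∈ I) (hlin : KoszulLinear a I univ univ)
    {k₀ : ℕ} (hk₀ : 1 ≤ k₀) (h : ∀ p, ∀ k ≥ k₀, RelInjective a I p k) (p : Fin N) {k : ℕ}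
    (hk : 1 ≤ k) : RelInjective a I p k := by
  -- Descending induction on the number `q` of variables. Vanishing of H_{i+1} for `q + 1` variables
  -- makes multiplication by the next element injective on H_i for `q` variables above the diagonal.
  have key : ∀ d q, q + d = N → ∀ i j, 1 ≤ i → i < j →
      KoszulExact a I univ (firstVars N q) i j := by
    intro d
    induction d with
    | zero =>
      intro q hq i j _ hij
      rw [add_zero] at hq
      rw [hq, firstVars_self]
      exact hlin i j hij
    | succ d ih =>
      intro q hq i j hi hij
      obtain ⟨p, rfl⟩ : ∃ p : Fin N, p.val = q := ⟨⟨q, by omega⟩, rfl⟩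
      have hinj : ∀ j, i < j → KoszulInj a I univ (firstVars N p.val) p i j := by
        intro j hij
        rw [firstVars_val]
        refine KoszulExact.inj_of_insert (fun k _ => ha k) (by simp) ?_
        rw [← firstVars_succ]
        exact ih _ (by omega) _ _ (by omega) (by simp [varDegree, hij])
      -- Repeated multiplication embeds H_i in degree `j` into H_i in a degree at least `i + k₀`,
      -- where it vanishes by injectivity in large degrees; `e` bounds the number of
      -- multiplications.
      have hlarge : ∀ e j, i < j → i + k₀ ≤ j + e →
          KoszulExact a I univ (firstVars N p.val) i j := by
        intro e
        induction e with
        | zero =>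
          intro j _ hj
          obtain ⟨i, rfl⟩ : ∃ k, i = k + 1 := ⟨i - 1, by omega⟩
          exact koszulExact_of_relInjective ha hk₀ h i j (by omega) _ p.isLt.le
        | succ e ih' =>
          intro j hij hj ω hω hD
          have h1 := smul_mem_reesChains (a := a) (fun k _ => ha k) p hω
          have hv : varDegree univ p = 1 := by simp [varDegree]
          refine hinj j hij ω hω hD ?_
          rw [hv] at h1 ⊢
          exact ih' (j + 1) (by omega) (by omega) _ h1 (by rw [map_smul, hD, smul_zero])
      exact hlarge (i + k₀) j hij (by omega)
  rw [← koszulInj_zero_iff p hk]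
  refine KoszulExact.inj_of_insert (fun k _ => ha k) (by simp) ?_
  rw [← firstVars_succ]
  have := p.isLt
  exact key (N - (p.val + 1)) _ (by omega) _ _ le_rfl (by simp [varDegree]; omega)

end RelativeInjectivity

/-! ### The Tor modules in terms of chains over `A` -/

section ReesTor

variable {A : Type*} [CommRing A] {n m : ℕ} {I : Ideal A}

/-- The values in `A` of the variables `x₁, …, xₙ, y₁, …, yₘ`. -/
def variableValues (x : Fin n → A) (f : Fin m → I) : Fin (n + m) → A :=
  Fin.append x (fun j => (f j : A))

/-- The indices of the variables `y₁, …, yₘ`. -/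
def yVars (n m : ℕ) : Finset (Fin (n + m)) := {t | n ≤ t.val}

theorem filter_le_eq_inter_yVars (T : Finset (Fin (n + m))) :
    ({t ∈ T | n ≤ Fin.val t} : Finset (Fin (n + m))) = T ∩ yVars n m := by
  ext t; simp [yVars]

theorem coe_reesVariables (x : Fin n → A) (f : Fin m → I) (k : Fin (n + m)) :
    (reesVariables x f k : Polynomial A) =
      Polynomial.monomial (varDegree (yVars n m) k) (variableValues x f k) := by
  refine Fin.addCases (fun l => ?_) (fun l => ?_) k
  · rw [reesVariables, variableValues, Fin.append_left, Fin.append_left, varDegree, if_neg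
      (by simp [yVars])]
    rfl
  · rw [reesVariables, variableValues, Fin.append_right, Fin.append_right, varDegree, if_pos
      (by simp [yVars])]
    rfl

theorem variableValues_mem (x : Fin n → A) (f : Fin m → I) :
    ∀ k ∈ yVars n m, variableValues x f k ∈ I := by
  intro k
  refine Fin.addCases (fun l h => ?_) (fun l _ => ?_) k
  · have := l.isLt
    simp [yVars] at h
    omega
  · simp [variableValues]

/-- The coefficients of the part of `y`-degree `j` of a chain over the Rees algebra. -/
noncomputable def reesComponent (j : ℕ) (ω : Finset (Fin (n + m)) → reesAlgebra I) :
    Finset (Fin (n + m)) → A :=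
  fun T => (ω T : Polynomial A).coeff (j - #(T ∩ yVars n m))

theorem reesComponent_mem {i j : ℕ} {ω : Finset (Fin (n + m)) → reesAlgebra I}
    (hω : ω ∈ koszulChains (reesAlgebra I) (n + m) i) :
    reesComponent j ω ∈ reesChains I (yVars n m) univ i j := by
  refine fun T => ⟨fun h => ⟨subset_univ _, ?_⟩, (ω T).2 _⟩
  by_contra hT
  exact h (by rw [reesComponent, hω T hT]; rfl)

/-- The chain of `y`-degree `j` over the Rees algebra with the given coefficients. -/
noncomputable def reesLift {i j : ℕ} {ω : Finset (Fin (n + m)) → A}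
    (hω : ω ∈ reesChains I (yVars n m) univ i j) : Finset (Fin (n + m)) → reesAlgebra I :=
  fun T => ⟨Polynomial.monomial (j - #(T ∩ yVars n m)) (ω T),
    reesAlgebra.monomial_mem.2 (hω T).2⟩

theorem reesLift_mem_koszulChains {i j : ℕ} {ω : Finset (Fin (n + m)) → A}
    (hω : ω ∈ reesChains I (yVars n m) univ i j) :
    reesLift hω ∈ koszulChains (reesAlgebra I) (n + m) i := by
  intro T hT
  ext1
  simp [reesLift, reesChains_apply_eq_zero hω fun h => hT h.2]

theorem reesLift_mem_yDegreeChains {i j : ℕ} (hij : i ≤ j) {ω : Finset (Fin (n + m)) → A}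
    (hω : ω ∈ reesChains I (yVars n m) univ i j) :
    reesLift hω ∈ yDegreeChains n m I j := by
  intro T k hk
  rw [filter_le_eq_inter_yVars] at hk
  by_cases hT : #T = i
  · have := Finset.card_le_card (Finset.inter_subset_left (s₁ := T) (s₂ := yVars n m))
    simp only [reesLift, Polynomial.coeff_monomial]
    rw [if_neg (by omega)]
  · simp [reesLift, reesChains_apply_eq_zero hω fun h => hT h.2]

theorem reesComponent_reesLift {i j : ℕ} {ω : Finset (Fin (n + m)) → A}
    (hω : ω ∈ reesChains I (yVars n m) univ i j) : reesComponent j (reesLift hω) = ω := by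
  funext T
  simp [reesComponent, reesLift]

theorem reesLift_reesComponent {i j : ℕ} {ω : Finset (Fin (n + m)) → reesAlgebra I}
    (hω : ω ∈ koszulChains (reesAlgebra I) (n + m) i) (hy : ω ∈ yDegreeChains n m I j) :
    reesLift (reesComponent_mem (j := j) hω) = ω := by
  funext T
  ext k
  simp only [reesLift, Polynomial.coeff_monomial]
  split_ifs with h
  · subst h; rfl
  · refine (hy T k fun h' => h ?_).symm
    rw [filter_le_eq_inter_yVars] at h'
    omega

theorem mem_koszulCycles {R : Type*} [CommRing R] {N : ℕ} {a : Fin N → R} {i : ℕ}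
    {ω : Finset (Fin N) → R} :
    ω ∈ koszulCycles a i ↔ ω ∈ koszulChains R N i ∧ koszulD a ω = 0 := Iff.rfl

theorem koszulD_mem_koszulChains {R : Type*} [CommRing R] {N : ℕ} (a : Fin N → R) {i : ℕ}
    {ω : Finset (Fin N) → R} (hω : ω ∈ koszulChains R N (i + 1)) :
    koszulD a ω ∈ koszulChains R N i := by
  intro T hT
  refine Finset.sum_eq_zero fun k hk => ?_
  rw [hω, mul_zero]
  rw [Finset.card_insert_of_notMem (by simpa using hk)]
  omega

/-- The assumption `i < j` keeps all exponents `j - #(T ∩ Y)` free of truncation on chains of degree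
at most `i + 1`, so that extracting coefficients commutes with the differential. -/
theorem koszulD_reesComponent (x : Fin n → A) (f : Fin m → I) {i j : ℕ} (hij : i < j)
    {ω : Finset (Fin (n + m)) → reesAlgebra I}
    (hω : ω ∈ koszulChains (reesAlgebra I) (n + m) (i + 1)) :
    koszulD (variableValues x f) (reesComponent j ω) =
      reesComponent j (koszulD (reesVariables x f) ω) := by
  have h1 := koszulD_mem_reesChains (variableValues_mem x f) (reesComponent_mem (j := j) hω)
  have h2 := reesComponent_mem (j := j) (koszulD_mem_koszulChains (reesVariables x f) hω)
  funext T
  by_cases hT : #T = i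
  · have hw := Finset.card_le_card (Finset.inter_subset_left (s₁ := T) (s₂ := yVars n m))
    rw [koszulD_apply, reesComponent, koszulD_apply]
    simp only [AddSubmonoidClass.coe_finsetSum, Polynomial.finsetSum_coeff]
    refine Finset.sum_congr rfl fun k hk => ?_
    have hv := varDegree_le_one (yVars n m) k
    simp only [MulMemClass.coe_mul, SubmonoidClass.coe_pow, NegMemClass.coe_neg,
      OneMemClass.coe_one, coe_reesVariables]
    rw [reesComponent, card_insert_inter (by simpa using hk)]
    obtain ⟨e, he⟩ : ∃ e, j - #(T ∩ yVars n m) = varDegree (yVars n m) k + e :=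
      ⟨j - #(T ∩ yVars n m) - varDegree (yVars n m) k, by omega⟩
    rw [he, show j - (#(T ∩ yVars n m) + varDegree (yVars n m) k) = e by omega, mul_assoc, mul_assoc,
      show ((-1 : Polynomial A) ^ #{t ∈ T | t < k}) = Polynomial.C ((-1) ^ #{t ∈ T | t < k}) by simp,
      Polynomial.coeff_C_mul, add_comm (varDegree _ _) e, Polynomial.coeff_monomial_mul]
  · rw [reesChains_apply_eq_zero h1 fun h => hT h.2, reesChains_apply_eq_zero h2 fun h => hT h.2]

theorem yReesTor_eq_bot_iff_forall (x : Fin n → A) (f : Fin m → I) (i j : ℕ) :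
    yReesTor x f i j = ⊥ ↔ ∀ ω ∈ koszulCycles (reesVariables x f) i, ω ∈ yDegreeChains n m I j →
      ω ∈ koszulBoundaries (reesVariables x f) i := by
  rw [yReesTor, eq_bot_iff]
  constructor
  · intro h ω hω hy
    have : Submodule.Quotient.mk ⟨ω, hω⟩ ∈ (⊥ : AddSubgroup (ReesTor x f i)) :=
      h ⟨⟨ω, hω⟩, hy, rfl⟩
    rwa [AddSubgroup.mem_bot, Submodule.Quotient.mk_eq_zero] at this
  · rintro h _ ⟨⟨ω, hω⟩, hy, rfl⟩
    rw [AddSubgroup.mem_bot]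
    exact (Submodule.Quotient.mk_eq_zero _).2 (h ω hω hy)

theorem yReesTor_eq_bot_iff (x : Fin n → A) (f : Fin m → I) {i j : ℕ} (hij : i < j) :
    yReesTor x f i j = ⊥ ↔ KoszulExact (variableValues x f) I (yVars n m) univ i j := by
  have hD : ∀ {i}, i < j → ∀ {η : Finset (Fin (n + m)) → A}
      (hη : η ∈ reesChains I (yVars n m) univ (i + 1) j),
      koszulD (reesVariables x f) (reesLift hη) =
        reesLift (koszulD_mem_reesChains (variableValues_mem x f) hη) := by
    intro i hij η hη
    -- The boundary of a lifted chain is homogeneous of `y`-degree `j`, hence is recovered from its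
    -- coefficients.
    have hy : koszulD (reesVariables x f) (reesLift hη) ∈ yDegreeChains n m I j := by
      intro T k hk
      rw [koszulD_apply]
      simp only [AddSubmonoidClass.coe_finsetSum, Polynomial.finsetSum_coeff]
      refine Finset.sum_eq_zero fun l hl => ?_
      simp only [MulMemClass.coe_mul, SubmonoidClass.coe_pow, NegMemClass.coe_neg,
        OneMemClass.coe_one, coe_reesVariables]
      rw [mul_assoc, show ((-1 : Polynomial A) ^ #{t ∈ T | t < l}) =
        Polynomial.C ((-1) ^ #{t ∈ T | t < l}) by simp, Polynomial.coeff_C_mul]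
      refine mul_eq_zero_of_right _ ?_
      by_cases hT : #T = i
      · have hw := Finset.card_le_card (Finset.inter_subset_left (s₁ := T) (s₂ := yVars n m))
        have hv := varDegree_le_one (yVars n m) l
        rw [filter_le_eq_inter_yVars] at hk
        simp only [reesLift]
        rw [Polynomial.monomial_mul_monomial, Polynomial.coeff_monomial, if_neg]
        rw [card_insert_inter (by simpa using hl)]
        omega
      · rw [reesLift_mem_koszulChains hη]
        · simp
        · rw [Finset.card_insert_of_notMem (by simpa using hl)]; omega
    rw [← reesLift_reesComponent (koszulD_mem_koszulChains _ (reesLift_mem_koszulChains hη)) hy]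
    congr 1
    rw [← koszulD_reesComponent x f hij (reesLift_mem_koszulChains hη), reesComponent_reesLift]
  rw [yReesTor_eq_bot_iff_forall]
  constructor
  · intro h ω hω h0
    obtain ⟨η, hη, e⟩ := h (reesLift hω) (mem_koszulCycles.2 ⟨reesLift_mem_koszulChains hω, by
      rcases i with _ | i
      · funext T
        refine Finset.sum_eq_zero fun k _ => ?_
        rw [reesLift_mem_koszulChains hω _ (by simp), mul_zero]
      · rw [hD (by omega)]
        funext T
        ext1
        simp [reesLift, h0]⟩) (reesLift_mem_yDegreeChains hij.le hω)
    exact ⟨reesComponent j η, reesComponent_mem hη, by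
      rw [koszulD_reesComponent x f hij hη, e, reesComponent_reesLift]⟩
  · intro h ω hω hy
    obtain ⟨hω, h0⟩ := mem_koszulCycles.1 hω
    have h0' : koszulD (variableValues x f) (reesComponent j ω) = 0 := by
      rcases i with _ | i
      · exact koszulD_eq_zero_of_degree_zero (reesComponent_mem (j := j) hω)
      · rw [koszulD_reesComponent x f (by omega) hω, h0]
        rfl
    obtain ⟨η, hη, e⟩ := h _ (reesComponent_mem hω) h0'
    refine ⟨reesLift hη, reesLift_mem_koszulChains hη, ?_⟩
    rw [hD hij, ← reesLift_reesComponent hω hy]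
    congr 1

/-- The class of `1` survives: a boundary has its `t`-degree-zero part in the ideal generated by the
`x`-variables. This is what gives `0 ≤ yRegularity x f`. -/
theorem yReesTor_zero_ne_bot (x : Fin n → A) (f : Fin m → I)
    (hx : (1 : A) ∉ Ideal.span (Set.range x)) : yReesTor x f 0 0 ≠ ⊥ := by
  intro h
  rw [yReesTor_eq_bot_iff_forall] at h
  have h1 : (Pi.single ∅ 1 : Finset (Fin (n + m)) → reesAlgebra I) ∈
      koszulChains (reesAlgebra I) (n + m) 0 := by
    intro T hT
    rw [Pi.single_eq_of_ne]
    exact fun h => hT (by simp [h])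
  obtain ⟨η, -, e⟩ := h (Pi.single ∅ 1) (mem_koszulCycles.2 ⟨h1, by
    funext T
    refine Finset.sum_eq_zero fun k _ => ?_
    rw [h1 _ (by simp), mul_zero]⟩) (by
      intro T k hk
      by_cases hT : T = ∅
      · subst hT
        simp only [Pi.single_eq_same, OneMemClass.coe_one, Polynomial.coeff_one]
        rw [if_neg]
        simpa using hk
      · rw [Pi.single_eq_of_ne hT]; simp)
  have e1 := congrArg (fun u : reesAlgebra I => (u : Polynomial A).coeff 0) (congrFun e ∅)
  simp only [koszulD_apply, Pi.single_eq_same, OneMemClass.coe_one, Polynomial.coeff_one_zero,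
    AddSubmonoidClass.coe_finsetSum, Polynomial.finsetSum_coeff, filter_empty, card_empty,
    pow_zero, one_mul, MulMemClass.coe_mul, coe_reesVariables, Polynomial.mul_coeff_zero] at e1
  apply hx
  rw [← e1]
  refine sum_mem fun k _ => Ideal.mul_mem_right _ _ ?_
  refine Fin.addCases (fun l => ?_) (fun l => ?_) k
  · rw [varDegree, if_neg (by simp [yVars])]
    simp only [variableValues, Fin.append_left, Polynomial.coeff_monomial, if_true]
    exact Ideal.subset_span ⟨l, rfl⟩
  · rw [varDegree, if_pos (by simp [yVars])]
    simp [Polynomial.coeff_monomial]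

/-- The `y`-regularity of the Rees algebra is zero if and only if the Koszul homology of all the
variables is linear. -/
theorem yRegularity_eq_zero_iff (x : Fin n → A) (f : Fin m → I)
    (hx : (1 : A) ∉ Ideal.span (Set.range x)) :
    yRegularity x f = 0 ↔ KoszulLinear (variableValues x f) I (yVars n m) univ := by
  have h0 : 0 ≤ yRegularity x f := by
    refine le_iSup_of_le 0 ?_
    have : (0 : EReal) ≤ yTop x f 0 :=
      le_iSup₂_of_le (f := fun (j : ℕ) (_ : yReesTor x f 0 j ≠ ⊥) => (j : EReal)) 0
        (yReesTor_zero_ne_bot x f hx) (by simp)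
    simpa using this
  have h1 : yRegularity x f ≤ 0 ↔ ∀ i j, i < j → yReesTor x f i j = ⊥ := by
    rw [yRegularity, iSup_le_iff]
    refine forall_congr' fun i => ?_
    rw [EReal.sub_nonpos, yTop, iSup₂_le_iff]
    refine forall_congr' fun j => ?_
    rw [← not_imp_not, not_le, EReal.natCast_lt_iff, Ne, not_not]
  rw [le_antisymm_iff, and_iff_left h0, h1]
  exact forall₃_congr fun i j hij => yReesTor_eq_bot_iff x f hij

end ReesTor

/-! ### Removing the variables of `y`-degree zero -/

section Nakayama

variable {A : Type*} [CommRing A] {N : ℕ} {a : Fin N → A} {I : Ideal A}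

/-- Cycles of the part of `y`-degree `j` of the Koszul complex over the Rees algebra. -/
def reesCycles (a : Fin N → A) (I : Ideal A) (Y S : Finset (Fin N)) (i j : ℕ) :
    Submodule A (Finset (Fin N) → A) :=
  reesChains I Y S i j ⊓ LinearMap.ker (koszulD a)

/-- Boundaries of the part of `y`-degree `j` of the Koszul complex over the Rees algebra. -/
def reesBoundaries (a : Fin N → A) (I : Ideal A) (Y S : Finset (Fin N)) (i j : ℕ) :
    Submodule A (Finset (Fin N) → A) :=
  (reesChains I Y S (i + 1) j).map (koszulD a)

theorem mem_reesCycles {Y S : Finset (Fin N)} {i j : ℕ} {ω : Finset (Fin N) → A} :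
    ω ∈ reesCycles a I Y S i j ↔ ω ∈ reesChains I Y S i j ∧ koszulD a ω = 0 := Iff.rfl

theorem koszulExact_iff_le {Y S : Finset (Fin N)} {i j : ℕ} :
    KoszulExact a I Y S i j ↔ reesCycles a I Y S i j ≤ reesBoundaries a I Y S i j :=
  ⟨fun h _ hω => h _ hω.1 hω.2, fun h _ hω h0 => h ⟨hω, h0⟩⟩

/-- Since `p` has `y`-degree zero, the cokernel of H_i(S)_j → H_i(S ∪ p)_j embeds into H_{i-1}(S)_j,
which is assumed to vanish. -/
theorem reesCycles_insert_le {Y S : Finset (Fin N)} (ha : ∀ k ∈ Y, a k ∈ I) {p : Fin N}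
    (hp : p ∉ S) (hY : p ∉ Y) {i j : ℕ} (h : ∀ i', i' + 1 = i → KoszulExact a I Y S i' j) :
    reesCycles a I Y (insert p S) i j ≤
      reesBoundaries a I Y (insert p S) i j ⊔ reesCycles a I Y S i j := by
  intro ω hω
  obtain ⟨hω, hD⟩ := mem_reesCycles.1 hω
  have hv : varDegree Y p = 0 := by simp [varDegree, hY]
  rcases i with _ | i
  · exact Submodule.mem_sup_right ⟨mem_reesChains_zero_insert hω, hD⟩
  · obtain ⟨ω₀, h0, ω₁, h1, rfl⟩ := exists_reesChains_decomposition hp hω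
    obtain ⟨e0, e1⟩ := koszulD_components ha hp h0 h1 (zero_mem _) (Or.inr rfl)
      (zero_mem (reesChains I Y S 0 (j - varDegree Y p))) (by simpa using hD)
    rw [hv, Nat.sub_zero] at h1
    obtain ⟨η, hη, e⟩ := h i rfl ω₁ h1 (by simpa using e1)
    have hw := koszulWedge_mem_reesChains p hη
    have hs := smul_mem_reesChains ha p hη
    rw [hv, add_zero] at hw hs
    rw [show ω₀ + koszulWedge p ω₁ = koszulD a (-koszulWedge p η) + (ω₀ + a p • η) by
      rw [map_neg, koszulD_wedge, e]; abel]
    exact Submodule.add_mem_sup ⟨_, neg_mem hw, rfl⟩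
      ⟨add_mem h0 hs, (by rw [map_add, map_smul, e, e0] : koszulD a (ω₀ + a p • η) = 0)⟩

/-- Descent along a variable of `y`-degree zero whose value lies in `𝔪`. -/
theorem reesCycles_le_of_insert {Y S : Finset (Fin N)} (ha : ∀ k ∈ Y, a k ∈ I) {p : Fin N}
    (hp : p ∉ S) (hY : p ∉ Y) {𝔪 : Ideal A} (h𝔪 : a p ∈ 𝔪) {i j : ℕ}
    (h : ∀ i', i' + 1 = i → KoszulExact a I Y S i' j)
    (h' : reesCycles a I Y (insert p S) i j ≤
      reesBoundaries a I Y (insert p S) i j ⊔ 𝔪 • reesCycles a I Y (insert p S) i j) :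
    reesCycles a I Y S i j ≤ reesBoundaries a I Y S i j ⊔ 𝔪 • reesCycles a I Y S i j := by
  intro ω hω
  have hv : varDegree Y p = 0 := by simp [varDegree, hY]
  -- The cycles multiplied by `𝔪` may be taken in `S`, by `reesCycles_insert_le`. In the equation
  -- for the components free of `p`, the extra term `a p • η₁` is then also in `𝔪` times a cycle of
  -- `S`.
  have h1 : reesCycles a I Y (insert p S) i j ≤
      reesBoundaries a I Y (insert p S) i j ⊔ 𝔪 • reesCycles a I Y S i j := by
    refine h'.trans (sup_le le_sup_left ?_)
    refine (smul_mono_right 𝔪 (reesCycles_insert_le ha hp hY h)).trans ?_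
    rw [Submodule.smul_sup]
    exact sup_le_sup_right Submodule.smul_le_right _
  obtain ⟨_, ⟨η, hη, rfl⟩, μ, hμ, e⟩ := Submodule.mem_sup.1
    (h1 ⟨reesChains_mono I Y (Finset.subset_insert _ _) _ le_rfl hω.1, hω.2⟩)
  obtain ⟨η₀, h0, η₁, h1, rfl⟩ := exists_reesChains_decomposition hp hη
  have hμ' : μ ∈ reesCycles a I Y S i j := Submodule.smul_le_right hμ
  obtain ⟨e0, e1⟩ := koszulD_components ha hp h0 h1 (sub_mem hω.1 hμ'.1) (Or.inr rfl)
    (zero_mem (reesChains I Y S 0 (j - varDegree Y p))) (by simpa using eq_sub_of_add_eq e)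
  rw [hv, Nat.sub_zero] at h1
  rw [show ω = koszulD a η₀ + (a p • η₁ + μ) by rw [← add_assoc, e0]; abel]
  exact Submodule.add_mem_sup ⟨η₀, h0, rfl⟩
    (add_mem (Submodule.smul_mem_smul h𝔪 ⟨h1, by simpa using e1⟩) hμ)

theorem koszulExact_union {Y S : Finset (Fin N)} (ha : ∀ k ∈ Y, a k ∈ I) {i j : ℕ} (hj : 1 ≤ j)
    (h : ∀ i' < i, KoszulExact a I Y S i' j) {T : Finset (Fin N)} (hT : ∀ p ∈ T, p ∉ Y) :
    ∀ i' < i, KoszulExact a I Y (T ∪ S) i' j := by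
  induction T using Finset.induction_on with
  | empty => simpa using h
  | insert p T _ ih =>
    intro i' hi'
    have ih := ih fun q hq => hT q (Finset.mem_insert_of_mem hq)
    rw [Finset.insert_union]
    refine koszulExact_insert ha p hj (ih i' hi') fun i'' hi'' => ?_
    rw [show varDegree Y p = 0 by simp [varDegree, hT p (Finset.mem_insert_self _ _)]]
    exact ih _ (by omega)

/-- The `x`-variables are deleted one at a time; at each stage the vanishing in lower homological
degrees is supplied by `koszulExact_union`. -/
theorem reesCycles_le_of_union {Y S : Finset (Fin N)} (ha : ∀ k ∈ Y, a k ∈ I) {𝔪 : Ideal A}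
    {i j : ℕ} (hj : 1 ≤ j) (h : ∀ i' < i, KoszulExact a I Y S i' j) {T : Finset (Fin N)}
    (hT : ∀ p ∈ T, p ∉ Y ∧ a p ∈ 𝔪)
    (h' : reesCycles a I Y (T ∪ S) i j ≤
      reesBoundaries a I Y (T ∪ S) i j ⊔ 𝔪 • reesCycles a I Y (T ∪ S) i j) :
    reesCycles a I Y S i j ≤ reesBoundaries a I Y S i j ⊔ 𝔪 • reesCycles a I Y S i j := by
  induction T using Finset.induction_on with
  | empty => simpa using h'
  | insert p T _ ih =>
    have hT' : ∀ q ∈ T, q ∉ Y ∧ a q ∈ 𝔪 := fun q hq => hT q (Finset.mem_insert_of_mem hq)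
    refine ih hT' ?_
    rw [Finset.insert_union] at h'
    by_cases hp : p ∈ T ∪ S
    · rwa [Finset.insert_eq_of_mem hp] at h'
    · obtain ⟨hpY, hp𝔪⟩ := hT p (Finset.mem_insert_self _ _)
      exact reesCycles_le_of_insert ha hp hpY hp𝔪 (fun i' hi' =>
        koszulExact_union ha hj h (fun q hq => (hT' q hq).1) i' (by omega)) h'

end Nakayama

/-! ### Homogeneous components of chains and graded Nakayama -/

section GradedNakayama

variable {K A : Type*} [Field K] [CommRing A] [Algebra K A] (𝒜 : ℕ → Submodule K A)
  [GradedAlgebra 𝒜] {N : ℕ} {a : Fin N → A} {I : Ideal A}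

/-- The homogeneous component of degree `d` of a Koszul chain, where `e_T` has degree
`∑ t ∈ T, δ t`. -/
noncomputable def chainComponent (δ : Fin N → ℕ) (d : ℕ) (ω : Finset (Fin N) → A) :
    Finset (Fin N) → A :=
  fun T => if ∑ t ∈ T, δ t ≤ d then GradedRing.proj 𝒜 (d - ∑ t ∈ T, δ t) (ω T) else 0

theorem chainComponent_add (δ : Fin N → ℕ) (d : ℕ) (ω η : Finset (Fin N) → A) :
    chainComponent 𝒜 δ d (ω + η) = chainComponent 𝒜 δ d ω + chainComponent 𝒜 δ d η := by
  funext T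
  simp only [chainComponent, Pi.add_apply, map_add]
  split_ifs <;> simp

theorem chainComponent_zero (δ : Fin N → ℕ) (d : ℕ) :
    chainComponent 𝒜 δ d (0 : Finset (Fin N) → A) = 0 := by
  funext T
  simp [chainComponent]

theorem isHomogeneous_pow (hI : I.IsHomogeneous 𝒜) (e : ℕ) : (I ^ e).IsHomogeneous 𝒜 := by
  induction e with
  | zero => rw [pow_zero, Ideal.one_eq_top]; exact Ideal.IsHomogeneous.top 𝒜
  | succ e ih => rw [pow_succ]; exact ih.mul hI

theorem chainComponent_mem (hI : I.IsHomogeneous 𝒜) (δ : Fin N → ℕ) (d : ℕ)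
    {Y S : Finset (Fin N)} {i j : ℕ} {ω : Finset (Fin N) → A} (hω : ω ∈ reesChains I Y S i j) :
    chainComponent 𝒜 δ d ω ∈ reesChains I Y S i j := by
  intro T
  unfold chainComponent
  split_ifs with h
  · refine ⟨fun h0 => (hω T).1 fun h' => h0 (by rw [h', map_zero]), ?_⟩
    exact isHomogeneous_pow 𝒜 hI _ _ (hω T).2
  · simp

theorem proj_mul_of_left_mem {d e : ℕ} {u v : A} (hu : u ∈ 𝒜 d) :
    GradedRing.proj 𝒜 e (u * v) = if d ≤ e then u * GradedRing.proj 𝒜 (e - d) v else 0 := by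
  rw [GradedRing.proj_apply, GradedRing.proj_apply, DirectSum.coe_decompose_mul_of_left_mem 𝒜 _ hu]

theorem koszulD_chainComponent {δ : Fin N → ℕ} (ha : ∀ k, a k ∈ 𝒜 (δ k)) (d : ℕ)
    (ω : Finset (Fin N) → A) :
    koszulD a (chainComponent 𝒜 δ d ω) = chainComponent 𝒜 δ d (koszulD a ω) := by
  funext T
  have hs : ∀ k, k ∈ Tᶜ → ∑ t ∈ insert k T, δ t = δ k + ∑ t ∈ T, δ t := fun k hk =>
    Finset.sum_insert (by simpa using hk)
  rw [koszulD_apply, chainComponent, koszulD_apply, map_sum]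
  have hmem : ∀ k e, (-1) ^ e * a k ∈ 𝒜 (δ k) := by
    intro k e
    rcases neg_one_pow_eq_or A e with h | h <;> rw [h]
    · rw [one_mul]; exact ha k
    · rw [neg_one_mul]; exact neg_mem (ha k)
  split_ifs with h
  · refine Finset.sum_congr rfl fun k hk => ?_
    rw [proj_mul_of_left_mem 𝒜 (hmem k _), chainComponent, hs k hk]
    by_cases h' : δ k ≤ d - ∑ t ∈ T, δ t
    · rw [if_pos h', if_pos (by omega), Nat.sub_sub, add_comm (δ k)]
    · rw [if_neg h', if_neg (by omega), mul_zero]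
  · refine Finset.sum_eq_zero fun k hk => ?_
    rw [chainComponent, hs k hk, if_neg (by omega), mul_zero]

theorem chainComponent_smul_succ (δ : Fin N → ℕ) (d : ℕ) {u : A} (hu : u ∈ 𝒜 1)
    (ω : Finset (Fin N) → A) :
    chainComponent 𝒜 δ (d + 1) (u • ω) = u • chainComponent 𝒜 δ d ω := by
  funext T
  rw [Pi.smul_apply, chainComponent, chainComponent, Pi.smul_apply, smul_eq_mul, smul_eq_mul,
    proj_mul_of_left_mem 𝒜 hu]
  by_cases h : ∑ t ∈ T, δ t ≤ d
  · rw [if_pos h, if_pos (by omega), if_pos (by omega)]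
    rw [show d + 1 - ∑ t ∈ T, δ t - 1 = d - ∑ t ∈ T, δ t by omega]
  · rw [if_neg h, mul_zero]
    split_ifs <;> first | rfl | omega

theorem chainComponent_smul_zero (δ : Fin N → ℕ) {u : A} (hu : u ∈ 𝒜 1)
    (ω : Finset (Fin N) → A) : chainComponent 𝒜 δ 0 (u • ω) = 0 := by
  funext T
  rw [chainComponent, Pi.smul_apply, smul_eq_mul, proj_mul_of_left_mem 𝒜 hu]
  split_ifs <;> first | rfl | omega

theorem exists_sum_proj_eq (u : A) :
    ∃ M, ∀ M' ≥ M, ∑ e ∈ Finset.range M', GradedRing.proj 𝒜 e u = u := by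
  classical
  refine ⟨(DirectSum.decompose 𝒜 u).support.sup id + 1, fun M' hM' => ?_⟩
  conv_rhs => rw [← DirectSum.sum_support_decompose 𝒜 u]
  refine (Finset.sum_subset (fun e he => ?_) fun e _ he => ?_).symm
  · have := Finset.le_sup (f := id) he
    simp only [id] at this
    exact Finset.mem_range.2 (by omega)
  · rw [DFinsupp.notMem_support_iff] at he
    rw [GradedRing.proj_apply, he]
    rfl

theorem exists_sum_chainComponent_eq (δ : Fin N → ℕ) (ω : Finset (Fin N) → A) :
    ∃ M, ∑ d ∈ Finset.range M, chainComponent 𝒜 δ d ω = ω := by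
  choose M hM using fun T => exists_sum_proj_eq 𝒜 (ω T)
  refine ⟨(univ.sup M) + ∑ t, δ t, ?_⟩
  funext T
  have h1 : M T ≤ univ.sup M := Finset.le_sup (mem_univ T)
  have h2 : ∑ t ∈ T, δ t ≤ ∑ t, δ t := Finset.sum_le_sum_of_subset (subset_univ T)
  obtain ⟨e, he⟩ : ∃ e, univ.sup M + ∑ t, δ t = ∑ t ∈ T, δ t + e :=
    ⟨univ.sup M + ∑ t, δ t - ∑ t ∈ T, δ t, by omega⟩
  rw [Finset.sum_apply, he, Finset.sum_range_add, Finset.sum_eq_zero, zero_add]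
  · conv_rhs => rw [← hM T e (by omega)]
    refine Finset.sum_congr rfl fun d _ => ?_
    rw [chainComponent, if_pos (by omega), Nat.add_sub_cancel_left]
  · intro d hd
    rw [chainComponent, if_neg (by simpa using hd)]

/-- Graded Nakayama's lemma for the Koszul homology over the Rees algebra. -/
theorem koszulExact_of_le {δ : Fin N → ℕ} (ha : ∀ k, a k ∈ 𝒜 (δ k)) (hI : I.IsHomogeneous 𝒜)
    {n : ℕ} {x : Fin n → A} (hx : ∀ l, x l ∈ 𝒜 1) {Y S : Finset (Fin N)} {i j : ℕ}
    (h : reesCycles a I Y S i j ≤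
      reesBoundaries a I Y S i j ⊔ Ideal.span (Set.range x) • reesCycles a I Y S i j) :
    KoszulExact a I Y S i j := by
  -- Multiplication by an element of degree one reduces the component of degree `d + 1` to that of
  -- degree `d`. Degrees are bounded below, so no finiteness of the homology is needed.
  have key : ∀ d, ∀ ω ∈ reesCycles a I Y S i j,
      chainComponent 𝒜 δ d ω ∈ reesBoundaries a I Y S i j := by
    intro d
    induction d using Nat.strong_induction_on with
    | _ d ih =>
    intro ω hω
    obtain ⟨_, ⟨η, hη, rfl⟩, μ, hμ, rfl⟩ := Submodule.mem_sup.1 (h hω)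
    rw [chainComponent_add, ← koszulD_chainComponent 𝒜 ha]
    refine add_mem ⟨_, chainComponent_mem 𝒜 hI δ d hη, rfl⟩ ?_
    clear hω
    induction hμ using Submodule.smul_induction_on' with
    | smul r hr c hc =>
      induction hr using Submodule.span_induction generalizing c with
      | mem r hr =>
        obtain ⟨l, rfl⟩ := hr
        rcases d with _ | d
        · rw [chainComponent_smul_zero 𝒜 δ (hx l)]
          exact zero_mem _
        · rw [chainComponent_smul_succ 𝒜 δ d (hx l)]
          exact Submodule.smul_mem _ _ (ih d (by omega) c hc)
      | zero => rw [zero_smul, chainComponent_zero]; exact zero_mem _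
      | add r s _ _ hr hs =>
        rw [add_smul, chainComponent_add]
        exact add_mem (hr c hc) (hs c hc)
      | smul s r _ hr =>
        rw [smul_eq_mul, mul_comm, mul_smul]
        exact hr _ (Submodule.smul_mem _ _ hc)
    | add x _ y _ hx hy =>
      rw [chainComponent_add]
      exact add_mem hx hy
  rw [koszulExact_iff_le]
  intro ω hω
  obtain ⟨M, hM⟩ := exists_sum_chainComponent_eq 𝒜 δ ω
  rw [← hM]
  exact sum_mem fun d _ => key d ω hω

/-- The `y`-regularity of the Rees algebra vanishes if and only if the Koszul homology of the
generators of the ideal over the Rees algebra is linear. -/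
theorem yRegularity_eq_zero_iff_koszulLinear (hI : I.IsHomogeneous 𝒜) {n m : ℕ} (hA : Nontrivial A)
    {x : Fin n → A} (hx : ∀ l, x l ∈ 𝒜 1) {f : Fin m → I}
    (hf : ∀ j, SetLike.IsHomogeneousElem 𝒜 (f j : A)) :
    yRegularity x f = 0 ↔ KoszulLinear (fun j => (f j : A)) I univ univ := by
  -- The elements `x l` lie in the irrelevant ideal, which does not contain `1` because `A` is
  -- nontrivial.
  have h1 : (1 : A) ∉ Ideal.span (Set.range x) := by
    intro h
    have h0 : Ideal.span (Set.range x) ≤ (HomogeneousIdeal.irrelevant 𝒜).toIdeal := by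
      rw [Ideal.span_le]
      rintro _ ⟨l, rfl⟩
      change x l ∈ HomogeneousIdeal.irrelevant 𝒜
      rw [HomogeneousIdeal.mem_irrelevant_iff, GradedRing.proj_apply,
        DirectSum.decompose_of_mem_ne 𝒜 (hx l) (by simp)]
    have h2 := h0 h
    change (1 : A) ∈ HomogeneousIdeal.irrelevant 𝒜 at h2
    rw [HomogeneousIdeal.mem_irrelevant_iff, GradedRing.proj_apply,
      DirectSum.decompose_of_mem_same 𝒜 SetLike.GradedOne.one_mem] at h2
    exact one_ne_zero h2
  have hv := variableValues_mem x f
  choose δ hδ using hf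
  have ha : ∀ k, variableValues x f k ∈ 𝒜 (Fin.append (fun _ => 1) δ k) := by
    intro k
    refine Fin.addCases (fun l => ?_) (fun l => ?_) k
    · simpa [variableValues] using hx l
    · simpa [variableValues] using hδ l
  have hY : yVars n m = univ.map (Fin.natAddOrderEmb n).toEmbedding := by
    ext k
    refine Fin.addCases (fun l => ?_) (fun l => ?_) k
    · simp only [yVars, mem_filter, mem_univ, true_and, Fin.val_castAdd, mem_map]
      refine ⟨fun h => absurd l.isLt (by omega), fun ⟨l', h⟩ => ?_⟩
      have : n + l'.val = l.val := congrArg Fin.val h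
      omega
    · simp only [yVars, mem_filter, mem_univ, true_and, Fin.val_natAdd, mem_map]
      exact ⟨fun _ => ⟨l, rfl⟩, fun _ => by omega⟩
  have h2 : KoszulLinear (fun j => (f j : A)) I univ univ ↔
      KoszulLinear (variableValues x f) I (yVars n m) (yVars n m) := by
    refine forall₃_congr fun i j _ => ?_
    have := koszulExact_comp_iff (I := I) (Y := yVars n m) (Y' := univ) (Fin.natAddOrderEmb n) hv
      (by simp [yVars]) (i := i) (j := j)
    rw [← hY] at this
    rw [← this]
    have he : (fun j => (f j : A)) = variableValues x f ∘ Fin.natAddOrderEmb n := by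
      funext l
      exact (Fin.append_right x (fun j => (f j : A)) l).symm
    rw [he]
  rw [yRegularity_eq_zero_iff x f h1, h2]
  refine ⟨fun h i => ?_, fun h => h.mono hv (subset_univ _)⟩
  -- Induction on the homological degree: vanishing of the lower homology of the `y`-variables in
  -- degree `j` is exactly what the descent along the `x`-variables consumes.
  induction i using Nat.strong_induction_on with
  | _ i ih =>
  intro j hij
  refine koszulExact_of_le 𝒜 ha hI hx
    (reesCycles_le_of_union hv (by omega) (fun i' hi' => ih i' hi' j (by omega))
      (T := univ \ yVars n m) (fun p hp => ?_) ?_)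
  · rw [mem_sdiff] at hp
    refine ⟨hp.2, ?_⟩
    have hp := hp.2
    revert hp
    refine Fin.addCases (fun l _ => ?_) (fun l hl => ?_) p
    · rw [variableValues, Fin.append_left]
      exact Ideal.subset_span ⟨l, rfl⟩
    · simp [yVars] at hl
  · rw [Finset.sdiff_union_of_subset (subset_univ _)]
    exact (koszulExact_iff_le.1 (h i j hij)).trans le_sup_left

end GradedNakayama

/-! ### Filter-regular elements from prime avoidance over an infinite field -/

section FilterRegular

/-- In a Noetherian ring, an element `z` outside finitely many ideals not containing `E` is
filter-regular modulo `Q` with respect to `E`. -/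
theorem exists_finite_ideals_filterRegular {R : Type*} [CommRing R] [IsNoetherianRing R]
    (E Q : Ideal R) : ∃ ℬ : Set (Ideal R), ℬ.Finite ∧ (∀ P ∈ ℬ, ¬ E ≤ P) ∧
      ∀ z, (∀ P ∈ ℬ, z ∉ P) → ∃ n₀, ∀ n ≥ n₀, ∀ p ∈ E ^ n, z * p ∈ Q → p ∈ Q := by
  -- The chain of ideals `Q : E ^ s` stabilises at the saturation `Q'`. The ideals to avoid are the
  -- associated primes of `R ⧸ Q'`; saturation ensures that none of them contains `E`.
  obtain ⟨s, hs⟩ := monotone_stabilizes_iff_noetherian.2 (inferInstance : IsNoetherian R R)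
    ⟨fun s => Submodule.colon Q (E ^ s : Ideal R), fun s s' h r hr =>
      Submodule.mem_colon.2 fun u hu =>
        Submodule.mem_colon.1 hr u (Ideal.pow_le_pow_right h hu)⟩
  set Q' : Ideal R := Submodule.colon Q (E ^ s : Ideal R) with hQ'
  have hQ'E : ∀ r, (∀ e ∈ E, r * e ∈ Q') → r ∈ Q' := by
    intro r hr
    rw [hQ', show Submodule.colon Q (E ^ s : Ideal R) = Submodule.colon Q (E ^ (s + 1) : Ideal R)
      from hs (s + 1) (by omega), Submodule.mem_colon]
    intro u hu
    rw [SetLike.mem_coe, pow_succ'] at hu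
    induction hu using Submodule.mul_induction_on' with
    | mem_mul_mem e he v hv =>
      have := Submodule.mem_colon.1 (hr e he) v hv
      rwa [smul_eq_mul, mul_assoc] at this
    | add x _ y _ hx hy =>
      rw [smul_add]
      exact add_mem hx hy
  have hQQ' : Q ≤ Q' := fun r hr => Submodule.mem_colon.2 fun u _ => Ideal.mul_mem_right _ _ hr
  refine ⟨associatedPrimes R (R ⧸ Q'), associatedPrimes.finite R (R ⧸ Q'), ?_, ?_⟩
  · intro P hP hE
    obtain ⟨hP, y, rfl⟩ := isAssociatedPrime_iff.1 hP
    obtain ⟨r, rfl⟩ := Ideal.Quotient.mk_surjective y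
    refine hP.ne_top ((Ideal.eq_top_iff_one _).2 ?_)
    rw [Submodule.mem_colon_singleton, one_smul, Submodule.mem_bot, Ideal.Quotient.eq_zero_iff_mem]
    refine hQ'E r fun e he => ?_
    have := hE he
    rw [Submodule.mem_colon_singleton, Submodule.mem_bot, Algebra.smul_def,
      Ideal.Quotient.algebraMap_eq, ← map_mul, Ideal.Quotient.eq_zero_iff_mem] at this
    rwa [mul_comm]
  · intro z hz
    have hreg : ∀ r, z * r ∈ Q' → r ∈ Q' := by
      intro r hr
      by_contra h
      obtain ⟨P, hP, hle⟩ := exists_le_isAssociatedPrime_of_isNoetherianRing R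
        (Ideal.Quotient.mk Q' r) (fun h' => h (Ideal.Quotient.eq_zero_iff_mem.1 h'))
      refine hz P hP (hle ?_)
      rwa [Submodule.mem_colon_singleton, Submodule.mem_bot, Algebra.smul_def,
        Ideal.Quotient.algebraMap_eq, ← map_mul, Ideal.Quotient.eq_zero_iff_mem]
    -- Artin–Rees: for large `n`, `E ^ n ∩ (Q : z)` is `E ^ (n - k)` times a subideal of `Q : z`.
    -- Since `z` is regular modulo `Q'`, that colon lies in `Q'`, and `E ^ s * Q'` lies in `Q`.
    obtain ⟨k, hk⟩ := Ideal.exists_pow_inf_eq_pow_smul E (Submodule.colon Q {z})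
    refine ⟨k + s, fun n hn p hp hzp => ?_⟩
    have hp' : p ∈ E ^ n • (⊤ : Submodule R R) ⊓ Submodule.colon Q {z} :=
      ⟨by simpa using hp, by rwa [SetLike.mem_coe, Submodule.mem_colon_singleton, smul_eq_mul,
        mul_comm]⟩
    rw [hk n (by omega)] at hp'
    have hle : E ^ (n - k) • (E ^ k • (⊤ : Submodule R R) ⊓ Submodule.colon Q {z}) ≤
        E ^ s • Q' := by
      refine Submodule.smul_mono (Ideal.pow_le_pow_right (by omega)) (inf_le_right.trans ?_)
      intro r hr
      rw [Submodule.mem_colon_singleton, smul_eq_mul, mul_comm] at hr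
      exact hreg r (hQQ' hr)
    refine (Submodule.smul_le.2 fun e he r hr => ?_ : E ^ s • Q' ≤ Q) (hle hp')
    rw [smul_eq_mul, mul_comm]
    exact Submodule.mem_colon.1 hr e he

variable {A : Type*} [CommRing A]

theorem exists_mem_pow_span_reesι (I : Ideal A) (n : ℕ) : ∀ w ∈ I ^ n,
    ∃ p ∈ Ideal.span (Set.range (reesι I)) ^ n, (p : Polynomial A) = Polynomial.monomial n w := by
  induction n with
  | zero =>
    intro w _
    exact ⟨algebraMap A _ w, by simp, rfl⟩
  | succ n ih =>
    intro w hw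
    rw [pow_succ'] at hw
    induction hw using Submodule.mul_induction_on' with
    | mem_mul_mem u hu v hv =>
      obtain ⟨p, hp, e⟩ := ih v hv
      refine ⟨reesι I ⟨u, hu⟩ * p, ?_, ?_⟩
      · rw [pow_succ']
        exact Ideal.mul_mem_mul (Ideal.subset_span ⟨_, rfl⟩) hp
      · rw [MulMemClass.coe_mul, e]
        change Polynomial.monomial 1 u * _ = _
        rw [Polynomial.monomial_mul_monomial, add_comm]
    | add x _ y _ hx hy =>
      obtain ⟨p, hp, e⟩ := hx
      obtain ⟨p', hp', e'⟩ := hy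
      exact ⟨p + p', add_mem hp hp', by rw [AddMemClass.coe_add, e, e', map_add]⟩

/-- The ideal of the Rees algebra whose component of degree `n` is `q n`. -/
def reesIdeal (I : Ideal A) (q : ℕ → Ideal A) (hq : ∀ i n, I ^ i * q n ≤ q (i + n)) :
    Ideal (reesAlgebra I) where
  carrier := {p | ∀ n, (p : Polynomial A).coeff n ∈ q n}
  add_mem' {p p'} hp hp' n := by
    rw [AddMemClass.coe_add, Polynomial.coeff_add]
    exact add_mem (hp n) (hp' n)
  zero_mem' n := by simp
  smul_mem' c p hp n := by
    rw [smul_eq_mul, MulMemClass.coe_mul, Polynomial.coeff_mul]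
    refine sum_mem fun ij hij => ?_
    rw [← Finset.HasAntidiagonal.mem_antidiagonal.1 hij]
    exact hq _ _ (Ideal.mul_mem_mul (c.2 _) (hp _))

theorem mem_reesIdeal {I : Ideal A} {q : ℕ → Ideal A} {hq : ∀ i n, I ^ i * q n ≤ q (i + n)}
    {p : reesAlgebra I} : p ∈ reesIdeal I q hq ↔ ∀ n, (p : Polynomial A).coeff n ∈ q n := Iff.rfl

/-- The existence of generic elements of an ideal over an infinite field. -/
theorem exists_filterRegular {K : Type*} [Field K] [Infinite K] [Algebra K A] [IsNoetherianRing A]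
    {I : Ideal A} {V W : Submodule K A} (hV : Ideal.span (V : Set A) = I) (hW : ¬ V ≤ W)
    {ι : Type*} [Finite ι] (q : ι → ℕ → Ideal A) (hq : ∀ c i n, I ^ i * q c n ≤ q c (i + n)) :
    ∃ v ∈ V, v ∉ W ∧ ∀ c, ∃ n₀, ∀ n ≥ n₀, ∀ w ∈ I ^ n, v * w ∈ q c (n + 1) → w ∈ q c n := by
  have hVI : ∀ v ∈ V, v ∈ I := fun v hv => hV ▸ Ideal.subset_span hv
  choose ℬ hfin hE hreg using fun c =>
    exists_finite_ideals_filterRegular (Ideal.span (Set.range (reesι I))) (reesIdeal I (q c) (hq c))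
  -- Each bad ideal of the Rees algebra cuts out a `K`-subspace of `V`, and it is proper: otherwise
  -- it would contain `I t`, since `V` generates `I`.
  let pull : Ideal (reesAlgebra I) → Submodule K V := fun P =>
    { carrier := {v | reesι I ⟨v, hVI _ v.2⟩ ∈ P}
      add_mem' := fun {u v} hu hv => by
        have h := map_add (reesι I) ⟨u, hVI _ u.2⟩ ⟨v, hVI _ v.2⟩
        exact (congrArg (· ∈ P) h).mpr (P.add_mem hu hv)
      zero_mem' := by
        have := map_zero (reesι I)
        exact (congrArg (· ∈ P) this).mpr (zero_mem P)
      smul_mem' := fun c v hv => by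
        have h : reesι I ⟨(c • v : V), hVI _ (c • v).2⟩ =
            algebraMap A (reesAlgebra I) (algebraMap K A c) * reesι I ⟨v, hVI _ v.2⟩ := by
          rw [← Algebra.smul_def, ← map_smul]
          congr 1
          ext1
          simp [Algebra.smul_def]
        exact (congrArg (· ∈ P) h).mpr (Ideal.mul_mem_left _ _ hv) }
  have hpull : ∀ c, ∀ P ∈ ℬ c, pull P ≠ ⊤ := by
    intro c P hP h
    refine hE c P hP (Ideal.span_le.2 ?_)
    rintro _ ⟨u, rfl⟩
    have hle : I ≤ Submodule.map I.subtype ((P.restrictScalars A).comap (reesι I)) := by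
      conv_lhs => rw [← hV]
      refine Ideal.span_le.2 fun v hv => ⟨⟨v, hVI v hv⟩, ?_, rfl⟩
      have : (⟨v, hv⟩ : V) ∈ pull P := h ▸ Submodule.mem_top
      exact this
    obtain ⟨u', hu', e⟩ := hle u.2
    rwa [← Subtype.ext (e : (u' : A) = u)]
  have hf : (⋃ c, ℬ c).Finite := Set.finite_iUnion hfin
  -- A vector space over an infinite field is not a finite union of proper subspaces. Including `W`
  -- keeps the chosen element outside the span of the earlier ones.
  let 𝒮 : Finset (Subspace K V) := by
    classical exact insert (W.comap V.subtype) (hf.toFinset.image pull)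
  have htop : ⊤ ∉ 𝒮 := by
    simp only [𝒮, Finset.mem_insert, Finset.mem_image, Set.Finite.mem_toFinset, Set.mem_iUnion,
      not_or, not_exists, not_and]
    refine ⟨fun h => hW fun v hv => ?_, fun P ⟨c, hP⟩ => hpull c P hP⟩
    have : (⟨v, hv⟩ : V) ∈ W.comap V.subtype := h ▸ Submodule.mem_top
    exact this
  have hne := Subspace.biUnion_ne_univ_of_top_notMem htop
  obtain ⟨v, hv⟩ := (Set.ne_univ_iff_exists_notMem _).1 hne
  simp only [Set.mem_iUnion, not_exists] at hv
  refine ⟨v, v.2, fun h => hv (W.comap V.subtype) (by simp [𝒮]) h, fun c => ?_⟩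
  obtain ⟨n₀, hn₀⟩ := hreg c (reesι I ⟨v, hVI _ v.2⟩) fun P hP h =>
    hv (pull P) (by simp only [𝒮, Finset.mem_insert, Finset.mem_image, Set.Finite.mem_toFinset,
      Set.mem_iUnion]; exact Or.inr ⟨P, ⟨c, hP⟩, rfl⟩) h
  refine ⟨n₀, fun n hn w hw hvw => ?_⟩
  obtain ⟨p, hp, e⟩ := exists_mem_pow_span_reesι I n w hw
  have h1 := mem_reesIdeal.1 (hn₀ n hn p hp (mem_reesIdeal.2 fun k => ?_)) n
  · rwa [e, Polynomial.coeff_monomial_same] at h1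
  · rw [MulMemClass.coe_mul, e]
    change (Polynomial.monomial 1 (v : A) * _).coeff k ∈ _
    rw [Polynomial.monomial_mul_monomial, add_comm, Polynomial.coeff_monomial]
    split_ifs with h
    · exact h ▸ hvw
    · exact zero_mem _

end FilterRegular

/-! ### Generic generating sequences -/

section GenericSequence

variable {A : Type*} [CommRing A]

/-- Multiplication with `v` is injective in large degrees on the Rees algebra of `I` modulo `𝔞 t`
and on the associated graded ring of `I` modulo the initial forms of `𝔞`. -/
def IsFilterRegular (I 𝔞 : Ideal A) (v : A) : Prop :=
  ∃ n₀, ∀ n ≥ n₀, ∀ w ∈ I ^ n, (v * w ∈ 𝔞 * I ^ n → w ∈ 𝔞 * I ^ (n - 1)) ∧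
    (v * w ∈ 𝔞 ⊔ I ^ (n + 2) → w ∈ 𝔞 ⊔ I ^ (n + 1))

/-- Both conditions are instances of `exists_filterRegular`, for the graded families `𝔞 * I ^ (n -
1)` and `𝔞 ⊔ I ^ (n + 1)`. The truncated exponent at `n = 0` is harmless, as only large `n` matter.
-/
theorem exists_isFilterRegular {K : Type*} [Field K] [Infinite K] [Algebra K A]
    [IsNoetherianRing A] {I : Ideal A} {V W : Submodule K A} (hV : Ideal.span (V : Set A) = I)
    (hW : ¬ V ≤ W) (𝔞 : Ideal A) : ∃ v ∈ V, v ∉ W ∧ IsFilterRegular I 𝔞 v := by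
  obtain ⟨v, hv, hvW, h⟩ := exists_filterRegular hV hW
    (fun (c : Bool) n => bif c then 𝔞 * I ^ (n - 1) else 𝔞 ⊔ I ^ (n + 1)) (by
      rintro (_ | _) i n
      · simp only [cond_false]
        rw [Ideal.mul_sup, ← pow_add]
        exact sup_le_sup Ideal.mul_le_right (Ideal.pow_le_pow_right (by omega))
      · simp only [cond_true]
        rw [mul_left_comm, ← pow_add]
        exact Ideal.mul_mono_right (Ideal.pow_le_pow_right (by omega)))
  obtain ⟨n₁, h₁⟩ := h true
  obtain ⟨n₂, h₂⟩ := h false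
  exact ⟨v, hv, hvW, max n₁ n₂, fun n hn w hw =>
    ⟨h₁ n (le_trans (le_max_left _ _) hn) w hw, h₂ n (le_trans (le_max_right _ _) hn) w hw⟩⟩

theorem initSpan_snoc_castSucc {d : ℕ} (z : Fin d → A) (v : A) (p : Fin d) :
    initSpan (Fin.snoc z v : Fin (d + 1) → A) p.castSucc = initSpan z p := by
  unfold initSpan
  congr 1
  ext w
  constructor
  · rintro ⟨l, hl, rfl⟩
    obtain ⟨l, rfl⟩ : ∃ l', Fin.castSucc l' = l :=
      ⟨l.castLT (lt_of_lt_of_le (Fin.lt_def.1 hl) p.isLt.le), rfl⟩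
    exact ⟨l, hl, by simp⟩
  · rintro ⟨l, hl, rfl⟩
    exact ⟨l.castSucc, hl, by simp⟩

theorem initSpan_snoc_last {d : ℕ} (z : Fin d → A) (v : A) :
    initSpan (Fin.snoc z v : Fin (d + 1) → A) (Fin.last d) = Ideal.span (Set.range z) := by
  unfold initSpan
  congr 1
  ext w
  constructor
  · rintro ⟨l, hl, rfl⟩
    obtain ⟨l, rfl⟩ : ∃ l', Fin.castSucc l' = l := ⟨l.castLT (Fin.lt_def.1 hl), rfl⟩
    exact ⟨l, by simp⟩
  · rintro ⟨l, rfl⟩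
    exact ⟨l.castSucc, Fin.castSucc_lt_last l, by simp⟩

/-- Generic linear combinations of the generators of an ideal form a filter-regular sequence. -/
theorem exists_filterRegular_sequence {K : Type*} [Field K] [Infinite K] [Algebra K A]
    [IsNoetherianRing A] {I : Ideal A} {m : ℕ} {f : Fin m → A}
    (hf : Ideal.span (Set.range f) = I) :
    ∃ (r : ℕ) (z : Fin r → A), Ideal.span (Set.range z) = I ∧
      ∀ p, IsFilterRegular I (initSpan z p) (z p) := by
  set V := Submodule.span K (Set.range f) with hVdef
  have : FiniteDimensional K V := FiniteDimensional.span_of_finite K (Set.finite_range f)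
  have hV : Ideal.span (V : Set A) = I := by
    rw [← hf]
    refine le_antisymm (Ideal.span_le.2 ?_) (Ideal.span_mono Submodule.subset_span)
    have : V ≤ (Ideal.span (Set.range f)).restrictScalars K :=
      Submodule.span_le.2 Ideal.subset_span
    exact this
  -- Linear independence is carried along so that a sequence of length `Module.finrank K V` spans
  -- `V` and therefore generates `I`.
  have key : ∀ d ≤ Module.finrank K V, ∃ z : Fin d → A, (∀ l, z l ∈ V) ∧ LinearIndependent K z ∧
      ∀ p, IsFilterRegular I (initSpan z p) (z p) := by
    intro d
    induction d with
    | zero => exact fun _ => ⟨Fin.elim0, fun l => l.elim0, linearIndependent_empty_type,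
        fun p => p.elim0⟩
    | succ d ih =>
      intro hd
      obtain ⟨z, hzV, hz, hreg⟩ := ih (by omega)
      have hW : ¬ V ≤ Submodule.span K (Set.range z) := by
        intro hle
        have : FiniteDimensional K (Submodule.span K (Set.range z)) :=
          FiniteDimensional.span_of_finite K (Set.finite_range z)
        have h1 := Submodule.finrank_mono hle
        rw [finrank_span_eq_card hz, Fintype.card_fin] at h1
        omega
      obtain ⟨v, hvV, hvW, hv⟩ := exists_isFilterRegular hV hW (Ideal.span (Set.range z))
      refine ⟨Fin.snoc z v, fun l => ?_, linearIndependent_finSnoc.2 ⟨hz, hvW⟩, fun p => ?_⟩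
      · refine Fin.lastCases ?_ (fun l => ?_) l <;> simp [hvV, hzV]
      · refine Fin.lastCases ?_ (fun p => ?_) p
        · rwa [initSpan_snoc_last, Fin.snoc_last]
        · rw [initSpan_snoc_castSucc, Fin.snoc_castSucc]
          exact hreg p
  obtain ⟨z, hzV, hz, hreg⟩ := key _ le_rfl
  refine ⟨_, z, ?_, hreg⟩
  have hspan : Submodule.span K (Set.range z) = V :=
    Submodule.eq_of_le_of_finrank_eq (Submodule.span_le.2 (by rintro _ ⟨l, rfl⟩; exact hzV l))
      (by rw [finrank_span_eq_card hz, Fintype.card_fin])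
  rw [← hV]
  refine le_antisymm (Ideal.span_mono (by rintro _ ⟨l, rfl⟩; exact hzV l)) (Ideal.span_le.2 ?_)
  have : Submodule.span K (Set.range z) ≤ (Ideal.span (Set.range z)).restrictScalars K :=
    Submodule.span_le.2 Ideal.subset_span
  rwa [hspan] at this

end GenericSequence

/-! ### `d`-sequences, `c`-sequences and relative injectivity -/

section DSequences

variable {A : Type*} [CommRing A]

/-- A filter-regular element preserves the property `𝔞 ∩ Iⁿ = 𝔞 Iⁿ⁻¹` for large `n`. -/
theorem inf_pow_le_of_isFilterRegular [IsNoetherianRing A] {I 𝔞 : Ideal A} {v : A} (hv : v ∈ I)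
    (h : IsFilterRegular I 𝔞 v) {M : ℕ} (hM : ∀ n ≥ M, 𝔞 ⊓ I ^ n ≤ 𝔞 * I ^ (n - 1)) :
    ∃ M, ∀ n ≥ M, (𝔞 ⊔ Ideal.span {v}) ⊓ I ^ n ≤ (𝔞 ⊔ Ideal.span {v}) * I ^ (n - 1) := by
  obtain ⟨n₀, hn₀⟩ := h
  obtain ⟨k, hk⟩ := Ideal.exists_pow_inf_eq_pow_smul I (𝔞 ⊔ Ideal.span {v})
  refine ⟨n₀ + M + k + 1, fun n hn x hx => ?_⟩
  -- Artin–Rees starts with `x ∈ 𝔞 + v I ^ (n - (k + 1))`. As `x ∈ I ^ n`, filter-regularity on the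
  -- associated graded ring raises the exponent one step at a time up to `n - 1`.
  have key : ∀ t, n - (k + 1) + t ≤ n - 1 → x ∈ 𝔞 ⊔ Ideal.span {v} * I ^ (n - (k + 1) + t) := by
    intro t
    induction t with
    | zero =>
      intro _
      have hx' : x ∈ I ^ n • (⊤ : Submodule A A) ⊓ (𝔞 ⊔ Ideal.span {v}) :=
        ⟨by simpa using hx.2, hx.1⟩
      rw [hk n (by omega)] at hx'
      have hle : I ^ (n - k) • (I ^ k • (⊤ : Submodule A A) ⊓ (𝔞 ⊔ Ideal.span {v})) ≤
          I ^ (n - k) * (𝔞 ⊔ Ideal.span {v}) := smul_mono_right _ inf_le_right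
      have h1 := hle hx'
      rw [Ideal.mul_sup, mul_comm _ (Ideal.span {v})] at h1
      have hle' : I ^ (n - k) * 𝔞 ⊔ Ideal.span {v} * I ^ (n - k) ≤
          𝔞 ⊔ Ideal.span {v} * I ^ (n - (k + 1) + 0) :=
        sup_le_sup Ideal.mul_le_right (Ideal.mul_mono_right (Ideal.pow_le_pow_right (by omega)))
      exact hle' h1
    | succ t ih =>
      intro ht
      obtain ⟨u, hu, y, hy, rfl⟩ := Submodule.mem_sup.1 (ih (by omega))
      obtain ⟨w, hw, rfl⟩ := Ideal.mem_span_singleton_mul.1 hy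
      have h1 := (hn₀ _ (by omega) w hw).2 (by
        rw [show v * w = -u + (u + v * w) by ring]
        exact Submodule.add_mem_sup (neg_mem hu) (Ideal.pow_le_pow_right (by omega) hx.2))
      obtain ⟨u', hu', w', hw', rfl⟩ := Submodule.mem_sup.1 h1
      rw [show u + v * (u' + w') = (u + v * u') + v * w' by ring]
      exact Submodule.add_mem_sup (add_mem hu (Ideal.mul_mem_left _ _ hu'))
        (Ideal.mul_mem_mul (Ideal.mem_span_singleton_self v) hw')
  have h1 := key k (by omega)
  rw [show n - (k + 1) + k = n - 1 by omega] at h1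
  obtain ⟨u, hu, y, hy, rfl⟩ := Submodule.mem_sup.1 h1
  have hyI : y ∈ I ^ n := by
    obtain ⟨w, hw, rfl⟩ := Ideal.mem_span_singleton_mul.1 hy
    rw [show n = (n - 1) + 1 by omega, pow_succ']
    exact Ideal.mul_mem_mul hv hw
  -- Subtracting `y = v * w ∈ I ^ n` puts `u` in `𝔞 ⊓ I ^ n`, where the hypothesis on `𝔞` applies.
  have hu' : u ∈ 𝔞 * I ^ (n - 1) := hM n (by omega) ⟨hu, by
    have := sub_mem hx.2 hyI
    rwa [add_sub_cancel_right] at this⟩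
  rw [Ideal.sup_mul]
  exact Submodule.add_mem_sup hu' hy

variable {r : ℕ} {z : Fin r → A} {I : Ideal A}

theorem exists_inf_pow_le [IsNoetherianRing A] (hzI : ∀ l, z l ∈ I)
    (hreg : ∀ p, IsFilterRegular I (initSpan z p) (z p)) {q : ℕ} (hq : q ≤ r) :
    ∃ M, ∀ n ≥ M, Ideal.span (z '' (firstVars r q : Finset (Fin r))) ⊓ I ^ n ≤
      Ideal.span (z '' (firstVars r q : Finset (Fin r))) * I ^ (n - 1) := by
  refine firstVars_induction (P := fun q => ∃ M, ∀ n ≥ M,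
    Ideal.span (z '' (firstVars r q : Finset (Fin r))) ⊓ I ^ n ≤
      Ideal.span (z '' (firstVars r q : Finset (Fin r))) * I ^ (n - 1)) ?_ (fun p ih => ?_) hq
  · exact ⟨0, fun n _ => by simp [firstVars_zero]⟩
  · rw [firstVars_val, ← initSpan_eq] at ih
    obtain ⟨M, hM⟩ := ih
    rw [firstVars_succ, Finset.coe_insert, Set.image_insert_eq, Ideal.span_insert, sup_comm,
      ← initSpan_eq]
    exact inf_pow_le_of_isFilterRegular (hzI p) (hreg p) hM

theorem initSpan_le_span (a : Fin r → A) (p : Fin r) :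
    initSpan a p ≤ Ideal.span (Set.range a) :=
  Ideal.span_mono (Set.image_subset_range _ _)

/-- A filter-regular sequence with linear Koszul homology is a `d`-sequence. -/
theorem isDSequence_of_koszulLinear [IsNoetherianRing A] (hz : Ideal.span (Set.range z) = I)
    (hreg : ∀ p, IsFilterRegular I (initSpan z p) (z p)) (hlin : KoszulLinear z I univ univ) :
    IsDSequence z := by
  have hzI : ∀ l, z l ∈ I := fun l => hz ▸ Ideal.subset_span ⟨l, rfl⟩
  have hrel : ∀ p, ∀ k ≥ 1, RelInjective z I p k := by
    choose n₀ hn₀ using hreg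
    intro p k hk
    refine relInjective_of_koszulLinear hzI hlin (k₀ := univ.sup n₀ + 1) (by omega)
      (fun p k hk w hw => (hn₀ p k ?_ w hw).1) p hk
    have := Finset.le_sup (f := n₀) (mem_univ p)
    omega
  intro p
  refine le_antisymm ?_ (le_inf (fun w hw => ?_) (initSpan_le_span z p))
  -- From large `n` downwards: if `x ∈ 𝔞 ∩ I ^ (n + 1)`, then `z p * x` lies in `𝔞 ∩ I ^ (n + 2) ⊆ 𝔞
  -- I ^ (n + 1)`, and relative injectivity cancels `z p`.
  · have hall : ∀ n, initSpan z p ⊓ I ^ (n + 1) ≤ initSpan z p * I ^ n := by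
      obtain ⟨M, hM⟩ := exists_inf_pow_le hzI hreg p.isLt.le
      rw [firstVars_val, ← initSpan_eq] at hM
      have hd : ∀ e n, M ≤ n + e → initSpan z p ⊓ I ^ (n + 1) ≤ initSpan z p * I ^ n := by
        intro e
        induction e with
        | zero => exact fun n hn => hM (n + 1) (by omega)
        | succ e ih =>
          intro n hn x hx
          refine hrel p (n + 1) (by omega) x hx.2 (ih (n + 1) (by omega) ⟨?_, ?_⟩)
          · exact Ideal.mul_mem_left _ _ hx.1
          · rw [pow_succ' I (n + 1)]
            exact Ideal.mul_mem_mul (hzI p) hx.2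
      exact fun n => hd M n (by omega)
    rintro w ⟨hw, hwI⟩
    rw [SetLike.mem_coe, Submodule.mem_colon_singleton, smul_eq_mul, mul_comm w] at hw
    have hwI : w ∈ I := hz ▸ hwI
    -- The equality `𝔞 ∩ I² = 𝔞 I` turns the colon condition of a `d`-sequence into the one of
    -- degree one for relative injectivity.
    have h1 : z p * w ∈ initSpan z p * I ^ 1 :=
      hall 1 ⟨hw, by rw [pow_two]; exact Ideal.mul_mem_mul (hzI p) hwI⟩
    simpa using hrel p 1 le_rfl w (by simpa using hwI) h1
  · rw [Submodule.mem_colon_singleton]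
    exact Ideal.mul_mem_right _ _ hw

/-- Only one inclusion in the definition carries content; the other holds for every sequence because
`a p` lies in the ideal. -/
theorem isCSequence_iff_relInjective {a : Fin r → A} :
    IsCSequence a ↔ ∀ p, ∀ k ≥ 1, RelInjective a (Ideal.span (Set.range a)) p k := by
  refine forall₃_congr fun p k hk => ⟨fun h w hw hw' => ?_, fun h => le_antisymm ?_ ?_⟩
  · rw [← h]
    exact ⟨by rwa [SetLike.mem_coe, Submodule.mem_colon_singleton, smul_eq_mul, mul_comm w], hw⟩
  · rintro w ⟨hw, hw'⟩
    rw [SetLike.mem_coe, Submodule.mem_colon_singleton, smul_eq_mul, mul_comm w] at hw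
    exact h w hw' hw
  · obtain ⟨k, rfl⟩ := Nat.exists_eq_add_of_le' hk
    rw [Nat.add_sub_cancel]
    refine le_inf (fun w hw => ?_) ?_
    · rw [Submodule.mem_colon_singleton, smul_eq_mul, pow_succ, ← mul_assoc]
      exact Ideal.mul_mem_mul hw (Ideal.subset_span ⟨p, rfl⟩)
    · rw [pow_succ']
      exact Ideal.mul_mono_left (initSpan_le_span a p)

theorem isWeakRelativeRegularSequence_iff {a : Fin r → A} :
    IsWeakRelativeRegularSequence a ↔
      ∀ p, RelInjective a (Ideal.span (Set.range a)) p 1 := by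
  refine forall_congr' fun p => ⟨fun h w hw hw' => ?_, fun h => le_antisymm ?_ (le_inf ?_ ?_)⟩
  · rw [pow_one] at hw hw'
    rw [Nat.sub_self, pow_zero, mul_one, ← h]
    exact ⟨by rwa [SetLike.mem_coe, Submodule.mem_colon_singleton, smul_eq_mul, mul_comm w], hw⟩
  · rintro w ⟨hw, hw'⟩
    rw [SetLike.mem_coe, Submodule.mem_colon_singleton, smul_eq_mul, mul_comm w] at hw
    simpa using h w (by simpa using hw') (by simpa using hw)
  · intro w hw
    rw [Submodule.mem_colon_singleton, smul_eq_mul]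
    exact Ideal.mul_mem_mul hw (Ideal.subset_span ⟨p, rfl⟩)
  · exact initSpan_le_span a p

/-- The ideals generated by initial segments of a `d`-sequence satisfy `𝔞 ∩ Iᵏ = 𝔞 Iᵏ⁻¹`. -/
theorem IsDSequence.inf_pow_le {a : Fin r → A} (ha : IsDSequence a) (k : ℕ) :
    ∀ d q, q + d = r → Ideal.span (a '' (firstVars r q : Finset (Fin r))) ⊓
        Ideal.span (Set.range a) ^ (k + 1) ≤
      Ideal.span (a '' (firstVars r q : Finset (Fin r))) * Ideal.span (Set.range a) ^ k := by
  induction k with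
  | zero => intro d q _; simp
  | succ k ihk =>
    intro d
    induction d with
    | zero =>
      intro q hq
      rw [add_zero] at hq
      rw [hq, firstVars_self, Finset.coe_univ, Set.image_univ, ← pow_succ']
      exact inf_le_right
    | succ d ihd =>
      intro q hq x hx
      obtain ⟨p, rfl⟩ : ∃ p : Fin r, p.val = q := ⟨⟨q, by omega⟩, rfl⟩
      have h1 := ihd (p.val + 1) (by omega) (x := x) ⟨by
        refine Ideal.span_mono (Set.image_mono ?_) hx.1
        rw [firstVars_succ, firstVars_val]
        exact Finset.coe_subset.2 (Finset.subset_insert _ _), hx.2⟩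
      have ihk := ihk (d + 1) p.val (by omega)
      rw [firstVars_val, ← initSpan_eq] at hx ihk ⊢
      rw [firstVars_succ, Finset.coe_insert, Set.image_insert_eq, Ideal.span_insert, sup_comm,
        ← initSpan_eq, Ideal.sup_mul] at h1
      obtain ⟨u, hu, y, hy, rfl⟩ := Submodule.mem_sup.1 h1
      obtain ⟨w, hw, rfl⟩ := Ideal.mem_span_singleton_mul.1 hy
      refine add_mem hu ?_
      -- Here `x = u + a p * w` with `a p * w ∈ 𝔞`. The `d`-condition puts `w` in `𝔞`, the outer
      -- induction in `𝔞 I ^ k`, and the factor `a p` supplies the missing power of `I`.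
      have hw1 : w ∈ initSpan a p := by
        rw [← ha p]
        refine ⟨?_, Ideal.pow_le_self (by omega) hw⟩
        rw [SetLike.mem_coe, Submodule.mem_colon_singleton, smul_eq_mul, mul_comm w]
        have := sub_mem hx.1 (Ideal.mul_le_left hu)
        rwa [add_sub_cancel_left] at this
      have hw2 := ihk ⟨hw1, hw⟩
      rw [pow_succ', mul_left_comm]
      exact Ideal.mul_mem_mul (Ideal.subset_span ⟨p, rfl⟩) hw2

theorem IsDSequence.isCSequence {a : Fin r → A} (ha : IsDSequence a) : IsCSequence a := by
  rw [isCSequence_iff_relInjective]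
  intro p k hk w hw hw'
  obtain ⟨k, rfl⟩ := Nat.exists_eq_add_of_le' hk
  have hw1 : w ∈ initSpan a p := by
    rw [← ha p]
    refine ⟨?_, Ideal.pow_le_self (by omega) hw⟩
    rw [SetLike.mem_coe, Submodule.mem_colon_singleton, smul_eq_mul, mul_comm w]
    exact Ideal.mul_le_left hw'
  have h := ha.inf_pow_le k (r - p.val) p.val (by omega)
  rw [firstVars_val, ← initSpan_eq] at h
  exact h ⟨hw1, hw⟩

theorem IsCSequence.isWeakRelativeRegularSequence {a : Fin r → A} (ha : IsCSequence a) :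
    IsWeakRelativeRegularSequence a :=
  isWeakRelativeRegularSequence_iff.2 fun p => isCSequence_iff_relInjective.1 ha p 1 le_rfl

end DSequences

/-! ### Proper sequences and annihilation of H_1 -/

section ProperSequences

variable {A : Type*} [CommRing A] {N : ℕ} {a : Fin N → A}

theorem mem_reesChains_top {S : Finset (Fin N)} {i : ℕ} {ω : Finset (Fin N) → A} :
    ω ∈ reesChains ⊤ ∅ S i 0 ↔ ∀ T, ω T ≠ 0 → T ⊆ S ∧ #T = i := by
  rw [mem_reesChains]
  simp

theorem reesChains_le_top (I : Ideal A) (Y S : Finset (Fin N)) (i j : ℕ) :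
    reesChains I Y S i j ≤ reesChains ⊤ ∅ S i 0 :=
  fun _ hω => mem_reesChains_top.2 fun T => (hω T).1

/-- This is the passage from ordinary Koszul homology to that over the Rees algebra: one factor from
`I` lifts a chain of homological degree `j` to `y`-degree `j + 1`, just above the diagonal. -/
theorem smul_mem_reesChains_of_top {I : Ideal A} {u : A} (hu : u ∈ I) (S : Finset (Fin N)) {j : ℕ}
    {ω : Finset (Fin N) → A} (hω : ω ∈ reesChains ⊤ ∅ S j 0) :
    u • ω ∈ reesChains I univ S j (j + 1) := by
  intro T
  refine ⟨fun h => (hω T).1 (right_ne_zero_of_mul h), ?_⟩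
  rw [Pi.smul_apply, smul_eq_mul, Finset.inter_univ]
  by_cases hT : ω T = 0
  · rw [hT, mul_zero]; exact zero_mem _
  · rw [((hω T).1 hT).2, Nat.add_sub_cancel_left, pow_one]
    exact Ideal.mul_mem_right _ _ hu

theorem univ_map_castLE (u : Fin N) :
    (univ.map (Fin.castLEOrderEmb u.isLt.le).toEmbedding) = Finset.Iio u := by
  ext k
  simp only [mem_map, mem_univ, true_and, mem_Iio]
  constructor
  · rintro ⟨l, rfl⟩
    exact l.isLt
  · intro h
    exact ⟨⟨k.val, h⟩, rfl⟩

theorem isProperSequence_iff : IsProperSequence a ↔ ∀ u, ∀ j ≥ 1,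
    ∀ ω ∈ reesChains ⊤ ∅ (Finset.Iio u) j 0, koszulD a ω = 0 →
      ∃ η ∈ reesChains ⊤ ∅ (Finset.Iio u) (j + 1) 0, koszulD a η = a u • ω := by
  refine forall₃_congr fun u j hj => ?_
  have hcomp : (fun l : Fin u => a (Fin.castLE u.isLt.le l)) =
    a ∘ Fin.castLEOrderEmb u.isLt.le := rfl
  have hY : ∀ k, k ∈ (∅ : Finset (Fin u)) ↔
    Fin.castLEOrderEmb u.isLt.le k ∈ (∅ : Finset (Fin N)) := by simp
  have ha : ∀ k ∈ (∅ : Finset (Fin N)), a k ∈ (⊤ : Ideal A) := by simp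
  rw [hcomp, ← univ_map_castLE]
  constructor
  · intro h ω hω hD
    have hp := reesChains_comp_map _ hY hω
    have hmem : (fun T => ω (T.map (Fin.castLEOrderEmb u.isLt.le).toEmbedding)) ∈
        koszulCycles (a ∘ Fin.castLEOrderEmb u.isLt.le) j := by
      refine mem_koszulCycles.2 ⟨fun T hT => reesChains_apply_eq_zero hp fun h => hT h.2, ?_⟩
      rw [koszulD_comp_map _ a fun T h => ((hω T).1 h).1, hD]
      rfl
    have h1 := h (Submodule.Quotient.mk ⟨_, hmem⟩)
    rw [← Submodule.Quotient.mk_smul, Submodule.Quotient.mk_eq_zero] at h1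
    obtain ⟨η, hη, e⟩ := h1
    obtain ⟨ζ, hζ, rfl⟩ := exists_reesChains_comp_map (I := ⊤) _ hY
      (mem_reesChains_top.2 fun T h =>
        ⟨subset_univ T, not_not.1 fun h' => h (hη T h')⟩ : η ∈ reesChains ⊤ ∅ univ (j + 1) 0)
    refine ⟨ζ, hζ, eq_of_comp_map_eq (Fin.castLEOrderEmb u.isLt.le)
      (fun T h => ((koszulD_mem_reesChains ha hζ T).1 h).1)
      (fun T h => ((hω T).1 (right_ne_zero_of_mul h)).1) ?_⟩
    rw [koszulD_comp_map _ a fun T h => ((hζ T).1 h).1] at e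
    exact congrFun e
  · intro h z
    obtain ⟨⟨ω, hω⟩, rfl⟩ := Submodule.Quotient.mk_surjective _ z
    obtain ⟨hω, hD⟩ := mem_koszulCycles.1 hω
    obtain ⟨ζ, hζ, rfl⟩ := exists_reesChains_comp_map (I := ⊤) _ hY
      (mem_reesChains_top.2 fun T h =>
        ⟨subset_univ T, not_not.1 fun h' => h (hω T h')⟩ : ω ∈ reesChains ⊤ ∅ univ j 0)
    obtain ⟨j, rfl⟩ := Nat.exists_eq_add_of_le' hj
    obtain ⟨η, hη, e⟩ := h ζ hζ (by
      rw [koszulD_comp_map _ a fun T h => ((hζ T).1 h).1] at hD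
      exact eq_of_comp_map_eq (Fin.castLEOrderEmb u.isLt.le)
        (fun T h => ((koszulD_mem_reesChains ha hζ T).1 h).1) (by simp) (congrFun hD))
    rw [← Submodule.Quotient.mk_smul, Submodule.Quotient.mk_eq_zero]
    refine ⟨fun T => η (T.map (Fin.castLEOrderEmb u.isLt.le).toEmbedding), fun T hT =>
      reesChains_apply_eq_zero (reesChains_comp_map _ hY hη) fun h => hT h.2, ?_⟩
    rw [koszulD_comp_map _ a fun T h => ((hη T).1 h).1, e]
    rfl

/-- The multiple of a cycle by `a u` is a cycle above the diagonal, where the homology of the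
initial segment is zero. -/
theorem IsCSequence.isProperSequence (ha : IsCSequence a) : IsProperSequence a := by
  rw [isCSequence_iff_relInjective] at ha
  rw [isProperSequence_iff]
  intro u j hj ω hω hD
  obtain ⟨j, rfl⟩ := Nat.exists_eq_add_of_le' hj
  have hI : ∀ k, a k ∈ Ideal.span (Set.range a) := fun k => Ideal.subset_span ⟨k, rfl⟩
  have h := koszulExact_of_relInjective hI le_rfl ha j (j + 1 + 1) le_rfl u.val u.isLt.le
  rw [firstVars_val] at h
  obtain ⟨η, hη, e⟩ := h _ (smul_mem_reesChains_of_top (hI u) _ hω)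
    (by rw [map_smul, hD, smul_zero])
  exact ⟨η, reesChains_le_top _ _ _ _ _ hη, e⟩

/-- Multiplication with each `a_q` kills the first Koszul homology of all the shorter initial
segments of the sequence. -/
def KillsKoszulOne (a : Fin N → A) : Prop :=
  ∀ p q : Fin N, p < q → ∀ ω ∈ reesChains ⊤ ∅ (firstVars N (p.val + 1)) 1 0, koszulD a ω = 0 →
    ∃ η ∈ reesChains ⊤ ∅ (firstVars N (p.val + 1)) 2 0, koszulD a η = a q • ω

theorem firstVars_mono {q q' : ℕ} (h : q ≤ q') : firstVars N q ⊆ firstVars N q' := by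
  intro t
  simp only [firstVars, mem_filter, mem_univ, true_and]
  omega

theorem IsWeakRelativeRegularSequence.killsKoszulOne (ha : IsWeakRelativeRegularSequence a) :
    KillsKoszulOne a := by
  rw [isWeakRelativeRegularSequence_iff] at ha
  intro p q _ ω hω hD
  have hI : ∀ k, a k ∈ Ideal.span (Set.range a) := fun k => Ideal.subset_span ⟨k, rfl⟩
  obtain ⟨η, hη, e⟩ := koszulExact_one_of_relInjective hI le_rfl ha (q := p.val + 1) p.isLt _
    (smul_mem_reesChains_of_top (hI q) _ hω) (by rw [map_smul, hD, smul_zero])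
  exact ⟨η, reesChains_le_top _ _ _ _ _ hη, e⟩

/-- Properness bounds `a q • ω` using all variables before `q`. To drop the last one, `t`, write the
bounding chain as `η₀ + e_t ∧ ρ`: then `ρ` is a cycle of degree one in the earlier variables, so `a
t • ρ` is again a boundary there. -/
theorem IsProperSequence.killsKoszulOne (ha : IsProperSequence a) : KillsKoszulOne a := by
  rw [isProperSequence_iff] at ha
  intro p q hpq ω hω hD
  have key : ∀ e, p.val + 1 + e ≤ q.val →
      (∃ η ∈ reesChains ⊤ ∅ (firstVars N (p.val + 1 + e)) 2 0, koszulD a η = a q • ω) →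
      ∃ η ∈ reesChains ⊤ ∅ (firstVars N (p.val + 1)) 2 0, koszulD a η = a q • ω := by
    intro e
    induction e with
    | zero => exact fun _ h => h
    | succ e ih =>
      rintro he ⟨η, hη, h⟩
      refine ih (by omega) ?_
      obtain ⟨t, ht⟩ : ∃ t : Fin N, t.val = p.val + 1 + e :=
        ⟨⟨p.val + 1 + e, lt_of_lt_of_le (by omega) q.isLt.le⟩, rfl⟩
      have hω' := reesChains_mono ⊤ ∅ (firstVars_mono (N := N) (by omega : p.val + 1 ≤ t.val)) 1
        le_rfl hω
      rw [← add_assoc, ← ht, firstVars_succ] at hη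
      rw [← ht, firstVars_val]
      rw [firstVars_val] at hω'
      obtain ⟨η₀, h0, ρ, h1, rfl⟩ := exists_reesChains_decomposition (by simp) hη
      obtain ⟨e0, e1⟩ := koszulD_components (by simp) (by simp) h0 h1
        (Submodule.smul_mem _ (a q) hω') (Or.inr rfl)
        (zero_mem (reesChains ⊤ ∅ (Finset.Iio t) 0 (0 - varDegree ∅ t))) (by simpa using h)
      obtain ⟨ζ, hζ, e2⟩ := ha t 1 le_rfl ρ (by simpa using h1) (by simpa using e1)
      exact ⟨η₀ + ζ, add_mem h0 hζ, by rw [map_add, e2, e0]⟩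
  refine key (q.val - (p.val + 1)) (by rw [Fin.lt_def] at hpq; omega) ?_
  rw [Fin.lt_def] at hpq
  rw [Nat.add_sub_cancel' hpq]
  have hω' := reesChains_mono ⊤ ∅ (firstVars_mono (N := N) (by omega : p.val + 1 ≤ q.val)) 1
    le_rfl hω
  rw [firstVars_val] at hω' ⊢
  exact ha q 1 le_rfl ω hω' hD

/-- `KillsKoszulOne` in terms of alternating matrices. -/
theorem KillsKoszulOne.exists_alternating (ha : KillsKoszulOne a) {p q : Fin N} (hpq : p < q)
    {c : Fin N → A} (hc : ∀ l, p < l → c l = 0) (hrel : ∑ l, c l * a l = 0) :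
    ∃ ε : Fin N → Fin N → A, (∀ l s, ε l s = -ε s l) ∧ (∀ l, ε l l = 0) ∧
      (∀ l s, p < s → ε l s = 0) ∧ ∀ l, a q * c l = ∑ s, ε l s * a s := by
  have h0 : ∀ v : A, (Pi.single ∅ v : Finset (Fin N) → A) ∈
      reesChains ⊤ ∅ (firstVars N (p.val + 1)) 0 0 := by
    intro v
    rw [mem_reesChains_top]
    intro T hT
    obtain rfl : T = ∅ := by
      by_contra h
      exact hT (Pi.single_eq_of_ne h _)
    simp
  have hωmem : (∑ l, koszulWedge l (Pi.single ∅ (c l))) ∈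
      reesChains ⊤ ∅ (firstVars N (p.val + 1)) 1 0 := by
    refine sum_mem fun l _ => ?_
    by_cases hl : p < l
    · rw [hc l hl, Pi.single_zero, map_zero]
      exact zero_mem _
    · have := koszulWedge_mem_reesChains l (h0 (c l))
      rw [Finset.insert_eq_of_mem] at this
      · simpa [varDegree] using this
      · simp only [firstVars, mem_filter, mem_univ, true_and]
        rw [Fin.lt_def] at hl
        omega
  have happly : ∀ l, (∑ k, koszulWedge k (Pi.single ∅ (c k))) {l} = c l := by
    intro l
    rw [Finset.sum_apply, Finset.sum_eq_single l]
    · rw [koszulWedge_apply, if_pos (by simp)]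
      simp [Finset.filter_singleton]
    · intro k _ hk
      rw [koszulWedge_apply, if_neg (by simpa using hk)]
    · simp
  obtain ⟨η, hη, e⟩ := ha p q hpq _ hωmem (by
    rw [map_sum]
    simp only [koszulD_wedge, koszulD_eq_zero_of_degree_zero (h0 _), map_zero, sub_zero,
      ← Pi.single_smul, smul_eq_mul]
    funext T
    by_cases hT : T = ∅
    · subst hT
      simpa [mul_comm] using hrel
    · simp [hT, Finset.sum_apply])
  -- The alternating matrix consists of the coefficients of the bounding 2-chain `η`, with the signs
  -- prescribed by the Koszul differential.
  refine ⟨fun l s => if s = l then 0 else if l < s then -η (insert s {l}) else η (insert s {l}),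
    fun l s => ?_, fun l => by simp, fun l s hs => ?_, fun l => ?_⟩
  · by_cases h : s = l
    · simp [h]
    · beta_reduce
      rw [if_neg h, if_neg (Ne.symm h), Finset.pair_comm s l]
      rcases lt_or_gt_of_ne h with h | h
      · rw [if_neg (not_lt.2 h.le), if_pos h, neg_neg]
      · rw [if_pos h, if_neg (not_lt.2 h.le)]
  · have : η (insert s {l}) = 0 := reesChains_apply_eq_zero hη fun h => by
      have := h.1 (Finset.mem_insert_self s {l})
      simp only [firstVars, mem_filter, mem_univ, true_and] at this
      rw [Fin.lt_def] at hs
      omega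
    simp [this]
  · have h1 := congrFun e {l}
    rw [Pi.smul_apply, happly, smul_eq_mul] at h1
    rw [← h1, koszulD_apply]
    refine Finset.sum_subset_zero_on_sdiff (subset_univ _) (fun s hs => ?_) (fun s hs => ?_)
    · obtain rfl : s = l := by simpa using hs
      simp
    · have hs : s ≠ l := by simpa using hs
      beta_reduce
      rw [if_neg hs, Finset.filter_singleton]
      split_ifs with h <;> simp [mul_comm]

end ProperSequences

/-! ### The defining ideal of the symmetric algebra -/

section SymRelations

open MvPolynomial

variable {A : Type*} [CommRing A] {r : ℕ}

/-- The linear form `∑ c_l y_l`. -/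
noncomputable def linForm : (Fin r → A) →ₗ[A] MvPolynomial (Fin r) A :=
  Fintype.linearCombination A X

theorem linForm_apply (c : Fin r → A) : linForm c = ∑ l, c l • X l :=
  Fintype.linearCombination_apply A X c

theorem isHomogeneous_linForm (c : Fin r → A) : (linForm c).IsHomogeneous 1 := by
  rw [linForm_apply]
  refine IsHomogeneous.sum _ _ _ fun l _ => ?_
  rw [smul_eq_C_mul]
  exact isHomogeneous_C_mul_X _ _

theorem eval_linForm (a c : Fin r → A) : eval a (linForm c) = ∑ l, c l * a l := by
  simp [linForm_apply, smul_eval]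

theorem coeff_linForm (c : Fin r → A) (l : Fin r) : coeff (Finsupp.single l 1) (linForm c) = c l := by
  classical
  simp [linForm_apply, coeff_sum, coeff_X, Finsupp.single_left_inj]

variable {a : Fin r → A}

theorem linForm_mem_symRelations {c : Fin r → A} (h : ∑ l, c l * a l = 0) :
    linForm c ∈ symRelations a := by
  rw [symRelations, RingHom.mem_ker, linForm_apply, map_sum]
  simp only [map_smul, aeval_X]
  simp only [← map_smul, ← map_sum]
  convert map_zero (SymmetricAlgebra.ι A (Ideal.span (Set.range a)))
  ext
  simpa using h

/-- The map `Aʳ → I` given by generators `a₁, …, aᵣ` of `I`. -/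
noncomputable def toSpanRange (a : Fin r → A) : (Fin r → A) →ₗ[A] Ideal.span (Set.range a) :=
  Fintype.linearCombination A fun l => ⟨a l, Ideal.subset_span ⟨l, rfl⟩⟩

theorem coe_toSpanRange (a c : Fin r → A) : (toSpanRange a c : A) = ∑ l, c l * a l := by
  simp [toSpanRange, Fintype.linearCombination_apply]

theorem toSpanRange_surjective (a : Fin r → A) : Function.Surjective (toSpanRange a) := by
  rintro ⟨w, hw⟩
  obtain ⟨c, hc⟩ := Ideal.mem_span_range_iff_exists_fun.1 hw
  exact ⟨c, Subtype.ext (by rw [coe_toSpanRange, hc])⟩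

/-- The linear map from `I` to the quotient of the polynomial ring by the linear relations is well
defined; its extension to the symmetric algebra, composed with the presentation, is the quotient
map, so the kernel is no larger. -/
theorem symRelations_eq_span (a : Fin r → A) : symRelations a =
    Ideal.span {g | ∃ c : Fin r → A, ∑ l, c l * a l = 0 ∧ g = linForm c} := by
  refine le_antisymm ?_ (Ideal.span_le.2 ?_)
  · set J := Ideal.span {g | ∃ c : Fin r → A, ∑ l, c l * a l = 0 ∧ g = linForm c} with hJ
    let ψ : (Fin r → A) →ₗ[A] MvPolynomial (Fin r) A ⧸ J :=
      (Ideal.Quotient.mkₐ A J).toLinearMap ∘ₗ linForm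
    have hψ : LinearMap.ker (toSpanRange a) ≤ LinearMap.ker ψ := by
      intro c hc
      rw [LinearMap.mem_ker] at hc ⊢
      refine Ideal.Quotient.eq_zero_iff_mem.2 (Ideal.subset_span ⟨c, ?_, rfl⟩)
      rw [← coe_toSpanRange, hc, Submodule.coe_zero]
    let g : Ideal.span (Set.range a) →ₗ[A] MvPolynomial (Fin r) A ⧸ J :=
      (LinearMap.ker (toSpanRange a)).liftQ ψ hψ ∘ₗ
        ((toSpanRange a).quotKerEquivOfSurjective (toSpanRange_surjective a)).symm.toLinearMap
    have hg : ∀ c, g (toSpanRange a c) = ψ c := by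
      intro c
      have : ((toSpanRange a).quotKerEquivOfSurjective (toSpanRange_surjective a)).symm
          (toSpanRange a c) = Submodule.Quotient.mk c := by
        rw [LinearEquiv.symm_apply_eq]; rfl
      simp [g, this]
    have hcomp : (SymmetricAlgebra.lift g).comp (aeval (R := A) fun i =>
        SymmetricAlgebra.ι A (Ideal.span (Set.range a)) ⟨a i, Ideal.subset_span ⟨i, rfl⟩⟩) =
        Ideal.Quotient.mkₐ A J := by
      refine MvPolynomial.algHom_ext fun l => ?_
      have e : (⟨a l, Ideal.subset_span ⟨l, rfl⟩⟩ : Ideal.span (Set.range a)) =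
          toSpanRange a (Pi.single l 1) := by
        ext
        simp [coe_toSpanRange, Pi.single_apply]
      rw [AlgHom.comp_apply, aeval_X, SymmetricAlgebra.lift_ι_apply, e, hg]
      simp [ψ, linForm, Fintype.linearCombination_apply_single]
    intro F hF
    rw [symRelations, RingHom.mem_ker] at hF
    rw [← Ideal.Quotient.eq_zero_iff_mem, ← Ideal.Quotient.mkₐ_eq_mk A, ← hcomp, AlgHom.comp_apply]
    exact (congrArg _ hF).trans (map_zero _)
  · rintro _ ⟨c, hc, rfl⟩
    exact linForm_mem_symRelations hc

theorem mem_symRelations_iff_mem_span {F : MvPolynomial (Fin r) A} : F ∈ symRelations a ↔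
    F ∈ Submodule.span A {P | ∃ (β : Fin r →₀ ℕ) (c : Fin r → A),
      ∑ l, c l * a l = 0 ∧ P = monomial β 1 * linForm c} := by
  constructor
  · intro hF
    rw [symRelations_eq_span] at hF
    refine Submodule.span_induction ?_ (zero_mem _) (fun _ _ _ _ => add_mem) ?_ hF
    · rintro _ ⟨c, hc, rfl⟩
      refine Submodule.subset_span ⟨0, c, hc, ?_⟩
      rw [monomial_zero', C_1, one_mul]
    · intro p q _ hq
      rw [smul_eq_mul]
      refine Submodule.span_induction (p := fun q _ => p * q ∈ Submodule.span A _) ?_ ?_ ?_ ?_ hq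
      · rintro _ ⟨β, c, hc, rfl⟩
        rw [p.as_sum, Finset.sum_mul]
        refine sum_mem fun γ _ => ?_
        have : monomial γ (coeff γ p) * (monomial β 1 * linForm c) =
            coeff γ p • (monomial (γ + β) 1 * linForm c) := by
          rw [← mul_assoc, monomial_mul, mul_one, ← smul_mul_assoc, smul_monomial, smul_eq_mul,
            mul_one]
        rw [this]
        exact Submodule.smul_mem _ _ (Submodule.subset_span ⟨_, c, hc, rfl⟩)
      · rw [mul_zero]; exact zero_mem _
      · intro x y _ _ hx hy
        rw [mul_add]; exact add_mem hx hy
      · intro u x _ hx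
        rw [mul_smul_comm]; exact Submodule.smul_mem _ _ hx
  · intro hF
    refine Submodule.span_induction ?_ (zero_mem _) (fun _ _ _ _ => add_mem) ?_ hF
    · rintro _ ⟨β, c, hc, rfl⟩
      exact Ideal.mul_mem_left _ _ (linForm_mem_symRelations hc)
    · intro u x _ hx
      rw [smul_eq_C_mul]
      exact Ideal.mul_mem_left _ _ hx

theorem homogeneousComponent_mem_span {F : MvPolynomial (Fin r) A} (hF : F ∈ symRelations a)
    (k : ℕ) : homogeneousComponent k F ∈ Submodule.span A {P | ∃ (β : Fin r →₀ ℕ) (c : Fin r → A),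
      β.degree + 1 = k ∧ ∑ l, c l * a l = 0 ∧ P = monomial β 1 * linForm c} := by
  rw [mem_symRelations_iff_mem_span] at hF
  refine Submodule.span_induction ?_ (by simp) ?_ ?_ hF
  · rintro _ ⟨β, c, hc, rfl⟩
    rw [homogeneousComponent_of_mem (n := β.degree + 1)
      ((isHomogeneous_monomial _ rfl).mul (isHomogeneous_linForm c))]
    split_ifs with h
    · exact Submodule.subset_span ⟨β, c, h.symm, hc, rfl⟩
    · exact zero_mem _
  · intro x y _ _ hx hy
    rw [map_add]; exact add_mem hx hy
  · intro u x _ hx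
    rw [map_smul]; exact Submodule.smul_mem _ _ hx

theorem homogeneousComponent_mem_symRelations {F : MvPolynomial (Fin r) A}
    (hF : F ∈ symRelations a) (k : ℕ) : homogeneousComponent k F ∈ symRelations a := by
  rw [mem_symRelations_iff_mem_span]
  refine Submodule.span_mono ?_ (homogeneousComponent_mem_span hF k)
  rintro _ ⟨β, c, _, hc, rfl⟩
  exact ⟨β, c, hc, rfl⟩

theorem eval_eq_zero_of_mem_symRelations {F : MvPolynomial (Fin r) A} (hF : F ∈ symRelations a) :
    eval a F = 0 := by
  have : symRelations a ≤ RingHom.ker (eval a) := by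
    rw [symRelations_eq_span, Ideal.span_le]
    rintro _ ⟨c, hc, rfl⟩
    exact (eval_linForm a c).trans hc
  exact this hF

theorem aeval_monomial_one_coeff (a : Fin r → A) (F : MvPolynomial (Fin r) A) (k : ℕ) :
    (aeval (fun l => Polynomial.monomial 1 (a l)) F).coeff k =
      eval a (homogeneousComponent k F) := by
  induction F using MvPolynomial.induction_on' with
  | monomial β c =>
    have h : aeval (fun l => Polynomial.monomial 1 (a l)) (monomial β c) =
        Polynomial.monomial β.degree (eval a (monomial β c)) := by
      rw [aeval_monomial, eval_monomial, Finsupp.prod, Finsupp.prod, Finsupp.degree_apply]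
      simp only [← Polynomial.C_mul_X_pow_eq_monomial, pow_one, mul_pow, Finset.prod_mul_distrib,
        Finset.prod_pow_eq_pow_sum, map_mul, map_prod, map_pow, Polynomial.algebraMap_eq, mul_assoc]
    rw [h, homogeneousComponent_of_mem (isHomogeneous_monomial c rfl), Polynomial.coeff_monomial]
    by_cases h : k = β.degree
    · rw [if_pos h, if_pos h.symm]
    · rw [if_neg h, if_neg (Ne.symm h), map_zero]
  | add p q hp hq => simp only [map_add, Polynomial.coeff_add, hp, hq]

theorem coe_lift_reesι_aeval (a : Fin r → A) (F : MvPolynomial (Fin r) A) :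
    (SymmetricAlgebra.lift (reesι (Ideal.span (Set.range a))) (aeval (R := A) (fun i =>
        SymmetricAlgebra.ι A (Ideal.span (Set.range a)) ⟨a i, Ideal.subset_span ⟨i, rfl⟩⟩) F) :
      Polynomial A) = aeval (fun l => Polynomial.monomial 1 (a l)) F := by
  have : (reesAlgebra (Ideal.span (Set.range a))).val.comp
      ((SymmetricAlgebra.lift (reesι (Ideal.span (Set.range a)))).comp (aeval (R := A) (fun i =>
        SymmetricAlgebra.ι A (Ideal.span (Set.range a)) ⟨a i, Ideal.subset_span ⟨i, rfl⟩⟩))) =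
      aeval (fun l => Polynomial.monomial 1 (a l)) := by
    refine MvPolynomial.algHom_ext fun l => ?_
    simp [reesι]
  exact DFunLike.congr_fun this F

theorem aeval_ι_surjective (a : Fin r → A) : Function.Surjective (aeval (R := A) (fun i =>
    SymmetricAlgebra.ι A (Ideal.span (Set.range a)) ⟨a i, Ideal.subset_span ⟨i, rfl⟩⟩)) := by
  intro s
  induction s using SymmetricAlgebra.induction with
  | algebraMap u => exact ⟨C u, by simp⟩
  | ι w =>
    obtain ⟨c, rfl⟩ := toSpanRange_surjective a w
    refine ⟨linForm c, ?_⟩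
    rw [linForm_apply, toSpanRange, Fintype.linearCombination_apply, map_sum, map_sum]
    simp only [map_smul, aeval_X]
  | mul x y hx hy =>
    obtain ⟨p, rfl⟩ := hx
    obtain ⟨q, rfl⟩ := hy
    exact ⟨p * q, map_mul _ _ _⟩
  | add x y hx hy =>
    obtain ⟨p, rfl⟩ := hx
    obtain ⟨q, rfl⟩ := hy
    exact ⟨p + q, map_add _ _ _⟩

/-- The presentation followed by the map to the Rees algebra sends `y_l` to `a_l t`, so its
coefficient of degree `k` is the value at `a` of the component of degree `k`. Surjectivity onto the
Rees algebra is automatic. -/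
theorem isLinearType_iff (a : Fin r → A) : IsLinearType (Ideal.span (Set.range a)) ↔
    ∀ (k : ℕ) (F : MvPolynomial (Fin r) A), F.IsHomogeneous k → eval a F = 0 →
      F ∈ symRelations a := by
  constructor
  · intro h k F hF hF0
    rw [symRelations, RingHom.mem_ker]
    refine h.1 ?_
    rw [map_zero]
    refine Subtype.ext (Polynomial.ext fun j => ?_)
    have := aeval_monomial_one_coeff a F j
    rw [← coe_lift_reesι_aeval] at this
    refine this.trans ?_
    rw [homogeneousComponent_of_mem hF]
    split_ifs
    · simpa using hF0
    · simp
  · intro h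
    refine ⟨(injective_iff_map_eq_zero _).2 fun s hs => ?_, fun p => ?_⟩
    · obtain ⟨F, rfl⟩ := aeval_ι_surjective a s
      have hF : F ∈ symRelations a := by
        rw [← sum_homogeneousComponent F]
        refine sum_mem fun k _ => h k _ (homogeneousComponent_isHomogeneous k F) ?_
        rw [← aeval_monomial_one_coeff, ← coe_lift_reesι_aeval, hs]
        simp
      exact hF
    · have hp := fun k => Ideal.mem_span_pow_iff_exists_isHomogeneous a _ |>.1
        ((mem_reesAlgebra_iff _ _).1 p.2 k)
      choose F hF hFp using hp
      refine ⟨aeval (R := A) (fun i => SymmetricAlgebra.ι A (Ideal.span (Set.range a))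
        ⟨a i, Ideal.subset_span ⟨i, rfl⟩⟩) (∑ k ∈ (p : Polynomial A).support, F k),
        Subtype.ext (Polynomial.ext fun j => ?_)⟩
      rw [coe_lift_reesι_aeval, aeval_monomial_one_coeff, map_sum, map_sum]
      have : ∀ k, eval a (homogeneousComponent j (F k)) =
          if k = j then (p : Polynomial A).coeff j else 0 := by
        intro k
        rw [homogeneousComponent_of_mem (hF k)]
        rcases eq_or_ne k j with e | e
        · rw [if_pos e.symm, if_pos e, ← e, hFp]
        · rw [if_neg e.symm, if_neg e, map_zero]
      simp only [this, Finset.sum_ite_eq']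
      split_ifs with e
      · rfl
      · exact (Polynomial.notMem_support_iff.1 e).symm

end SymRelations

/-! ### Forms in initial sets of variables and linear type -/

section VarForms

open MvPolynomial

variable {A : Type*} [CommRing A] {r : ℕ}

/-- The forms of degree `k + 1` in the ideal generated by the variables `y_l`, `l ∈ T`. -/
def varForms (A : Type*) [CommRing A] {r : ℕ} (T : Set (Fin r)) (k : ℕ) :
    Submodule A (MvPolynomial (Fin r) A) where
  carrier := {P | ∃ G : Fin r → MvPolynomial (Fin r) A, (∀ l, (G l).IsHomogeneous k) ∧
    (∀ l, l ∉ T → G l = 0) ∧ P = ∑ l, X l * G l}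
  add_mem' := by
    rintro _ _ ⟨G, hG, hT, rfl⟩ ⟨H, hH, hT', rfl⟩
    refine ⟨G + H, fun l => (hG l).add (hH l), fun l hl => ?_, ?_⟩
    · simp [hT l hl, hT' l hl]
    · simp [mul_add, Finset.sum_add_distrib]
  zero_mem' := ⟨0, fun _ => isHomogeneous_zero _ _ _, fun _ _ => rfl, by simp⟩
  smul_mem' := by
    rintro c _ ⟨G, hG, hT, rfl⟩
    refine ⟨c • G, fun l => ?_, fun l hl => ?_, ?_⟩
    · rw [Pi.smul_apply, smul_eq_C_mul]
      exact (hG l).C_mul c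
    · simp [hT l hl]
    · simp [Finset.smul_sum]

theorem varForms_mono {T T' : Set (Fin r)} (h : T ⊆ T') (k : ℕ) :
    varForms A T k ≤ varForms A T' k := by
  rintro _ ⟨G, hG, hT, rfl⟩
  exact ⟨G, hG, fun l hl => hT l fun hl' => hl (h hl'), rfl⟩

theorem isHomogeneous_of_mem_varForms {T : Set (Fin r)} {k : ℕ} {P : MvPolynomial (Fin r) A}
    (hP : P ∈ varForms A T k) : P.IsHomogeneous (k + 1) := by
  obtain ⟨G, hG, _, rfl⟩ := hP
  refine IsHomogeneous.sum _ _ _ fun l _ => ?_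
  rw [add_comm k 1]
  exact (isHomogeneous_X A l).mul (hG l)

theorem X_mul_mem_varForms {T : Set (Fin r)} {k : ℕ} {l : Fin r} (hl : l ∈ T)
    {G : MvPolynomial (Fin r) A} (hG : G.IsHomogeneous k) : X l * G ∈ varForms A T k := by
  classical
  refine ⟨Pi.single l G, fun s => ?_, fun s hs => ?_, ?_⟩
  · rcases eq_or_ne s l with rfl | h
    · rwa [Pi.single_eq_same]
    · rw [Pi.single_eq_of_ne h]; exact isHomogeneous_zero _ _ _
  · exact Pi.single_eq_of_ne (by rintro rfl; exact hs hl) _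
  · rw [Finset.sum_eq_single l (fun s _ h => by rw [Pi.single_eq_of_ne h, mul_zero]) (by simp),
      Pi.single_eq_same]

theorem monomial_eq_X_mul {β : Fin r →₀ ℕ} {l : Fin r} (hl : β l ≠ 0) (c : A) :
    monomial β c = X l * monomial (β - Finsupp.single l 1) c := by
  rw [X, monomial_mul, one_mul, add_tsub_cancel_of_le]
  exact Finsupp.single_le_iff.2 (Nat.one_le_iff_ne_zero.2 hl)

theorem degree_tsub_single {β : Fin r →₀ ℕ} {l : Fin r} (hl : β l ≠ 0) :
    (β - Finsupp.single l 1).degree + 1 = β.degree := by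
  have : β - Finsupp.single l 1 + Finsupp.single l 1 = β :=
    tsub_add_cancel_of_le (Finsupp.single_le_iff.2 (Nat.one_le_iff_ne_zero.2 hl))
  conv_rhs => rw [← this]
  simp

theorem mem_varForms_of_support {T : Set (Fin r)} {k : ℕ} {P : MvPolynomial (Fin r) A}
    (hP : P.IsHomogeneous (k + 1)) (h : ∀ β ∈ P.support, ∃ l ∈ T, β l ≠ 0) :
    P ∈ varForms A T k := by
  rw [P.as_sum]
  refine sum_mem fun β hβ => ?_
  obtain ⟨l, hl, hl0⟩ := h β hβ
  rw [monomial_eq_X_mul hl0]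
  refine X_mul_mem_varForms hl (isHomogeneous_monomial _ ?_)
  have := degree_tsub_single hl0
  have hd := hP.degree_eq_sum_deg_support hβ
  rw [← Finsupp.degree_apply] at hd
  omega

theorem exists_ne_zero_of_isHomogeneous {k : ℕ} {P : MvPolynomial (Fin r) A}
    (hP : P.IsHomogeneous (k + 1)) {β : Fin r →₀ ℕ} (hβ : β ∈ P.support) : ∃ l, β l ≠ 0 := by
  have hd := hP.degree_eq_sum_deg_support hβ
  rw [← Finsupp.degree_apply] at hd
  refine (Finsupp.ne_iff (g := 0)).1 ?_
  rintro rfl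
  simp at hd

theorem exists_ne_zero_of_mem_varForms {T : Set (Fin r)} {k : ℕ} {P : MvPolynomial (Fin r) A}
    (hP : P ∈ varForms A T k) {β : Fin r →₀ ℕ} (hβ : coeff β P ≠ 0) : ∃ l ∈ T, β l ≠ 0 := by
  classical
  obtain ⟨G, _, hT, rfl⟩ := hP
  rw [coeff_sum] at hβ
  obtain ⟨l, _, hl⟩ := Finset.exists_ne_zero_of_sum_ne_zero hβ
  refine ⟨l, by_contra fun h => hl (by rw [hT l h, mul_zero, coeff_zero]), fun h => hl ?_⟩
  rw [coeff_X_mul', if_neg (by simpa using h)]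

theorem eval_mem_of_mem_varForms (a : Fin r → A) {T : Set (Fin r)} {k : ℕ}
    {P : MvPolynomial (Fin r) A} (hP : P ∈ varForms A T k) :
    eval a P ∈ Ideal.span (a '' T) * Ideal.span (Set.range a) ^ k := by
  obtain ⟨G, hG, hT, rfl⟩ := hP
  rw [map_sum]
  refine sum_mem fun l _ => ?_
  rw [map_mul, eval_X]
  by_cases hl : l ∈ T
  · exact Ideal.mul_mem_mul (Ideal.subset_span ⟨l, hl, rfl⟩)
      ((Ideal.mem_span_pow_iff_exists_isHomogeneous a _).2 ⟨G l, hG l, rfl⟩)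
  · rw [hT l hl, map_zero, mul_zero]; exact zero_mem _

theorem exists_mem_varForms_eval (a : Fin r → A) {T : Set (Fin r)} {k : ℕ} {w : A}
    (hw : w ∈ Ideal.span (a '' T) * Ideal.span (Set.range a) ^ k) :
    ∃ P ∈ varForms A T k, eval a P = w := by
  let N : Submodule A A := (varForms A T k).map (aeval a).toLinearMap
  suffices h : Ideal.span (a '' T) * Ideal.span (Set.range a) ^ k ≤ N by
    obtain ⟨P, hP, rfl⟩ := h hw
    exact ⟨P, hP, by simp [aeval_eq_eval]⟩
  refine Ideal.mul_le.2 fun u hu v hv => ?_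
  obtain ⟨G, hG, rfl⟩ := (Ideal.mem_span_pow_iff_exists_isHomogeneous a _).1 hv
  refine Submodule.span_induction (p := fun u _ => u * eval a G ∈ N) ?_ ?_ ?_ ?_ hu
  · rintro _ ⟨l, hl, rfl⟩
    exact ⟨X l * G, X_mul_mem_varForms hl hG, by simp [aeval_eq_eval]⟩
  · rw [zero_mul]; exact zero_mem _
  · intro x y _ _ hx hy
    rw [add_mul]; exact add_mem hx hy
  · intro c x _ hx
    rw [smul_eq_mul, mul_assoc]
    exact Submodule.smul_mem _ c hx

theorem exists_eq_X_mul_add {k q : ℕ} (hq : q < r) {P : MvPolynomial (Fin r) A}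
    (hP : P ∈ varForms A {l : Fin r | l.val < q + 1} k) :
    ∃ G : MvPolynomial (Fin r) A, G.IsHomogeneous k ∧
      P - X ⟨q, hq⟩ * G ∈ varForms A (Set.Iio ⟨q, hq⟩) k := by
  classical
  obtain ⟨G, hG, hT, rfl⟩ := hP
  refine ⟨G ⟨q, hq⟩, hG _, ?_⟩
  rw [← Finset.add_sum_erase _ _ (Finset.mem_univ (⟨q, hq⟩ : Fin r)), add_sub_cancel_left]
  refine sum_mem fun l hl => ?_
  by_cases h : l.val < q
  · exact X_mul_mem_varForms (Fin.lt_def.2 h) (hG l)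
  · have hne := (Finset.mem_erase.1 hl).1
    rw [hT l (fun h' => hne (Fin.ext (by
      have : l.val < q + 1 := h'
      simp only; omega))), mul_zero]
    exact zero_mem _

variable {a : Fin r → A}

/-- Induction on the degree and on the number of variables. In `P = P' + y_q G`, relative
injectivity replaces the value `G(a)` by `Q(a)` with `Q` in the earlier variables. Then `G - Q` has
smaller degree, and `P' + y_q Q` no longer needs `y_q` as a generator. -/
theorem mem_symRelations_of_relInjective
    (h : ∀ p, ∀ k ≥ 1, RelInjective a (Ideal.span (Set.range a)) p k) (k : ℕ) :
    ∀ (q : ℕ) (P : MvPolynomial (Fin r) A), P ∈ varForms A {l : Fin r | l.val < q} k →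
      eval a P = 0 → P ∈ symRelations a := by
  induction k with
  | zero =>
    rintro q _ ⟨G, hG, _, rfl⟩ hP0
    have hG' : ∀ l, G l = C (coeff 0 (G l)) := fun l =>
      totalDegree_eq_zero_iff_eq_C.1 ((totalDegree_zero_iff_isHomogeneous _).2 (hG l))
    have e : ∑ l, X l * G l = linForm fun l => coeff 0 (G l) := by
      rw [linForm_apply]
      exact Finset.sum_congr rfl fun l _ => by rw [smul_eq_C_mul, ← hG' l, mul_comm]
    rw [e] at hP0 ⊢
    exact linForm_mem_symRelations (by rw [← eval_linForm, hP0])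
  | succ k ihk =>
    intro q
    induction q with
    | zero =>
      rintro _ ⟨G, hG, hT, rfl⟩ _
      rw [Finset.sum_eq_zero fun l _ => by rw [hT l (Nat.not_lt_zero _), mul_zero]]
      exact zero_mem _
    | succ q ihq =>
      intro P hP hP0
      by_cases hq : q < r
      · obtain ⟨G, hG, hP'⟩ := exists_eq_X_mul_add hq hP
        have hGa : eval a G ∈ initSpan a ⟨q, hq⟩ * Ideal.span (Set.range a) ^ (k + 1 - 1) := by
          refine h ⟨q, hq⟩ (k + 1) (by omega) _
            ((Ideal.mem_span_pow_iff_exists_isHomogeneous a _).2 ⟨G, hG, rfl⟩) ?_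
          have := eval_mem_of_mem_varForms a hP'
          rw [map_sub, hP0, zero_sub, map_mul, eval_X, neg_mem_iff] at this
          exact this
        obtain ⟨Q, hQ, hQa⟩ := exists_mem_varForms_eval a hGa
        rw [Nat.add_sub_cancel] at hQ
        have hGQ : G - Q ∈ symRelations a := by
          refine ihk r _ (mem_varForms_of_support (hG.sub (isHomogeneous_of_mem_varForms hQ))
            fun β hβ => ?_) (by rw [map_sub, hQa, sub_self])
          obtain ⟨l, hl⟩ := exists_ne_zero_of_isHomogeneous
            (hG.sub (isHomogeneous_of_mem_varForms hQ)) hβ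
          exact ⟨l, l.isLt, hl⟩
        have hrest : (P - X ⟨q, hq⟩ * G) + X ⟨q, hq⟩ * Q ∈ symRelations a := by
          refine ihq _ (add_mem hP' ?_) ?_
          · refine mem_varForms_of_support ?_ fun β hβ => ?_
            · rw [add_comm (k + 1) 1]
              exact (isHomogeneous_X A _).mul (isHomogeneous_of_mem_varForms hQ)
            · classical
              rw [mem_support_iff, coeff_X_mul'] at hβ
              split_ifs at hβ with h0
              · obtain ⟨l, hl, hl0⟩ := exists_ne_zero_of_mem_varForms hQ hβ
                refine ⟨l, hl, fun h => hl0 ?_⟩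
                rw [Finsupp.tsub_apply, h, zero_tsub]
              · exact absurd rfl hβ
          · simp [hP0, hQa]
        have := add_mem hrest (Ideal.mul_mem_left (symRelations a) (X ⟨q, hq⟩) hGQ)
        convert this using 1
        ring
      · exact ihq P (varForms_mono (fun l _ => lt_of_lt_of_le l.isLt (not_lt.1 hq)) _ hP) hP0

theorem IsCSequence.isLinearType (ha : IsCSequence a) :
    IsLinearType (Ideal.span (Set.range a)) := by
  rw [isCSequence_iff_relInjective] at ha
  rw [isLinearType_iff]
  rintro (_ | k) F hF hF0
  · rw [totalDegree_eq_zero_iff_eq_C.1 ((totalDegree_zero_iff_isHomogeneous _).2 hF)] at hF0 ⊢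
    rw [eval_C] at hF0
    rw [hF0, C_0]
    exact zero_mem _
  · refine mem_symRelations_of_relInjective ha k r F
      (mem_varForms_of_support hF fun β hβ => ?_) hF0
    obtain ⟨l, hl⟩ := exists_ne_zero_of_isHomogeneous hF hβ
    exact ⟨l, l.isLt, hl⟩

end VarForms

/-! ### Leading monomials and the strong `s`-property -/

section LeadingMonomials

open MvPolynomial

variable {A : Type*} [CommRing A] {r : ℕ} {a : Fin r → A}

/-- In a fixed degree the reverse lexicographic order is the opposite of `toLex`, so leading
monomials are the `toLex`-minimal ones. -/
theorem revLexLT_iff {α β : Fin r →₀ ℕ} (h : β.degree = α.degree) :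
    RevLexLT β α ↔ toLex α < toLex β := by
  rw [Finsupp.Lex.lt_iff]
  constructor
  · rintro (h' | ⟨_, i, hi, hlt⟩)
    · exact absurd h h'.ne
    · exact ⟨i, fun j hj => (hi j hj).symm, hlt⟩
  · rintro ⟨i, hi, hlt⟩
    exact Or.inr ⟨h, i, fun j hj => (hi j hj).symm, hlt⟩

theorem toLex_lt_of_exists {α β : Fin r →₀ ℕ} {i : Fin r} (hα : ∀ l < i, α l = 0)
    (hβ : ∃ l < i, β l ≠ 0) : toLex α < toLex β := by
  obtain ⟨l, hl, hl0⟩ := hβ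
  have hne : β.support.Nonempty := ⟨l, by simpa using hl0⟩
  have hmin := β.support.min'_mem hne
  have hle : β.support.min' hne ≤ l := Finset.min'_le _ _ (by simpa using hl0)
  rw [Finsupp.Lex.lt_iff]
  refine ⟨β.support.min' hne, fun j hj => ?_, ?_⟩
  · have : β j = 0 := by
      by_contra h
      exact absurd (Finset.min'_le _ j (by simpa using h)) (not_le.2 hj)
    exact (hα j (hj.trans_le hle |>.trans hl)).trans this.symm
  · refine lt_of_eq_of_lt (hα _ (hle.trans_lt hl)) (Nat.pos_of_ne_zero ?_)
    simpa using hmin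

theorem le_of_toLex_le {α β : Fin r →₀ ℕ} {i : Fin r} (h : toLex α ≤ toLex β)
    (hα : ∀ l < i, α l = 0) (hβ : ∀ l < i, β l = 0) : α i ≤ β i := by
  by_contra hlt
  refine absurd h (not_le.2 (Finsupp.Lex.lt_iff.2 ⟨i, fun j hj => ?_, not_le.1 hlt⟩))
  exact (hβ j hj).trans (hα j hj).symm

theorem toLex_add_single_lt (γ : Fin r →₀ ℕ) {l q : Fin r} (h : l < q) :
    toLex (γ + Finsupp.single q 1) < toLex (γ + Finsupp.single l 1) :=
  add_lt_add_right (Finsupp.Lex.single_lt_iff.2 h) (toLex γ)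

theorem coeff_linForm_ne_zero {c : Fin r → A} {δ : Fin r →₀ ℕ} (h : coeff δ (linForm c) ≠ 0) :
    ∃ l, c l ≠ 0 ∧ δ = Finsupp.single l 1 := by
  classical
  rw [linForm_apply, coeff_sum] at h
  obtain ⟨l, _, hl⟩ := Finset.exists_ne_zero_of_sum_ne_zero h
  rw [coeff_smul, coeff_X, smul_eq_mul] at hl
  split_ifs at hl with e
  · exact ⟨l, by simpa using hl, e.symm⟩
  · exact absurd (mul_zero _) hl

theorem coeff_monomial_mul_linForm (γ : Fin r →₀ ℕ) (c : Fin r → A) (l : Fin r) :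
    coeff (γ + Finsupp.single l 1) (monomial γ 1 * linForm c) = c l := by
  rw [coeff_monomial_mul, one_mul, coeff_linForm]

theorem coeff_monomial_mul_linForm_ne_zero {γ β : Fin r →₀ ℕ} {c : Fin r → A}
    (h : coeff β (monomial γ 1 * linForm c) ≠ 0) :
    ∃ l, c l ≠ 0 ∧ β = γ + Finsupp.single l 1 := by
  rw [coeff_monomial_mul'] at h
  split_ifs at h with hle
  · rw [one_mul] at h
    obtain ⟨l, hl, e⟩ := coeff_linForm_ne_zero h
    exact ⟨l, hl, by rw [← e, add_tsub_cancel_of_le hle]⟩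
  · exact absurd rfl h

theorem exists_sum_eq_of_mem_initSpan {i : Fin r} {w : A} (hw : w ∈ initSpan a i) :
    ∃ d : Fin r → A, (∀ l, ¬ l < i → d l = 0) ∧ ∑ l, d l * a l = w := by
  classical
  refine Submodule.span_induction (p := fun w _ => ∃ d : Fin r → A,
    (∀ l, ¬ l < i → d l = 0) ∧ ∑ l, d l * a l = w) ?_ ⟨0, by simp, by simp⟩ ?_ ?_ hw
  · rintro _ ⟨l, hl, rfl⟩
    refine ⟨Pi.single l 1, fun s hs => Pi.single_eq_of_ne (by rintro rfl; exact hs hl) _, ?_⟩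
    simp [Pi.single_apply]
  · rintro _ _ _ _ ⟨d, hd, rfl⟩ ⟨e, he, rfl⟩
    exact ⟨d + e, fun l hl => by simp [hd l hl, he l hl], by
      simp [add_mul, Finset.sum_add_distrib]⟩
  · rintro u _ _ ⟨d, hd, rfl⟩
    exact ⟨u • d, fun l hl => by simp [hd l hl], by simp [Finset.mul_sum, mul_assoc]⟩

/-- A relation `c a_i = ∑_{l < i} d_l a_l` witnessing `c ∈ (a₁, …, a_{i-1}) : a_i`. -/
theorem exists_relation_of_mem_colon {i : Fin r} {c : A}
    (hc : c ∈ (initSpan a i).colon {a i}) :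
    ∃ g : Fin r → A, g i = c ∧ (∀ l, i < l → g l = 0) ∧ ∑ l, g l * a l = 0 := by
  classical
  obtain ⟨d, hdlt, hd⟩ := exists_sum_eq_of_mem_initSpan (Submodule.mem_colon_singleton.1 hc)
  refine ⟨Pi.single i c - d, by simp [hdlt i (lt_irrefl i)], fun l hl => ?_, ?_⟩
  · simp [hdlt l hl.not_gt, hl.ne']
  · simp [sub_mul, Finset.sum_sub_distrib, hd, Pi.single_apply]

theorem mem_colon_of_relation {i : Fin r} {g : Fin r → A} (hg : ∀ l, i < l → g l = 0)
    (hrel : ∑ l, g l * a l = 0) : g i ∈ (initSpan a i).colon {a i} := by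
  classical
  refine Submodule.mem_colon_singleton.2 ?_
  rw [← Finset.add_sum_erase _ _ (Finset.mem_univ i)] at hrel
  rw [smul_eq_mul, eq_neg_of_add_eq_zero_left hrel, neg_mem_iff]
  refine sum_mem fun l hl => ?_
  rcases lt_or_ge l i with h | h
  · exact Ideal.mul_mem_left _ _ (Ideal.subset_span ⟨l, h, rfl⟩)
  · rw [hg l (lt_of_le_of_ne h (Finset.mem_erase.1 hl).1.symm), zero_mul]
    exact zero_mem _

/-- `y^α` is the leading monomial of the form `F`. -/
def IsLead (F : MvPolynomial (Fin r) A) (α : Fin r →₀ ℕ) : Prop :=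
  coeff α F ≠ 0 ∧ ∀ β, coeff β F ≠ 0 → toLex α ≤ toLex β

/-- Leading terms may be computed on homogeneous components. The inclusion `L_i y_i ⊆ in(J)` needs
no hypothesis, since every element of `L_i` is the coefficient of `y_i` in a linear relation ending
there. -/
theorem isStrongSSequence_of_isLead
    (hmono : Monotone fun i => (initSpan a i).colon {a i})
    (hlead : ∀ (k : ℕ) (F : MvPolynomial (Fin r) A), F.IsHomogeneous k → F ∈ symRelations a →
      ∀ α, IsLead F α → ∃ i, α i ≠ 0 ∧ coeff α F ∈ (initSpan a i).colon {a i}) :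
    IsStrongSSequence a := by
  classical
  refine ⟨le_antisymm (Ideal.span_le.2 ?_) (iSup_le fun i => ?_), hmono⟩
  · rintro _ ⟨p, hp, α, hα, hlt, rfl⟩
    have hc : ∀ β, coeff β (homogeneousComponent α.degree p) =
        if β.degree = α.degree then coeff β p else 0 := fun β => coeff_homogeneousComponent _ _ _
    obtain ⟨i, hi, hci⟩ := hlead α.degree _ (homogeneousComponent_isHomogeneous _ p)
      (homogeneousComponent_mem_symRelations hp _) α
      ⟨by rw [hc, if_pos rfl]; exact mem_support_iff.1 hα, fun β hβ => by
        rw [hc] at hβ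
        split_ifs at hβ with hd
        · rcases eq_or_ne β α with rfl | hne
          · exact le_rfl
          · exact ((revLexLT_iff hd).1 (hlt β (mem_support_iff.2 hβ) hne)).le
        · exact absurd rfl hβ⟩
    rw [hc, if_pos rfl] at hci
    refine Submodule.mem_iSup_of_mem i ?_
    have e : monomial α (coeff α p) =
        C (coeff α p) * X i * monomial (α - Finsupp.single i 1) 1 := by
      rw [mul_assoc, ← monomial_eq_X_mul hi, C_mul_monomial, mul_one]
    rw [e]
    exact Ideal.mul_mem_right _ _ (Ideal.mul_mem_mul (Ideal.mem_map_of_mem _ hci)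
      (Ideal.mem_span_singleton_self _))
  · rw [Ideal.map, Ideal.span_mul_span', Ideal.span_le]
    rintro _ ⟨_, ⟨c, hc, rfl⟩, _, rfl, rfl⟩
    obtain ⟨g, rfl, hg0, hrel⟩ := exists_relation_of_mem_colon hc
    by_cases hc0 : g i = 0
    · simp [hc0]
    refine Ideal.subset_span ⟨linForm g, linForm_mem_symRelations hrel, Finsupp.single i 1, ?_,
      fun β hβ hne => ?_, ?_⟩
    · rw [mem_support_iff, coeff_linForm]; exact hc0
    · obtain ⟨l, hl, rfl⟩ := coeff_linForm_ne_zero (mem_support_iff.1 hβ)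
      rw [revLexLT_iff (by simp), Finsupp.Lex.single_lt_iff]
      exact lt_of_le_of_ne (not_lt.1 fun h => hl (hg0 l h)) (by rintro rfl; exact hne rfl)
    · rw [coeff_linForm]
      exact C_mul_X_eq_monomial

/-- If `c * a i ∈ I_{i-1}`, then `c * a j` lies in `(I_{i-1} : a i) ∩ I`, which is `I_{i-1}`. -/
theorem IsDSequence.monotone_colon (ha : IsDSequence a) :
    Monotone fun i => (initSpan a i).colon {a i} := by
  intro i j hij c hc
  rcases hij.eq_or_lt with rfl | hij
  · exact hc
  have hmono : initSpan a i ≤ initSpan a j := by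
    refine Ideal.span_mono (Set.image_mono fun l hl => ?_)
    exact lt_trans (Set.mem_Iio.1 hl) hij
  have hc' := Submodule.mem_colon_singleton.1 hc
  refine Submodule.mem_colon_singleton.2 (hmono ?_)
  rw [← ha i]
  refine ⟨Submodule.mem_colon_singleton.2 ?_, ?_⟩
  · rw [smul_eq_mul, smul_eq_mul, mul_right_comm]
    exact Ideal.mul_mem_right _ _ hc'
  · exact Ideal.mul_mem_left _ _ (Ideal.subset_span ⟨j, rfl⟩)

/-- Let `i` be the smallest variable of the leading monomial. By reverse lexicographic order, `F =
y_i G` up to terms in earlier variables. The `c`-condition gives `Q` in the earlier variables with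
`Q(a) = G(a)`, so `G - Q` is a relation of smaller degree with the same leading coefficient; in
degree one the coefficient lies in `L_i` directly. -/
theorem IsCSequence.exists_coeff_mem_colon (ha : IsCSequence a) (k : ℕ) :
    ∀ F : MvPolynomial (Fin r) A, F.IsHomogeneous k → F ∈ symRelations a →
      ∀ α, IsLead F α → ∃ i, α i ≠ 0 ∧ coeff α F ∈ (initSpan a i).colon {a i} := by
  classical
  have hlin := (isLinearType_iff a).1 ha.isLinearType
  rw [isCSequence_iff_relInjective] at ha
  induction k with
  | zero =>
    intro F hF hFJ α hα
    have h0 := eval_eq_zero_of_mem_symRelations hFJ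
    rw [totalDegree_eq_zero_iff_eq_C.1 ((totalDegree_zero_iff_isHomogeneous _).2 hF), eval_C] at h0
    refine absurd ?_ hα.1
    rw [totalDegree_eq_zero_iff_eq_C.1 ((totalDegree_zero_iff_isHomogeneous _).2 hF), h0, C_0,
      coeff_zero]
  | succ k ih =>
    intro F hF hFJ α hα
    have hne : α.support.Nonempty := by
      obtain ⟨l, hl⟩ := exists_ne_zero_of_isHomogeneous hF (mem_support_iff.2 hα.1)
      exact ⟨l, by simpa using hl⟩
    set i := α.support.min' hne with hi
    have hαi : α i ≠ 0 := by simpa using α.support.min'_mem hne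
    have hαl : ∀ l < i, α l = 0 := fun l hl => by
      by_contra h
      exact absurd (Finset.min'_le _ l (by simpa using h)) (not_le.2 hl)
    have hFv : F ∈ varForms A {l : Fin r | l.val < i.val + 1} k := by
      refine mem_varForms_of_support hF fun β hβ => ?_
      by_cases h : ∃ l < i, β l ≠ 0
      · obtain ⟨l, hl, hl0⟩ := h
        exact ⟨l, (Fin.lt_def.1 hl).trans (Nat.lt_succ_self _), hl0⟩
      · push Not at h
        have := le_of_toLex_le (hα.2 β (mem_support_iff.1 hβ)) hαl h
        exact ⟨i, Nat.lt_succ_self _, by omega⟩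
    obtain ⟨G, hG, hP⟩ := exists_eq_X_mul_add i.isLt hFv
    rw [Fin.eta] at hP
    have hcoeff : ∀ β : Fin r →₀ ℕ, (∀ l < i, β l = 0) →
        coeff (β + Finsupp.single i 1) F = coeff β G := by
      intro β hβ
      have h0 : coeff (β + Finsupp.single i 1) (F - X i * G) = 0 := by
        by_contra h
        obtain ⟨l, hl, hl0⟩ := exists_ne_zero_of_mem_varForms hP h
        exact hl0 (by simp [hβ l hl, (Set.mem_Iio.1 hl).ne])
      rw [coeff_sub, sub_eq_zero, mul_comm, coeff_mul_X] at h0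
      exact h0
    set α' := α - Finsupp.single i 1 with hα'
    have hαα' : α' + Finsupp.single i 1 = α :=
      tsub_add_cancel_of_le (Finsupp.single_le_iff.2 (Nat.one_le_iff_ne_zero.2 hαi))
    have hα'l : ∀ l < i, α' l = 0 := fun l hl => by simp [hα', hαl l hl]
    have hcα : coeff α F = coeff α' G := by rw [← hcoeff α' hα'l, hαα']
    have hGa : a i * eval a G ∈ initSpan a i * Ideal.span (Set.range a) ^ k := by
      have := eval_mem_of_mem_varForms a hP
      rw [map_sub, eval_eq_zero_of_mem_symRelations hFJ, zero_sub, map_mul, eval_X,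
        neg_mem_iff] at this
      exact this
    cases k with
    | zero =>
      refine ⟨i, hαi, Submodule.mem_colon_singleton.2 ?_⟩
      have hGC := totalDegree_eq_zero_iff_eq_C.1 ((totalDegree_zero_iff_isHomogeneous _).2 hG)
      have hα0 : α' = 0 := by
        by_contra h
        rw [hGC, coeff_C, if_neg (Ne.symm h)] at hcα
        exact hα.1 hcα
      rw [hGC, eval_C, pow_zero, Ideal.one_eq_top, Ideal.mul_top] at hGa
      rw [hcα, hα0, smul_eq_mul, mul_comm]
      exact hGa
    | succ k =>
      obtain ⟨Q, hQ, hQa⟩ := exists_mem_varForms_eval a (ha i (k + 1) (by omega) _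
        ((Ideal.mem_span_pow_iff_exists_isHomogeneous a _).2 ⟨G, hG, rfl⟩) hGa)
      rw [Nat.add_sub_cancel] at hQ
      have hGQ := hG.sub (isHomogeneous_of_mem_varForms hQ)
      have hQ0 : ∀ β : Fin r →₀ ℕ, (∀ l < i, β l = 0) → coeff β Q = 0 := by
        intro β hβ
        by_contra h
        obtain ⟨l, hl, hl0⟩ := exists_ne_zero_of_mem_varForms hQ h
        exact hl0 (hβ l hl)
      have hcα' : coeff α' (G - Q) = coeff α F := by
        rw [coeff_sub, hQ0 α' hα'l, sub_zero, hcα]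
      obtain ⟨j, hj, hcj⟩ := ih (G - Q) hGQ (hlin _ _ hGQ (by rw [map_sub, hQa, sub_self])) α'
        ⟨by rw [hcα']; exact hα.1, fun β hβ => by
          by_cases h : ∃ l < i, β l ≠ 0
          · exact (toLex_lt_of_exists hα'l h).le
          · push Not at h
            rw [coeff_sub, hQ0 β h, sub_zero, ← hcoeff β h] at hβ
            have := hα.2 _ hβ
            rw [← hαα', toLex_add, toLex_add, add_le_add_iff_right] at this
            exact this⟩
      rw [hcα'] at hcj
      exact ⟨j, fun h => hj (by simp [hα', h]), hcj⟩

theorem IsDSequence.isStrongSSequence (ha : IsDSequence a) : IsStrongSSequence a :=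
  isStrongSSequence_of_isLead ha.monotone_colon ha.isCSequence.exists_coeff_mem_colon

end LeadingMonomials

/-! ### From strong `s`-sequences to `c`-sequences -/

section StrongSSequence

open MvPolynomial

variable {A : Type*} [CommRing A] {r : ℕ} {a : Fin r → A}

/-- A term of `in(J)` in variables up to `q` can only come from `L_j y_j` with `j ≤ q`, and then
`L_j ⊆ L_q`. -/
theorem IsStrongSSequence.coeff_mem_colon (ha : IsStrongSSequence a) {k : ℕ}
    {F : MvPolynomial (Fin r) A} (hF : F.IsHomogeneous k) (hFJ : F ∈ symRelations a)
    {α : Fin r →₀ ℕ} (hα : IsLead F α) {q : Fin r} (hq : ∀ i, α i ≠ 0 → i ≤ q) :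
    coeff α F ∈ (initSpan a q).colon {a q} := by
  classical
  let N : Ideal (MvPolynomial (Fin r) A) :=
    { carrier := {g | ∀ β : Fin r →₀ ℕ, (∀ i, β i ≠ 0 → i ≤ q) →
        coeff β g ∈ (initSpan a q).colon {a q}}
      add_mem' := fun hx hy β hβ => by
        rw [coeff_add]; exact add_mem (hx β hβ) (hy β hβ)
      zero_mem' := fun β _ => by rw [coeff_zero]; exact zero_mem _
      smul_mem' := fun p x hx β hβ => by
        rw [smul_eq_mul, coeff_mul]
        refine sum_mem fun s hs => Ideal.mul_mem_left _ _ (hx _ fun i hi => hβ i fun h => hi ?_)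
        rw [← Finset.HasAntidiagonal.mem_antidiagonal.1 hs, Finsupp.add_apply] at h
        omega }
  have hN : initialIdeal (symRelations a) ≤ N := by
    rw [ha.1]
    refine iSup_le fun j => ?_
    rw [Ideal.map, Ideal.span_mul_span', Ideal.span_le]
    rintro _ ⟨_, ⟨u, hu, rfl⟩, _, rfl, rfl⟩ β hβ
    simp only
    rw [coeff_C_mul, coeff_X]
    split_ifs with e
    · rw [mul_one]
      refine ha.2 (hβ j ?_) hu
      rw [← e]; simp
    · rw [mul_zero]; exact zero_mem _
  have hmem : monomial α (coeff α F) ∈ initialIdeal (symRelations a) := by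
    refine Ideal.subset_span ⟨F, hFJ, α, mem_support_iff.2 hα.1, fun β hβ hne => ?_, rfl⟩
    have hd : β.degree = α.degree := by
      have h1 := hF.degree_eq_sum_deg_support hβ
      have h2 := hF.degree_eq_sum_deg_support (mem_support_iff.2 hα.1)
      rw [← Finsupp.degree_apply] at h1 h2
      omega
    rw [revLexLT_iff hd]
    exact lt_of_le_of_ne (hα.2 β (mem_support_iff.1 hβ)) fun h => hne (toLex.injective h).symm
  have := hN hmem α hq
  rwa [coeff_monomial, if_pos rfl] at this

/-- The set `S` collects the monomials still allowed besides those involving a variable before `i`.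
Each round removes the `toLex`-smallest remaining monomial of `F` by a relation vanishing at `a`;
when none is left, `F` lies in `(y_l : l < i)` and its value has the required form. -/
theorem IsStrongSSequence.eval_mem (ha : IsStrongSSequence a)
    (hlin : IsLinearType (Ideal.span (Set.range a))) (i : Fin r) (k : ℕ)
    (S : Finset (Fin r →₀ ℕ)) :
    (∀ β ∈ S, ∀ β' : Fin r →₀ ℕ, β'.degree = k + 1 → toLex β ≤ toLex β' → β' ∈ S) →
    ∀ F : MvPolynomial (Fin r) A, F.IsHomogeneous (k + 1) →
      (∀ β ∈ F.support, β ∈ S ∨ ∃ l < i, β l ≠ 0) →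
      a i * eval a F ∈ initSpan a i * Ideal.span (Set.range a) ^ (k + 1) →
      eval a F ∈ initSpan a i * Ideal.span (Set.range a) ^ k := by
  classical
  induction S using Finset.strongInduction with
  | H S ih =>
    intro hS F hF hFS haF
    by_cases hbad : ∀ β ∈ F.support, ∃ l < i, β l ≠ 0
    · exact eval_mem_of_mem_varForms a (mem_varForms_of_support hF hbad)
    obtain ⟨α, hα, hmin⟩ := (F.support.filter fun β => ¬ ∃ l < i, β l ≠ 0).exists_min_image
      toLex (by push Not at hbad; obtain ⟨β, h1, h2⟩ := hbad; exact ⟨β, Finset.mem_filter.2 ⟨h1, by push Not; exact h2⟩⟩)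
    rw [Finset.mem_filter, mem_support_iff] at hα
    obtain ⟨hα0, hαl⟩ := hα
    have hαS := (hFS α (mem_support_iff.2 hα0)).resolve_right hαl
    push Not at hαl
    have hne : α.support.Nonempty := by
      obtain ⟨l, hl⟩ := exists_ne_zero_of_isHomogeneous hF (mem_support_iff.2 hα0)
      exact ⟨l, by simpa using hl⟩
    set q := α.support.max' hne with hq
    have hαq : α q ≠ 0 := by simpa using α.support.max'_mem hne
    have hqmax : ∀ l, α l ≠ 0 → l ≤ q := fun l hl => Finset.le_max' _ _ (by simpa using hl)
    have hiq : i ≤ q := not_lt.1 fun h => hαq (hαl q h)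
    obtain ⟨H, hH, hHa⟩ := exists_mem_varForms_eval a haF
    have hH0 : ∀ β : Fin r →₀ ℕ, (∀ l < i, β l = 0) → coeff β H = 0 := by
      intro β hβ
      by_contra h
      obtain ⟨l, hl, hl0⟩ := exists_ne_zero_of_mem_varForms hH h
      exact hl0 (hβ l hl)
    have hXF : (X i * F - H).IsHomogeneous (k + 1 + 1) := by
      refine IsHomogeneous.sub ?_ (isHomogeneous_of_mem_varForms hH)
      rw [add_comm (k + 1) 1]
      exact (isHomogeneous_X A i).mul hF
    have hα1 : ∀ l < i, (α + Finsupp.single i 1 : Fin r →₀ ℕ) l = 0 := fun l hl => by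
      simp [hαl l hl, hl.ne]
    have hcα : coeff (α + Finsupp.single i 1) (X i * F - H) = coeff α F := by
      rw [coeff_sub, hH0 _ hα1, sub_zero, mul_comm, coeff_mul_X]
    -- By linear type, `y_i F - H` is a relation with leading monomial `α y_i`. As `i ≤ q`, the
    -- largest variable of `α y_i` is still `q`.
    have hc : coeff α F ∈ (initSpan a q).colon {a q} := by
      rw [← hcα]
      refine ha.coeff_mem_colon hXF ((isLinearType_iff a).1 hlin _ _ hXF (by
        rw [map_sub, map_mul, eval_X, hHa, sub_self])) ⟨by rwa [hcα], fun β hβ => ?_⟩ fun l hl => ?_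
      · by_cases h : ∃ l < i, β l ≠ 0
        · exact (toLex_lt_of_exists hα1 h).le
        · push Not at h
          rw [coeff_sub, hH0 β h, sub_zero, coeff_X_mul'] at hβ
          split_ifs at hβ with hi
          · have hle := hmin (β - Finsupp.single i 1) (by
              rw [Finset.mem_filter, mem_support_iff]
              refine ⟨hβ, ?_⟩
              push Not
              exact fun l hl => by simp [h l hl])
            have e : β - Finsupp.single i 1 + Finsupp.single i 1 = β :=
              tsub_add_cancel_of_le (Finsupp.single_le_iff.2
                (Nat.one_le_iff_ne_zero.2 (by simpa using hi)))
            rw [← e, toLex_add, toLex_add, add_le_add_iff_right]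
            exact hle
          · exact absurd rfl hβ
      · rcases eq_or_ne l i with rfl | hli
        · exact hiq
        · exact hqmax l (by simpa [hli] using hl)
    obtain ⟨g, hgq, hg0, hrel⟩ := exists_relation_of_mem_colon hc
    set γ := α - Finsupp.single q 1 with hγ
    have hγα : γ + Finsupp.single q 1 = α :=
      tsub_add_cancel_of_le (Finsupp.single_le_iff.2 (Nat.one_le_iff_ne_zero.2 hαq))
    have hdα : α.degree = k + 1 := by
      have := hF.degree_eq_sum_deg_support (mem_support_iff.2 hα0)
      rw [← Finsupp.degree_apply] at this
      exact this.symm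
    have hdγ : γ.degree = k := by
      have := degree_tsub_single hαq
      rw [← hγ] at this
      omega
    have hM : eval a (monomial γ 1 * linForm g) = 0 := by
      rw [map_mul, eval_linForm, hrel, mul_zero]
    have hF' : (F - monomial γ 1 * linForm g).IsHomogeneous (k + 1) :=
      hF.sub ((isHomogeneous_monomial _ hdγ).mul (isHomogeneous_linForm g))
    have heval : eval a (F - monomial γ 1 * linForm g) = eval a F := by
      rw [map_sub, hM, sub_zero]
    rw [← heval] at haF ⊢
    refine ih (S.filter fun β => toLex α < toLex β) ?_ ?_ _ hF' ?_ haF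
    · exact Finset.filter_ssubset.2 ⟨α, hαS, lt_irrefl _⟩
    · intro β hβ β' hd hle
      rw [Finset.mem_filter] at hβ ⊢
      exact ⟨hS β hβ.1 β' hd hle, hβ.2.trans_le hle⟩
    · intro β hβ
      by_cases h : ∃ l < i, β l ≠ 0
      · exact Or.inr h
      · refine Or.inl ?_
        have hdβ : β.degree = k + 1 := by
          have := hF'.degree_eq_sum_deg_support hβ
          rw [← Finsupp.degree_apply] at this
          exact this.symm
        rw [mem_support_iff] at hβ
        have hlt : toLex α < toLex β := by
          rcases eq_or_ne β α with rfl | hβα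
          · refine absurd ?_ hβ
            have := coeff_monomial_mul_linForm γ g q
            rw [hγα, hgq] at this
            rw [coeff_sub, this, sub_self]
          · rw [coeff_sub] at hβ
            by_cases hβF : coeff β F = 0
            · rw [hβF, zero_sub, neg_ne_zero] at hβ
              obtain ⟨l, hl, rfl⟩ := coeff_monomial_mul_linForm_ne_zero hβ
              have hlq : l < q := lt_of_le_of_ne
                (not_lt.1 fun h => hl (hg0 l h)) (by rintro rfl; exact hβα hγα)
              rw [← hγα]
              exact toLex_add_single_lt γ hlq
            · exact lt_of_le_of_ne (hmin β (by
                rw [Finset.mem_filter, mem_support_iff]; exact ⟨hβF, h⟩))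
                fun e => hβα (toLex.injective e).symm
        exact Finset.mem_filter.2 ⟨hS α hαS β hdβ hlt.le, hlt⟩

theorem IsStrongSSequence.isCSequence (ha : IsStrongSSequence a)
    (hlin : IsLinearType (Ideal.span (Set.range a))) : IsCSequence a := by
  classical
  rw [isCSequence_iff_relInjective]
  intro i k hk w hw haw
  obtain ⟨k, rfl⟩ := Nat.exists_eq_add_of_le' hk
  obtain ⟨F, hF, rfl⟩ := (Ideal.mem_span_pow_iff_exists_isHomogeneous a _).1 hw
  have hD : ∀ β : Fin r →₀ ℕ, β ∈ (Finset.univ : Finset (Fin r)).finsuppAntidiag (k + 1) ↔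
      β.degree = k + 1 := fun β => by
    rw [Finset.mem_finsuppAntidiag, Finsupp.degree_eq_sum]
    simp
  refine ha.eval_mem hlin i k (Finset.univ.finsuppAntidiag (k + 1))
    (fun β _ β' h _ => (hD β').2 h) F hF (fun β hβ => Or.inl ((hD β).2 ?_)) haw
  have := hF.degree_eq_sum_deg_support hβ
  rw [← Finsupp.degree_apply] at this
  exact this.symm

end StrongSSequence

/-! ### Rewriting linear syzygies when H_1 is killed -/

section KoszulOne

open MvPolynomial

variable {A : Type*} [CommRing A] {r : ℕ} {a : Fin r → A}

theorem KillsKoszulOne.monotone_colon (ha : KillsKoszulOne a) :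
    Monotone fun i => (initSpan a i).colon {a i} := by
  intro i j hij c hc
  rcases hij.eq_or_lt with rfl | hij
  · exact hc
  obtain ⟨g, rfl, hg0, hrel⟩ := exists_relation_of_mem_colon hc
  obtain ⟨ε, halt, hdiag, hε0, hε⟩ := ha.exists_alternating hij hg0 hrel
  refine Submodule.mem_colon_singleton.2 ?_
  rw [smul_eq_mul, mul_comm, hε]
  refine sum_mem fun s _ => ?_
  rcases lt_or_ge s j with h | h
  · exact Ideal.mul_mem_left _ _ (Ideal.subset_span ⟨s, h, rfl⟩)
  · rw [hε0 _ _ (hij.trans_le h), zero_mul]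
    exact zero_mem _

/-- The span of the relations `y^β ∑_{l ≤ p} c_l y_l` with `y^β y_p ∈ S`. -/
noncomputable def relationSpan (a : Fin r → A) (S : Finset (Fin r →₀ ℕ)) : Submodule A (MvPolynomial (Fin r) A) :=
  Submodule.span A {P | ∃ (β : Fin r →₀ ℕ) (c : Fin r → A) (p : Fin r), (∀ l, p < l → c l = 0) ∧
    ∑ l, c l * a l = 0 ∧ β + Finsupp.single p 1 ∈ S ∧ P = monomial β 1 * linForm c}

theorem coeff_relationSpan {S : Finset (Fin r →₀ ℕ)} {γ : Fin r →₀ ℕ}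
    (hγ : ∀ β ∈ S, toLex γ < toLex β) {P : MvPolynomial (Fin r) A} (hP : P ∈ relationSpan a S) :
    coeff γ P = 0 := by
  refine Submodule.span_induction ?_ (coeff_zero _) (fun x y _ _ hx hy => ?_)
    (fun u x _ hx => ?_) hP
  · rintro _ ⟨β, c, p, hc, _, hS, rfl⟩
    by_contra h
    obtain ⟨l, hl, rfl⟩ := coeff_monomial_mul_linForm_ne_zero h
    have hlt := hγ _ hS
    rcases (not_lt.1 fun h => hl (hc l h) : l ≤ p).eq_or_lt with rfl | hlp
    · exact lt_irrefl _ hlt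
    · exact lt_asymm hlt (toLex_add_single_lt β hlp)
  · rw [coeff_add, hx, hy, add_zero]
  · rw [coeff_smul, hx, smul_zero]

/-- The Buchberger step: relations that share the top monomial `γ` but end at different variables
are all moved, modulo `relationSpan a S`, to the largest variable `q` of `γ`, where they combine
into a single one. -/
theorem KillsKoszulOne.exists_add_of_mem_relationSpan (ha : KillsKoszulOne a)
    {S : Finset (Fin r →₀ ℕ)} {γ : Fin r →₀ ℕ} {q : Fin r}
    (hS : ∀ β : Fin r →₀ ℕ, β.degree = γ.degree → toLex γ < toLex β → β ∈ S)
    (hq : γ q ≠ 0) (hqmax : ∀ l, γ l ≠ 0 → l ≤ q) {P : MvPolynomial (Fin r) A}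
    (hP : P ∈ relationSpan a (insert γ S)) :
    ∃ c : Fin r → A, (∀ l, q < l → c l = 0) ∧ ∑ l, c l * a l = 0 ∧
      P - monomial (γ - Finsupp.single q 1) 1 * linForm c ∈ relationSpan a S := by
  classical
  have hadd : ∀ {x y : MvPolynomial (Fin r) A},
      (∃ c : Fin r → A, (∀ l, q < l → c l = 0) ∧ ∑ l, c l * a l = 0 ∧
        x - monomial (γ - Finsupp.single q 1) 1 * linForm c ∈ relationSpan a S) →
      (∃ c : Fin r → A, (∀ l, q < l → c l = 0) ∧ ∑ l, c l * a l = 0 ∧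
        y - monomial (γ - Finsupp.single q 1) 1 * linForm c ∈ relationSpan a S) →
      ∃ c : Fin r → A, (∀ l, q < l → c l = 0) ∧ ∑ l, c l * a l = 0 ∧
        x + y - monomial (γ - Finsupp.single q 1) 1 * linForm c ∈ relationSpan a S := by
    rintro x y ⟨c, hc, hcr, hx⟩ ⟨d, hd, hdr, hy⟩
    refine ⟨c + d, fun l hl => by simp [hc l hl, hd l hl], ?_, ?_⟩
    · simp only [Pi.add_apply, add_mul, Finset.sum_add_distrib, hcr, hdr, add_zero]
    · rw [map_add, mul_add, add_sub_add_comm]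
      exact add_mem hx hy
  have hbase : ∀ {x : MvPolynomial (Fin r) A}, x ∈ relationSpan a S →
      ∃ c : Fin r → A, (∀ l, q < l → c l = 0) ∧ ∑ l, c l * a l = 0 ∧
        x - monomial (γ - Finsupp.single q 1) 1 * linForm c ∈ relationSpan a S := by
    intro x hx
    exact ⟨0, by simp, by simp, by simpa using hx⟩
  refine Submodule.span_induction (p := fun P _ => ∃ c : Fin r → A, (∀ l, q < l → c l = 0) ∧
    ∑ l, c l * a l = 0 ∧ P - monomial (γ - Finsupp.single q 1) 1 * linForm c ∈ relationSpan a S)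
    ?_ (hbase (zero_mem _)) (fun x y _ _ => hadd) ?_ hP
  · rintro _ ⟨β, c, p, hc, hcr, hβ, rfl⟩
    rcases Finset.mem_insert.1 hβ with hβ | hβ
    swap
    · exact hbase (Submodule.subset_span ⟨β, c, p, hc, hcr, hβ, rfl⟩)
    have hpq : p ≤ q := hqmax p (by rw [← hβ]; simp)
    rcases hpq.eq_or_lt with rfl | hpq
    · refine ⟨c, hc, hcr, ?_⟩
      rw [← hβ, add_tsub_cancel_right, sub_self]
      exact zero_mem _
    · have hβq : β q ≠ 0 := by
        rw [← hβ] at hq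
        simpa [hpq.ne] using hq
      obtain ⟨δ, rfl⟩ : ∃ δ, β = δ + Finsupp.single q 1 := ⟨β - Finsupp.single q 1,
        (tsub_add_cancel_of_le (Finsupp.single_le_iff.2 (Nat.one_le_iff_ne_zero.2 hβq))).symm⟩
      obtain ⟨ε, halt, hdiag, hε0, hε⟩ := ha.exists_alternating hpq hc hcr
      -- The rows `c_l e_q - ε_l` are themselves relations ending at `q`. The alternating part
      -- cancels in `∑ X l * linForm (e l)`, which leaves `X q * linForm c`. In the expansion, the
      -- term `l = p` keeps the top monomial `γ`, and those with `l < p` fall into `S`.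
      set e : Fin r → Fin r → A := fun l => Pi.single q (c l) - ε l with he
      have hesupp : ∀ l s, q < s → e l s = 0 := fun l s hs => by
        simp [he, hs.ne', hε0 l s (hpq.trans hs)]
      have herel : ∀ l, ∑ s, e l s * a s = 0 := fun l => by
        simp [he, sub_mul, Finset.sum_sub_distrib, ← hε l, Pi.single_apply, mul_comm (c l)]
      have hezero : ∀ l, p < l → e l = 0 := fun l hl => by
        funext s
        simp [he, hc l hl, halt l s, hε0 s l hl]
      have hsum : X q * linForm c = ∑ l, X l * linForm (e l) := by
        have halt0 : ∑ l, X l * linForm (ε l) = (0 : MvPolynomial (Fin r) A) := by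
          simp only [linForm_apply, Finset.mul_sum]
          rw [← Finset.sum_product']
          refine Finset.sum_involution (fun x _ => (x.2, x.1)) ?_ ?_ ?_ ?_
          · rintro ⟨l, s⟩ _
            simp only [halt s l, smul_eq_C_mul, map_neg]
            ring
          · rintro ⟨l, s⟩ _ hne heq
            obtain rfl : s = l := (Prod.mk.inj heq).1
            exact hne (by simp [hdiag])
          · simp
          · simp
        have : ∀ l, linForm (e l) = c l • X q - linForm (ε l) := fun l => by
          rw [he, map_sub]
          congr 1
          rw [linForm, Fintype.linearCombination_apply_single]
        simp only [this, mul_sub, Finset.sum_sub_distrib, halt0, sub_zero]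
        rw [linForm_apply, Finset.mul_sum]
        exact Finset.sum_congr rfl fun l _ => by simp only [smul_eq_C_mul]; ring
      have hexp : monomial (δ + Finsupp.single q 1) 1 * linForm c =
          ∑ l, monomial (δ + Finsupp.single l 1) 1 * linForm (e l) := by
        have hm : ∀ l, monomial (δ + Finsupp.single l 1) (1 : A) = monomial δ 1 * X l := fun l => by
          rw [X, monomial_mul, one_mul]
        simp only [hm, mul_assoc]
        rw [hsum, Finset.mul_sum]
      rw [hexp, ← Finset.add_sum_erase _ _ (Finset.mem_univ p)]
      refine hadd ⟨e p, hesupp p, herel p, ?_⟩ (hbase (sum_mem fun l hl => ?_))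
      · rw [← hβ, add_right_comm, add_tsub_cancel_right, sub_self]
        exact zero_mem _
      · by_cases hlp : p < l
        · rw [hezero l hlp, map_zero, mul_zero]; exact zero_mem _
        · have hlp' : l < p := lt_of_le_of_ne (not_lt.1 hlp) (Finset.mem_erase.1 hl).1
          refine Submodule.subset_span ⟨_, e l, q, hesupp l, herel l, hS _ ?_ ?_, rfl⟩
          · rw [← hβ]; simp
          · rw [← hβ, add_right_comm δ (Finsupp.single l 1)]
            exact toLex_add_single_lt _ hlp'
  · rintro u x _ ⟨c, hc, hcr, hx⟩
    refine ⟨u • c, fun l hl => by simp [hc l hl], ?_, ?_⟩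
    · simp only [Pi.smul_apply, smul_eq_mul, mul_assoc, ← Finset.mul_sum, hcr, mul_zero]
    · rw [map_smul, mul_smul_comm, ← smul_sub]
      exact Submodule.smul_mem _ _ hx

/-- Induction on the set of admissible top monomials. At the `toLex`-minimal `γ`, the coefficient is
the last entry of one relation ending at `q`: if nonzero it is the leading coefficient and lies in
`L_q`, otherwise `γ` can be discarded. -/
theorem KillsKoszulOne.exists_coeff_mem_colon_of_mem_relationSpan (ha : KillsKoszulOne a) (k : ℕ)
    (S : Finset (Fin r →₀ ℕ)) :
    (∀ β ∈ S, β.degree = k + 1) →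
    (∀ β ∈ S, ∀ β' : Fin r →₀ ℕ, β'.degree = k + 1 → toLex β ≤ toLex β' → β' ∈ S) →
    ∀ F ∈ relationSpan a S, ∀ α, IsLead F α →
      ∃ i, α i ≠ 0 ∧ coeff α F ∈ (initSpan a i).colon {a i} := by
  classical
  induction S using Finset.strongInduction with
  | H S ih =>
    intro hSd hS F hF α hα
    rcases S.eq_empty_or_nonempty with rfl | hne
    · have : F = 0 := by
        simpa [relationSpan] using hF
      exact absurd (by rw [this, coeff_zero]) hα.1
    obtain ⟨γ, hγ, hmin⟩ := S.exists_min_image toLex hne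
    have hlt : ∀ β ∈ S.erase γ, toLex γ < toLex β := fun β hβ =>
      lt_of_le_of_ne (hmin β (Finset.mem_erase.1 hβ).2)
        fun e => (Finset.mem_erase.1 hβ).1 (toLex.injective e).symm
    have hγne : γ.support.Nonempty := by
      rw [Finsupp.support_nonempty_iff]
      rintro rfl
      simpa using hSd 0 hγ
    set q := γ.support.max' hγne with hq
    have hγq : γ q ≠ 0 := by simpa using γ.support.max'_mem hγne
    have hqmax : ∀ l, γ l ≠ 0 → l ≤ q := fun l hl => Finset.le_max' _ _ (by simpa using hl)
    have hgt : ∀ β : Fin r →₀ ℕ, β.degree = γ.degree → toLex γ < toLex β → β ∈ S.erase γ :=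
      fun β hd h => Finset.mem_erase.2 ⟨by rintro rfl; exact lt_irrefl _ h,
        hS γ hγ β (hd.trans (hSd γ hγ)) h.le⟩
    rw [← Finset.insert_erase hγ] at hF
    obtain ⟨c, hc, hcr, hu⟩ := ha.exists_add_of_mem_relationSpan hgt hγq hqmax hF
    set δ := γ - Finsupp.single q 1 with hδ
    have hδγ : δ + Finsupp.single q 1 = γ :=
      tsub_add_cancel_of_le (Finsupp.single_le_iff.2 (Nat.one_le_iff_ne_zero.2 hγq))
    have hcγ : coeff γ F = c q := by
      have h0 := coeff_relationSpan hlt hu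
      have h1 := coeff_monomial_mul_linForm δ c q
      rw [hδγ] at h1
      rw [coeff_sub, h1, sub_eq_zero] at h0
      exact h0
    by_cases hcq : c q = 0
    · refine ih (S.erase γ) (Finset.erase_ssubset hγ) (fun β hβ => hSd β (Finset.mem_erase.1 hβ).2)
        (fun β hβ β' hd hle => hgt β' (hd.trans (hSd γ hγ).symm) ((hlt β hβ).trans_le hle))
        F ?_ α hα
      -- With `c q = 0` the relation ends at `q - 1`, so its top monomial `δ y_{q-1}` belongs to `S`
      -- without `γ`. If `q` is the first variable, the relation is zero.
      have hM : monomial δ 1 * linForm c ∈ relationSpan a (S.erase γ) := by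
        by_cases hq0 : q.val = 0
        · have : c = 0 := by
            funext l
            rcases eq_or_ne l q with rfl | hl
            · exact hcq
            · refine hc l (Fin.lt_def.2 ?_)
              have : l.val ≠ q.val := fun h => hl (Fin.ext h)
              omega
          rw [this, map_zero, mul_zero]
          exact zero_mem _
        · have hlq : (⟨q.val - 1, by omega⟩ : Fin r) < q :=
            Fin.lt_def.2 (show q.val - 1 < q.val by omega)
          refine Submodule.subset_span ⟨δ, c, ⟨q.val - 1, by omega⟩, fun l hl => ?_, hcr,
            hgt _ ?_ ?_, rfl⟩
          · rcases eq_or_ne l q with rfl | hlq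
            · exact hcq
            · refine hc l (Fin.lt_def.2 ?_)
              have h1 : q.val - 1 < l.val := Fin.lt_def.1 hl
              have h2 : l.val ≠ q.val := fun h => hlq (Fin.ext h)
              omega
          · have := congrArg Finsupp.degree hδγ
            rw [map_add, Finsupp.degree_single] at this
            rw [map_add, Finsupp.degree_single, this]
          · exact lt_of_eq_of_lt (congrArg toLex hδγ.symm) (toLex_add_single_lt δ hlq)
      have := add_mem hu hM
      rwa [sub_add_cancel] at this
    · have hle : ∀ β, coeff β F ≠ 0 → toLex γ ≤ toLex β := by
        intro β hβ
        by_contra h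
        rw [not_le] at h
        refine hβ (coeff_relationSpan (S := insert γ (S.erase γ)) (fun β' hβ' => ?_) hF)
        rw [Finset.insert_erase hγ] at hβ'
        exact h.trans_le (hmin β' hβ')
      obtain rfl : α = γ := toLex.injective
        (le_antisymm (hα.2 γ (by rwa [hcγ])) (hle α hα.1))
      exact ⟨q, hγq, by rw [hcγ]; exact mem_colon_of_relation hc hcr⟩

theorem KillsKoszulOne.isStrongSSequence (ha : KillsKoszulOne a) : IsStrongSSequence a := by
  classical
  refine isStrongSSequence_of_isLead ha.monotone_colon fun k F hF hFJ α hα => ?_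
  have hFspan := homogeneousComponent_mem_span hFJ k
  rw [homogeneousComponent_of_mem hF, if_pos rfl] at hFspan
  cases k with
  | zero =>
    have : F = 0 := by simpa using hFspan
    exact absurd (by rw [this, coeff_zero]) hα.1
  | succ k =>
    have hD : ∀ β : Fin r →₀ ℕ, β ∈ (Finset.univ : Finset (Fin r)).finsuppAntidiag (k + 1) ↔
        β.degree = k + 1 := fun β => by
      rw [Finset.mem_finsuppAntidiag, Finsupp.degree_eq_sum]
      simp
    refine ha.exists_coeff_mem_colon_of_mem_relationSpan k (Finset.univ.finsuppAntidiag (k + 1))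
      (fun β => (hD β).1) (fun β _ β' h _ => (hD β').2 h) F ?_ α hα
    refine Submodule.span_mono ?_ hFspan
    rintro _ ⟨β, c, hd, hcr, rfl⟩
    obtain ⟨l, hl⟩ := exists_ne_zero_of_isHomogeneous hF (mem_support_iff.2 hα.1)
    refine ⟨β, c, ⟨r - 1, by have := l.isLt; omega⟩, fun s hs => ?_, hcr, (hD _).2 (by simp [hd]),
      rfl⟩
    have h1 : r - 1 < s.val := Fin.lt_def.1 hs
    exact absurd s.isLt (by omega)

end KoszulOne

/-! ### The equivalences -/

theorem isNoetherianRing_of_isStandardGraded {K A : Type*} [Field K] [CommRing A] [Algebra K A]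
    {𝒜 : ℕ → Submodule K A} (h𝒜 : IsStandardGraded 𝒜) : IsNoetherianRing A := by
  have hfin := h𝒜.finite_degree_one
  obtain ⟨s, hs⟩ := (Module.Finite.iff_fg (N := 𝒜 1)).1 hfin
  have : Algebra.FiniteType K A := ⟨⟨s, by
    rw [← Algebra.adjoin_span, hs, h𝒜.adjoin_degree_one]⟩⟩
  exact Algebra.FiniteType.isNoetherianRing K A

theorem mainTheorem1 {K A : Type*} [Field K] [Infinite K] [CommRing A] [Nontrivial A] [Algebra K A]
    (𝒜 : ℕ → Submodule K A) [GradedAlgebra 𝒜] (h𝒜 : IsStandardGraded 𝒜)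
    (I : Ideal A) (hI : I.IsHomogeneous 𝒜)
    {n m : ℕ} (x : Fin n → A) (hx : Submodule.span K (Set.range x) = 𝒜 1)
    (f : Fin m → I) (hf : ∀ j, SetLike.IsHomogeneousElem 𝒜 (f j : A))
    (hfI : Ideal.span (Set.range fun j => (f j : A)) = I) :
    List.TFAE [
      yRegularity x f = 0,
      IsGeneratedBy IsDSequence I,
      IsGeneratedBy IsStrongSSequence I ∧ IsLinearType I,
      IsGeneratedBy IsCSequence I,
      IsGeneratedBy IsProperSequence I ∧ IsLinearType I,
      IsGeneratedBy IsWeakRelativeRegularSequence I ∧ IsLinearType I] := by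
  have hnoeth : IsNoetherianRing A := isNoetherianRing_of_isStandardGraded h𝒜
  have hx1 : ∀ l, x l ∈ 𝒜 1 := fun l => hx ▸ Submodule.subset_span ⟨l, rfl⟩
  have hreg := yRegularity_eq_zero_iff_koszulLinear 𝒜 hI inferInstance hx1 hf
  -- The only implication that uses the infinite field: generic generators are filter-regular, and
  -- linearity passes from `f` to them.
  tfae_have 1 → 2 := fun h => by
    obtain ⟨r, z, hz, hzreg⟩ := exists_filterRegular_sequence (K := K) hfI
    exact ⟨r, z, hz, isDSequence_of_koszulLinear hz hzreg
      (KoszulLinear.of_span_eq hfI hz (hreg.1 h))⟩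
  tfae_have 2 → 3 := by
    rintro ⟨r, a, rfl, ha⟩
    exact ⟨⟨r, a, rfl, ha.isStrongSSequence⟩, ha.isCSequence.isLinearType⟩
  tfae_have 3 → 4 := by
    rintro ⟨⟨r, a, rfl, ha⟩, hlin⟩
    exact ⟨r, a, rfl, ha.isCSequence hlin⟩
  tfae_have 4 → 1 := by
    rintro ⟨r, a, rfl, ha⟩
    exact hreg.2 (KoszulLinear.of_span_eq rfl hfI
      (koszulLinear_of_relInjective rfl (isCSequence_iff_relInjective.1 ha)))
  tfae_have 4 → 5 := by
    rintro ⟨r, a, rfl, ha⟩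
    exact ⟨⟨r, a, rfl, ha.isProperSequence⟩, ha.isLinearType⟩
  tfae_have 4 → 6 := by
    rintro ⟨r, a, rfl, ha⟩
    exact ⟨⟨r, a, rfl, ha.isWeakRelativeRegularSequence⟩, ha.isLinearType⟩
  tfae_have 5 → 3 := by
    rintro ⟨⟨r, a, rfl, ha⟩, hlin⟩
    exact ⟨⟨r, a, rfl, ha.killsKoszulOne.isStrongSSequence⟩, hlin⟩
  tfae_have 6 → 3 := by
    rintro ⟨⟨r, a, rfl, ha⟩, hlin⟩
    exact ⟨⟨r, a, rfl, ha.killsKoszulOne.isStrongSSequence⟩, hlin⟩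
  tfae_finish
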